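/- **Setting.** In weighted set cover we are given sets $S_1,\dots,S_n\subseteq[m]$, $m\ge 1$, with $\bigcup_i S_i=[m]$ and weights $w_1,\dots,w_n\in\mathbb R_{>0}$. A cover is a set $X\subseteq[n]$ with $\bigcup_{i\in X}S_i=[m]$; its weight is $w(X)=\sum_{i\in X}w_i$. For $j\in[m]$ let $T_j=\{i: j\in S_i\}$, and let $f=\max_j|T_j|$. An $f$-approximation is a cover $X$ with $w(X)\le f\,w(Y)$ for every cover $Y$. The instance is a *vertex cover instance* if $f=2$ and the sets $T_j$ are pairwise distinct (the sets are the vertices, and the elements the edges, of a graph without parallel edges). **Model.** Let $0<\mu<c$, $m\le n^{1+c}$ and $s=\lceil n^{1+\mu}\rceil$. There are $\lceil m/s\rceil$ machines, each of which knows its own number, the number of machines, $n$, $m$ and $s$. Element $j$ is stored, together with $T_j$, on an arbitrary machine, subject to at most $s$ elements per machine; each weight $w_i$ is stored, with its index $i$, on an arbitrary machine. Computation proceeds in synchronous rounds. In each round every machine applies one and the same program, independent of the instance and of $c,\mu$, to its state, the messages just received and $s$ fresh uniformly random words, and produces a new state and messages to other machines, which are delivered before the next round. A word holds a natural number less than $n+m+s+2$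 or one real number, and the only real numbers kept or sent between rounds are input weights. The memory of a machine is the peak number of words in use during its local computation, including its state and the messages received and sent. After the last round one central machine outputs a set $X\subseteq[n]$. **Theorem.** There are a MapReduce algorithm and an absolute constant $K$ such that for all real $0<\mu<c$, every weighted set cover instance with $m\le n^{1+c}$, and every such placement of the input, the following holds with probability at least $1-K\,\frac c\mu\,e^{-n}$ after $R$ rounds: every machine has used at most $K\cdot f\cdot n^{1+\mu}$ words of memory and at most $(n+m+s+2)^K$ steps for each of its local computations, and the output is an $f$-approximation to the minimum weight set cover. Here * $R=\lfloor K\,c/\mu\rfloor$ if the instance is a vertex cover instance, and * $R=\lfloor K\,(c/\mu)^2\rfloor$ for every instance, in particular whenever $f>2$. -/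

import Mathlib

open Finset

/-! ## Weighted set cover -/

/-- A weighted set cover instance: `n` sets `S i` over the ground set `Fin m`, with positive real
weights, whose union is the ground set. -/
structure SetCover (n m : ℕ) where
  S : Fin n → Finset (Fin m)
  w : Fin n → ℝ
  w_pos : ∀ i, 0 < w i
  feasible : ∀ j, ∃ i, j ∈ S i

namespace SetCover

variable {n m : ℕ}

/-- `T j`: the (indices of the) sets that contain the element `j`. -/
def T (I : SetCover n m) (j : Fin m) : Finset (Fin n) := univ.filter fun i => j ∈ I.S i

/-- `f`: the maximum frequency of an element. -/
def maxFreq (I : SetCover n m) : ℕ := univ.sup fun j => (I.T j).card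

/-- `X` is a cover. -/
def IsCover (I : SetCover n m) (X : Finset (Fin n)) : Prop := ∀ j, ∃ i ∈ X, j ∈ I.S i

/-- The total weight of `X`. -/
noncomputable def cost (I : SetCover n m) (X : Finset (Fin n)) : ℝ := ∑ i ∈ X, I.w i

/-- `X` is a cover whose weight is at most `α` times the minimum weight of a cover. -/
def IsApprox (I : SetCover n m) (α : ℝ) (X : Finset (Fin n)) : Prop :=
  I.IsCover X ∧ ∀ Y, I.IsCover Y → I.cost X ≤ α * I.cost Y

/-- The instance is a vertex cover instance: `f = 2`, and the elements, as collections of at most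
two sets (edges between vertices), are pairwise distinct (no parallel edges). -/
def IsVertexCoverInstance (I : SetCover n m) : Prop := I.maxFreq = 2 ∧ Function.Injective I.T

end SetCover

namespace MapReduce

/-! ## Local computations

The functions that the machines compute are given by codes in a small first-order language over
natural numbers, real numbers, pairs and lists, with an explicit count of time and space.  A code is
one finite text that serves inputs of all sizes.

There are two types of real numbers.  `wt` is the type of the weights in the input; such a number can
be copied, stored, sent, and read into a `real`.  The type `real` is for the results of arithmetic
on weights; these may be used during a local computation only.  Storing and sending nothing but
natural numbers and input weights between rounds prevents one real number from carrying many words.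
-/

/-- Data types. -/
inductive Ty : Type
  | nat : Ty
  | wt : Ty
  | real : Ty
  | prod : Ty → Ty → Ty
  | list : Ty → Ty

namespace Ty

/-- The values of a data type. -/
@[reducible] def den : Ty → Type
  | nat => ℕ
  | wt => ℝ
  | real => ℝ
  | prod a b => a.den × b.den
  | list a => List a.den

/-- Data that may be kept or sent between rounds: no `real` in it. -/
def Storable : Ty → Prop
  | nat => True
  | wt => True
  | real => False
  | prod a b => a.Storable ∧ b.Storable
  | list a => a.Storable

/-- The size of a value in words, a word being able to hold the natural numbers below `B` or one real
number.  (A natural number `x` takes as many words as it has digits in base `B`.) -/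
def size (B : ℕ) : (a : Ty) → a.den → ℕ
  | nat, x => Nat.log B x + 1
  | wt, _ => 1
  | real, _ => 1
  | prod a b, x => a.size B x.1 + b.size B x.2
  | list a, x => (List.map (a.size B) x).sum + 1

end Ty

open Ty

/-- Elementary operations. -/
inductive Prim : Ty → Ty → Type
  | id {a : Ty} : Prim a a
  | fst {a b : Ty} : Prim (prod a b) a
  | snd {a b : Ty} : Prim (prod a b) b
  | nil {a b : Ty} : Prim a (list b)
  | cons {a : Ty} : Prim (prod a (list a)) (list a)
  | const {a : Ty} (k : ℕ) : Prim a nat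
  | add : Prim (prod nat nat) nat
  | sub : Prim (prod nat nat) nat
  | mul : Prim (prod nat nat) nat
  | div : Prim (prod nat nat) nat
  | le : Prim (prod nat nat) nat
  | read : Prim wt real
  | rzero {a : Ty} : Prim a real
  | radd : Prim (prod real real) real
  | rsub : Prim (prod real real) real
  | rle : Prim (prod real real) nat

open Classical in
/-- The value of an elementary operation; comparisons return `1` or `0`, and subtraction and division
of natural numbers are truncated. -/
noncomputable def Prim.eval : {a b : Ty} → Prim a b → a.den → b.den
  | _, _, .id, x => x
  | _, _, .fst, x => x.1
  | _, _, .snd, x => x.2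
  | _, _, .nil, _ => []
  | _, _, .cons, x => x.1 :: x.2
  | _, _, .const k, _ => k
  | _, _, .add, x => x.1 + x.2
  | _, _, .sub, x => x.1 - x.2
  | _, _, .mul, x => x.1 * x.2
  | _, _, .div, x => x.1 / x.2
  | _, _, .le, x => if x.1 ≤ x.2 then 1 else 0
  | _, _, .read, x => x
  | _, _, .rzero, _ => (0 : ℝ)
  | _, _, .radd, x => x.1 + x.2
  | _, _, .rsub, x => x.1 - x.2
  | _, _, .rle, x => if x.1 ≤ x.2 then 1 else 0

/-- Codes.  `pair p q` computes both results; `ite t p q` branches on whether the result of `t` is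
nonzero; `fold p` runs through a list and updates an accumulator by `p`, which sees the (fixed)
environment, the current entry and the accumulator; `loop p` does the same with the numbers
`0, …, k - 1` in place of the entries of a list. -/
inductive Code : Ty → Ty → Type
  | prim {a b : Ty} (p : Prim a b) : Code a b
  | comp {a b c : Ty} (q : Code b c) (p : Code a b) : Code a c
  | pair {a b c : Ty} (p : Code a b) (q : Code a c) : Code a (prod b c)
  | ite {a b : Ty} (t : Code a nat) (p q : Code a b) : Code a b
  | fold {e a b : Ty} (p : Code (prod e (prod a b)) b) : Code (prod e (prod (list a) b)) b
  | loop {e b : Ty} (p : Code (prod e (prod nat b)) b) : Code (prod e (prod nat b)) b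

/-- The number of steps of an iteration along a list with body `g`, if one run of the body takes
`t` steps. -/
def iterTime {α β : Type} (g : β → α → β) (t : β → α → ℕ) : β → List α → ℕ
  | _, [] => 1
  | y, x :: l => t y x + iterTime g t (g y x) l + 1

/-- The peak space of an iteration along a list with body `g`, if one run of the body takes space
`s`, and the final accumulator takes space `z`. -/
def iterSpace {α β : Type} (g : β → α → β) (s : β → α → ℕ) (z : β → ℕ) : β → List α → ℕ
  | y, [] => z y
  | y, x :: l => max (s y x) (iterSpace g s z (g y x) l)

namespace Code

/-- The function computed by a code. -/
noncomputable def eval : {a b : Ty} → Code a b → a.den → b.den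
  | _, _, .prim p, x => p.eval x
  | _, _, .comp q p, x => q.eval (p.eval x)
  | _, _, .pair p q, x => (p.eval x, q.eval x)
  | _, _, .ite t p q, x => if (show ℕ from t.eval x) ≠ 0 then p.eval x else q.eval x
  | _, _, .fold p, x => List.foldl (fun y z => p.eval (x.1, z, y)) x.2.2 x.2.1
  | _, _, .loop p, x => List.foldl (fun y i => p.eval (x.1, i, y)) x.2.2 (List.range x.2.1)

/-- The number of steps that a code takes on a given input. -/
noncomputable def time : {a b : Ty} → Code a b → a.den → ℕ
  | _, _, .prim _, _ => 1
  | _, _, .comp q p, x => p.time x + q.time (p.eval x) + 1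
  | _, _, .pair p q, x => p.time x + q.time x + 1
  | _, _, .ite t p q, x =>
      t.time x + (if (show ℕ from t.eval x) ≠ 0 then p.time x else q.time x) + 1
  | _, _, .fold p, x =>
      iterTime (fun y z => p.eval (x.1, z, y)) (fun y z => p.time (x.1, z, y)) x.2.2 x.2.1
  | _, _, .loop p, x =>
      iterTime (fun y i => p.eval (x.1, i, y)) (fun y i => p.time (x.1, i, y)) x.2.2
        (List.range x.2.1)

/-- The peak number of words (for word capacity `B`) in use while a code runs on a given input,
including the input, the output and everything that is kept for later during sub-computations. -/
noncomputable def space (B : ℕ) : {a b : Ty} → Code a b → a.den → ℕ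
  | a, b, .prim p, x => a.size B x + b.size B (p.eval x)
  | _, _, .comp q p, x => max (p.space B x) (q.space B (p.eval x))
  | a, _, .pair (b := b) p q, x =>
      max (a.size B x + p.space B x) (b.size B (p.eval x) + q.space B x)
  | a, _, .ite t p q, x =>
      max (a.size B x + t.space B x)
        (if (show ℕ from t.eval x) ≠ 0 then p.space B x else q.space B x)
  | _, _, .fold (e := e) (a := a) (b := b) p, x =>
      e.size B x.1 + (list a).size B x.2.1 +
        iterSpace (fun y z => p.eval (x.1, z, y)) (fun y z => p.space B (x.1, z, y)) (b.size B)
          x.2.2 x.2.1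
  | _, _, .loop (e := e) (b := b) p, x =>
      e.size B x.1 + nat.size B x.2.1 +
        iterSpace (fun y i => p.eval (x.1, i, y)) (fun y i => p.space B (x.1, i, y)) (b.size B)
          x.2.2 (List.range x.2.1)

end Code

/-! ## MapReduce algorithms for set cover -/

/-- The initial local data of a machine: its own number, the number of machines, `n`, `m`, and the
memory parameter `s`; then the elements `j` stored on it, each with the list of the sets that contain
`j`; then the indices of the sets whose weight is stored on it, each with the weight. -/
@[reducible] def inputTy : Ty :=
  prod (prod nat (prod nat (prod nat (prod nat nat))))
    (prod (list (prod nat (list nat))) (list (prod nat wt)))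

/-- A MapReduce algorithm: all machines run the same codes.  In every round a machine takes its
state, the list of messages it received and fresh random words, and computes its new state and a list
of messages, each with the number of the recipient.  When the run is over, machine `0` computes the
output, a list of indices of sets. -/
structure Algorithm where
  state : Ty
  msg : Ty
  state_storable : state.Storable
  msg_storable : msg.Storable
  init : Code inputTy state
  step : Code (prod state (prod (list msg) (list nat))) (prod state (list (prod nat msg)))
  output : Code state (list nat)

/-- The memory parameter `n ^ (1 + μ)`, rounded up. -/
noncomputable def memUnit (n : ℕ) (μ : ℝ) : ℕ := ⌈(n : ℝ) ^ (1 + μ)⌉₊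

/-- The number of machines: `m / s` rounded up (for `m, s ≥ 1`). -/
def numMachines (m s : ℕ) : ℕ := (m - 1) / s + 1

instance (m s : ℕ) : NeZero (numMachines m s) := ⟨Nat.succ_ne_zero _⟩

/-- The capacity of a word: a word holds a natural number below `n + m + s + 2`. -/
def wordCap (n m s : ℕ) : ℕ := n + m + s + 2

/-- A placement of the input on the machines: elements and weights are assigned to machines
arbitrarily, except that no machine is assigned more than `s` elements. -/
structure Placement (n m s : ℕ) where
  elt : Fin m → Fin (numMachines m s)
  set : Fin n → Fin (numMachines m s)
  balanced : ∀ k, (univ.filter fun j => elt j = k).card ≤ s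

/-- The random words used in `R` rounds: in every round, every machine gets `s` of them. -/
abbrev Tape (n m s R : ℕ) : Type :=
  Fin R → Fin (numMachines m s) → Fin s → Fin (wordCap n m s)

/-- The random words of machine `k` in round `r`, as a list. -/
def Tape.words {n m s R : ℕ} (ω : Tape n m s R) (r : ℕ) (k : Fin (numMachines m s)) : List ℕ :=
  if h : r < R then List.ofFn fun t => (ω ⟨r, h⟩ k t : ℕ) else []

/-- The local input of machine `k`. -/
def localInput {n m s : ℕ} (I : SetCover n m) (H : Placement n m s)
    (k : Fin (numMachines m s)) : inputTy.den :=
  (((k : ℕ), numMachines m s, n, m, s),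
    ((List.finRange m).filter fun j => decide (H.elt j = k)).map
      (fun j : Fin m => ((j : ℕ),
        ((List.finRange n).filter fun i => decide (i ∈ I.T j)).map (fun i : Fin n => (i : ℕ)))),
    ((List.finRange n).filter fun i => decide (H.set i = k)).map
      (fun i : Fin n => ((i : ℕ), I.w i)))

/-- A global configuration: the states of `M` machines and the messages waiting for them. -/
structure Config (P : Algorithm) (M : ℕ) where
  state : Fin M → P.state.den
  inbox : Fin M → List P.msg.den

namespace Algorithm

/-- What a machine in a given configuration feeds to its code in a round. -/
def stepInput (P : Algorithm) {M : ℕ} (C : Config P M) (ρ : Fin M → List ℕ) (k : Fin M) :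
    (prod P.state (prod (list P.msg) (list nat))).den :=
  (C.state k, C.inbox k, ρ k)

/-- One round: all machines compute, then the messages are delivered (in the order of the senders,
those of one sender in the order in which they were listed). -/
noncomputable def next (P : Algorithm) {M : ℕ} (C : Config P M) (ρ : Fin M → List ℕ) :
    Config P M where
  state k := (P.step.eval (P.stepInput C ρ k)).1
  inbox k := (List.finRange M).flatMap fun i =>
    (List.filter (fun z : ℕ × P.msg.den => decide (z.1 = (k : ℕ)))
      (P.step.eval (P.stepInput C ρ i)).2).map Prod.snd

variable {n m s R : ℕ}

/-- The configuration after `r` rounds. -/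
noncomputable def run (P : Algorithm) (I : SetCover n m) (H : Placement n m s)
    (ω : Tape n m s R) : ℕ → Config P (numMachines m s)
  | 0 => ⟨fun k => P.init.eval (localInput I H k), fun _ => []⟩
  | r + 1 => P.next (P.run I H ω r) (ω.words r)

/-- The collection of sets that is output after `R` rounds. -/
noncomputable def result (P : Algorithm) (I : SetCover n m) (H : Placement n m s)
    (ω : Tape n m s R) : Finset (Fin n) :=
  univ.filter fun i =>
    (i : ℕ) ∈ (show List ℕ from P.output.eval ((P.run I H ω R).state 0))

/-- Throughout the run of `R` rounds every machine uses at most `σ` words of memory, and at most `τ`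
steps for each of its local computations. -/
def Respects (P : Algorithm) (I : SetCover n m) (H : Placement n m s) (ω : Tape n m s R)
    (σ τ : ℝ) : Prop :=
  (∀ k, (P.init.space (wordCap n m s) (localInput I H k) : ℝ) ≤ σ ∧
    (P.init.time (localInput I H k) : ℝ) ≤ τ) ∧
  (∀ r < R, ∀ k,
    (P.step.space (wordCap n m s) (P.stepInput (P.run I H ω r) (ω.words r) k) : ℝ) ≤ σ ∧
    (P.step.time (P.stepInput (P.run I H ω r) (ω.words r) k) : ℝ) ≤ τ) ∧
  (P.output.space (wordCap n m s) ((P.run I H ω R).state 0) : ℝ) ≤ σ ∧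
    (P.output.time ((P.run I H ω R).state 0) : ℝ) ≤ τ

/-- The probability, over uniform random words, that the run of `R` rounds stays within memory `σ`
and local time `τ` on every machine and outputs an `α`-approximate set cover. -/
noncomputable def successProb (P : Algorithm) (I : SetCover n m) (H : Placement n m s) (R : ℕ)
    (σ τ α : ℝ) : ℝ :=
  (Nat.card {ω : Tape n m s R // P.Respects I H ω σ τ ∧ I.IsApprox α (P.result I H ω)} : ℝ) /
    Nat.card (Tape n m s R)

end Algorithm

end MapReduce

/-! The approximation comes from the local ratio method. To process an element, lower the residual
weights of the sets through it by their minimum. The sum `D` of all reductions is a lower bound for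
the weight of every cover, because a cover pays each reduction at least once; the total amount
removed is at most `f * D`, because a reduction touches at most `f` sets. Once every element lies in
a set of residual weight zero, those sets form an `f`-approximation (`LRInv.step`,
`LRInv.isApprox`). The order of the elements is irrelevant, and an element that already has a set of
residual zero changes nothing.

Only machine `0` runs local ratio. Every effective element drives a new set to zero, so at most `n`
elements need to be remembered. Residual weights may not be stored between rounds, so each phase
replays the remembered elements on the original weights; this reproduces the same state
(`lrRun_reverse_snd`).

A phase samples each uncovered element with probability `θ / B`, where `B` is the word capacity, and
processes the sample. Let `U` be the set of uncovered elements, and suppose `|U| * θ ≤ 4 * s * B`.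
The expected sample size is then at most `4 * s`, and an exponential moment shows that it exceeds `9
* s` with probability at most `exp (-n)` (`card_large_sample_le`). The new uncovered set is
determined by the chosen sets, for which there are at most `2 ^ n` possibilities, and it contains no
sampled element. A fixed candidate with `|U'| * θ > 2 * n * B` is missed by the sample with
probability at most `exp (-2n)`, so a union bound leaves `|U'| * θ ≤ 2 * n * B` except with
probability `exp (-n)` (`card_large_rest_le`). Multiplying `θ` by `2 * s / n` restores the first
inequality. The thresholds are therefore fixed in advance and no uncovered elements have to be
counted. They grow by at least `n ^ μ` per phase and reach `B` after at most `c / μ` phases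
(`exists_le_thetaSeq`); then everything left is sampled.

Between phases all machines must learn the chosen sets, a list of up to `n` indices. Sending the
whole list directly to `s` machines would exceed the memory. Instead a leader scatters it over a
group of up to `s` machines, and each member forwards its share to the whole group
(`groupOf_mul_length_share`). Three rounds multiply the number of informed machines by `s`, so a
broadcast takes `O(c / μ)` rounds in general (`exists_relay`), and one such step suffices for a
vertex cover instance, where `m ≤ n ^ 2`. This accounts for the two round bounds.

The resource bounds come from a calculus of codes with linear memory and polynomial time
(`Code.Lin`); the two messaging codes need extra information about addresses and group sizes
(`Code.Admissible`). -/

set_option linter.unusedSimpArgs false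

namespace MapReduce

open Ty

/-! ## Cost of codes -/

lemma Ty.one_le_size (B : ℕ) : ∀ (a : Ty) (x : a.den), 1 ≤ a.size B x
  | nat, _ => Nat.le_add_left _ _
  | wt, _ => le_rfl
  | real, _ => le_rfl
  | prod a _, x => (Ty.one_le_size B a x.1).trans (Nat.le_add_right _ _)
  | list _, _ => Nat.le_add_left _ _

lemma Ty.size_prod (B : ℕ) (a b : Ty) (x : (prod a b).den) :
    (prod a b).size B x = a.size B x.1 + b.size B x.2 := rfl

lemma Ty.size_nil (B : ℕ) (a : Ty) : (list a).size B [] = 1 := rfl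

lemma Ty.size_cons (B : ℕ) (a : Ty) (x : a.den) (l : List a.den) :
    (list a).size B (x :: l) = a.size B x + (list a).size B l := by
  simp only [Ty.size, List.map_cons, List.sum_cons]
  omega

lemma Ty.length_lt_size (B : ℕ) (a : Ty) (l : List a.den) : l.length + 1 ≤ (list a).size B l := by
  induction l with
  | nil => simp [Ty.size]
  | cons x l ih =>
    rw [Ty.size_cons, List.length_cons]
    have := Ty.one_le_size B a x
    omega

lemma Ty.size_append (B : ℕ) (a : Ty) (l l' : List a.den) :
    (list a).size B (l ++ l') + 1 = (list a).size B l + (list a).size B l' := by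
  simp only [Ty.size, List.map_append, List.sum_append]
  omega

lemma Ty.size_perm (B : ℕ) (a : Ty) {l l' : List a.den} (h : l.Perm l') :
    (list a).size B l = (list a).size B l' := by
  simp only [Ty.size, (h.map (a.size B)).sum_eq]

lemma Ty.size_mem_le (B : ℕ) (a : Ty) {l : List a.den} {x : a.den} (h : x ∈ l) :
    a.size B x + 1 ≤ (list a).size B l := by
  have := List.single_le_sum (by simp) _ (List.mem_map_of_mem (f := a.size B) h)
  exact Nat.add_le_add_right this 1

lemma Ty.size_list_le (B : ℕ) (a : Ty) {l : List a.den} {k : ℕ} (h : ∀ x ∈ l, a.size B x ≤ k) :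
    (list a).size B l ≤ l.length * k + 1 := by
  have := List.sum_le_card_nsmul (l.map (a.size B)) k (by simpa using h)
  simp only [List.length_map, smul_eq_mul] at this
  exact Nat.add_le_add_right this 1

lemma Ty.size_nat_of_lt {B x : ℕ} (h : x < B) : nat.size B x = 1 := by
  simp [Ty.size, h]

lemma Ty.size_nat_le {B x k : ℕ} (h : x < B ^ k) (hk : k ≠ 0) : nat.size B x ≤ k := by
  have : Nat.log B x < k := Nat.log_lt_of_lt_pow' hk h
  simpa [Ty.size] using this

lemma Ty.lt_pow_size {B : ℕ} (hB : 2 ≤ B) (x : ℕ) : x < B ^ nat.size B x :=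
  Nat.lt_pow_succ_log_self (by omega) x

lemma Ty.size_nat_mono {B x y : ℕ} (h : x ≤ y) : nat.size B x ≤ nat.size B y :=
  Nat.add_le_add_right (Nat.log_mono_right h) 1

namespace Code

/-- Bounds for the size of the output and the costs of a code on an input of size at most `N`. -/
structure Cost (B N C : ℕ) {a b : Ty} (p : Code a b) (x : a.den) : Prop where
  size_le : b.size B (p.eval x) ≤ C * N
  space_le : p.space B x ≤ C * N
  time_le : p.time x ≤ (C * N + 1) ^ C

/-- A code whose output and memory have size linear in the size of the input, and whose running time
is polynomial in it. -/
class Lin {a b : Ty} (p : Code a b) : Prop where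
  cost : ∃ C, ∀ B, 2 ≤ B → ∀ N x, a.size B x ≤ N → Cost B N C p x

lemma Cost.mono {B N C N' C' : ℕ} {a b : Ty} {p : Code a b} {x : a.den} (h : Cost B N C p x)
    (hN : N ≤ N') (hC : C ≤ C') : Cost B N' C' p x := by
  have := Nat.mul_le_mul hC hN
  exact ⟨h.size_le.trans this, h.space_le.trans this, h.time_le.trans
    ((Nat.pow_le_pow_left (by omega) _).trans (Nat.pow_le_pow_right (by omega) hC))⟩

/-- Running times are bounded by powers, and two runs plus one step must fit under a single power; a
base of at least `3` and one spare exponent are enough. The summand `2` in the constants of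
`Cost.comp`, `Cost.pair` and `Cost.ite` secures this base. -/
lemma pow_add_pow_add_one_le {b C D E : ℕ} (hb : 3 ≤ b) (h : C + D + 1 ≤ E) :
    b ^ C + b ^ D + 1 ≤ b ^ E := by
  have h1 : b ^ C ≤ b ^ (C + D) := Nat.pow_le_pow_right (by omega) (by omega)
  have h2 : b ^ D ≤ b ^ (C + D) := Nat.pow_le_pow_right (by omega) (by omega)
  have h3 : 1 ≤ b ^ (C + D) := Nat.one_le_pow _ _ (by omega)
  have h4 : b ^ (C + D + 1) ≤ b ^ E := Nat.pow_le_pow_right (by omega) h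
  rw [pow_succ] at h4
  nlinarith

lemma Cost.comp {B N C D : ℕ} {a b c : Ty} {p : Code a b} {q : Code b c} {x : a.den}
    (hN : 1 ≤ N) (hp : Cost B N C p x) (hq : Cost B (C * N) D q (p.eval x)) :
    Cost B N (C + D + D * C + 2) (comp q p) x := by
  have e : D * (C * N) = D * C * N := by ring
  have h1 : (C + D + D * C + 2) * N = C * N + D * N + D * C * N + 2 * N := by ring
  refine ⟨?_, ?_, ?_⟩
  · have := hq.size_le
    simp only [eval]
    omega
  · have h2 := hp.space_le
    have h3 := hq.space_le
    simp only [space]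
    omega
  · have h2 := hp.time_le
    have h3 := hq.time_le
    simp only [time]
    rw [e] at h3
    have h4 := h2.trans (Nat.pow_le_pow_left
      (show C * N + 1 ≤ (C + D + D * C + 2) * N + 1 by omega) _)
    have h5 := h3.trans (Nat.pow_le_pow_left
      (show D * C * N + 1 ≤ (C + D + D * C + 2) * N + 1 by omega) _)
    have := pow_add_pow_add_one_le (b := (C + D + D * C + 2) * N + 1) (C := C) (D := D)
      (E := C + D + D * C + 2) (by omega) (by omega)
    omega

lemma Cost.pair {B N C D : ℕ} {a b c : Ty} {p : Code a b} {q : Code a c} {x : a.den}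
    (hx : a.size B x ≤ N) (hp : Cost B N C p x) (hq : Cost B N D q x) :
    Cost B N (C + D + 2) (pair p q) x := by
  have hN := (Ty.one_le_size B a x).trans hx
  have h1 : (C + D + 2) * N = C * N + D * N + 2 * N := by ring
  have h2 := hp.size_le
  have h2' := hq.size_le
  have h3 := hp.space_le
  have h3' := hq.space_le
  refine ⟨?_, ?_, ?_⟩
  · simp only [eval, Ty.size]
    omega
  · simp only [space]
    omega
  · simp only [time]
    have h4 := hp.time_le.trans (Nat.pow_le_pow_left (show C * N + 1 ≤ (C + D + 2) * N + 1 by omega) _)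
    have h5 := hq.time_le.trans (Nat.pow_le_pow_left (show D * N + 1 ≤ (C + D + 2) * N + 1 by omega) _)
    have := pow_add_pow_add_one_le (b := (C + D + 2) * N + 1) (C := C) (D := D)
      (E := C + D + 2) (by omega) (by omega)
    omega

lemma Cost.ite {B N C D : ℕ} {a b : Ty} {t : Code a nat} {p q : Code a b} {x : a.den}
    (hx : a.size B x ≤ N) (ht : Cost B N C t x)
    (hp : t.eval x ≠ (0 : ℕ) → Cost B N D p x) (hq : t.eval x = (0 : ℕ) → Cost B N D q x) :
    Cost B N (C + D + 2) (ite t p q) x := by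
  have hN := (Ty.one_le_size B a x).trans hx
  have h1 : (C + D + 2) * N = C * N + D * N + 2 * N := by ring
  have h3 := ht.space_le
  have h4 := ht.time_le.trans (Nat.pow_le_pow_left (show C * N + 1 ≤ (C + D + 2) * N + 1 by omega) _)
  have h6 := pow_add_pow_add_one_le (b := (C + D + 2) * N + 1) (C := C) (D := D)
      (E := C + D + 2) (by omega) (by omega)
  by_cases h : t.eval x = (0 : ℕ)
  · have h' := hq h
    have := h'.size_le
    have := h'.space_le
    have := h'.time_le.trans (Nat.pow_le_pow_left (show D * N + 1 ≤ (C + D + 2) * N + 1 by omega) _)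
    refine ⟨?_, ?_, ?_⟩
    · simp only [eval, h, ne_eq, not_true_eq_false, if_false]
      omega
    · simp only [space, h, ne_eq, not_true_eq_false, if_false]
      omega
    · simp only [time, h, ne_eq, not_true_eq_false, if_false]
      omega
  · have h' := hp h
    have := h'.size_le
    have := h'.space_le
    have := h'.time_le.trans (Nat.pow_le_pow_left (show D * N + 1 ≤ (C + D + 2) * N + 1 by omega) _)
    refine ⟨?_, ?_, ?_⟩
    · simp only [eval, h, ne_eq, not_false_eq_true, if_true]
      omega
    · simp only [space, h, ne_eq, not_false_eq_true, if_true]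
      omega
    · simp only [time, h, ne_eq, not_false_eq_true, if_true]
      omega

instance {a b c : Ty} (p : Code a b) (q : Code b c) [hp : Lin p] [hq : Lin q] :
    Lin (comp q p) := by
  obtain ⟨C, hC⟩ := hp.cost
  obtain ⟨D, hD⟩ := hq.cost
  exact ⟨_, fun B hB N x hx => Cost.comp ((Ty.one_le_size B a x).trans hx) (hC B hB N x hx)
    (hD B hB _ _ (hC B hB N x hx).size_le)⟩

instance {a b c : Ty} (p : Code a b) (q : Code a c) [hp : Lin p] [hq : Lin q] :
    Lin (pair p q) := by
  obtain ⟨C, hC⟩ := hp.cost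
  obtain ⟨D, hD⟩ := hq.cost
  exact ⟨_, fun B hB N x hx => Cost.pair hx (hC B hB N x hx) (hD B hB N x hx)⟩

instance {a b : Ty} (t : Code a nat) (p q : Code a b) [ht : Lin t] [hp : Lin p] [hq : Lin q] :
    Lin (ite t p q) := by
  obtain ⟨C, hC⟩ := ht.cost
  obtain ⟨D, hD⟩ := hp.cost
  obtain ⟨E, hE⟩ := hq.cost
  exact ⟨_, fun B hB N x hx => Cost.ite hx (hC B hB N x hx)
    (fun _ => (hD B hB N x hx).mono le_rfl (le_max_left D E))
    (fun _ => (hE B hB N x hx).mono le_rfl (le_max_right D E))⟩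

/-! ### Growth of sizes under elementary operations -/

lemma size_nat_add {B : ℕ} (hB : 2 ≤ B) (x y : ℕ) :
    nat.size B (x + y) ≤ nat.size B x + nat.size B y := by
  have hx := Ty.lt_pow_size hB x
  have hy := Ty.lt_pow_size hB y
  have h1 := Ty.one_le_size B nat x
  have h2 := Ty.one_le_size B nat y
  refine Ty.size_nat_le ?_ (by omega)
  have h3 : 2 ≤ B ^ nat.size B x := hB.trans (Nat.le_self_pow (by omega) B)
  have h4 : 2 ≤ B ^ nat.size B y := hB.trans (Nat.le_self_pow (by omega) B)
  rw [pow_add]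
  nlinarith

lemma size_nat_mul {B : ℕ} (hB : 2 ≤ B) (x y : ℕ) :
    nat.size B (x * y) ≤ nat.size B x + nat.size B y := by
  have hx := Ty.lt_pow_size hB x
  have hy := Ty.lt_pow_size hB y
  have h1 := Ty.one_le_size B nat x
  refine Ty.size_nat_le ?_ (by omega)
  rw [pow_add]
  exact Nat.mul_lt_mul'' hx hy

lemma size_ite_one {B : ℕ} (hB : 2 ≤ B) (P : Prop) [Decidable P] :
    nat.size B (if P then 1 else 0) = 1 := by
  apply Ty.size_nat_of_lt
  split_ifs <;> omega

/-- The factor by which an elementary operation can increase the size. -/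
def primFactor : {a b : Ty} → Prim a b → ℕ
  | _, _, .const k => k + 1
  | _, _, _ => 1

open Ty in
lemma size_prim_le {B : ℕ} (hB : 2 ≤ B) : ∀ {a b : Ty} (p : Prim a b) (x : a.den),
    b.size B (p.eval x) ≤ primFactor p * a.size B x
  | _, _, .id, x => by simp [primFactor, Prim.eval]
  | _, _, .fst, x => by simp [primFactor, Prim.eval, Ty.size]
  | _, _, .snd, x => by simp [primFactor, Prim.eval, Ty.size]
  | _, _, .nil, x => by
      simp only [primFactor, Prim.eval, Ty.size_nil, one_mul]; exact Ty.one_le_size _ _ _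
  | _, _, .cons, x => by
      simp only [primFactor, Prim.eval, Ty.size_cons, one_mul, Ty.size_prod]; exact le_rfl
  | a, _, .const k, x => by
      simp only [primFactor, Prim.eval, Ty.size]
      have h1 := Ty.one_le_size B a x
      have h2 := Nat.log_le_self B k
      nlinarith
  | _, _, .add, x => by
      simpa [primFactor, Prim.eval, Ty.size_prod] using size_nat_add hB _ _
  | _, _, .sub, x => by
      have := (Ty.size_nat_mono (B := B) (Nat.sub_le x.1 x.2))
      simp only [primFactor, Prim.eval, Ty.size_prod, one_mul]
      omega
  | _, _, .mul, x => by
      simpa [primFactor, Prim.eval, Ty.size_prod] using size_nat_mul hB _ _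
  | _, _, .div, x => by
      have := (Ty.size_nat_mono (B := B) (Nat.div_le_self x.1 x.2))
      simp only [primFactor, Prim.eval, Ty.size_prod, one_mul]
      omega
  | _, _, .le, x => by
      simp only [primFactor, Prim.eval, size_ite_one hB, one_mul]; exact Ty.one_le_size _ _ _
  | _, _, .read, x => by simp [primFactor, Ty.size]
  | _, _, .rzero, x => by
      simp only [primFactor, Ty.size, one_mul]; exact Ty.one_le_size _ _ _
  | _, _, .radd, x => by simp [primFactor, Ty.size]
  | _, _, .rsub, x => by simp [primFactor, Ty.size]
  | _, _, .rle, x => by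
      simp only [primFactor, Prim.eval, size_ite_one hB, one_mul]; exact Ty.one_le_size _ _ _

instance {a b : Ty} (p : Prim a b) : Lin (prim p) := by
  refine ⟨primFactor p + 1, fun B hB N x hx => ?_⟩
  have h1 := (size_prim_le hB p x).trans (Nat.mul_le_mul_left _ hx)
  have h2 : (primFactor p + 1) * N = primFactor p * N + N := by ring
  refine ⟨?_, ?_, ?_⟩
  · simp only [eval]
    omega
  · simp only [space]
    omega
  · simp only [time]
    exact Nat.one_le_pow _ _ (by omega)

/-! ### Costs of iterations -/

lemma iterTime_le {α β : Type} (g : β → α → β) (t : β → α → ℕ) (T : ℕ) (l : List α) :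
    ∀ y, (∀ l₁ z l₂, l = l₁ ++ z :: l₂ → t (l₁.foldl g y) z ≤ T) →
      iterTime g t y l ≤ l.length * (T + 1) + 1 := by
  induction l with
  | nil => intro y _; simp [iterTime]
  | cons x l ih =>
    intro y h
    have h1 := h [] x l rfl
    have h2 := ih (g y x) fun l₁ z l₂ e => h (x :: l₁) z l₂ (by rw [e]; rfl)
    simp only [iterTime, List.length_cons, List.foldl_nil] at *
    nlinarith

/-- The body is bounded only at splittings `l₁ ++ z :: l₂`, that is, on accumulators that really
occur. Bounds for arbitrary accumulators would be useless here. -/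
lemma iterSpace_le {α β : Type} (g : β → α → β) (s : β → α → ℕ) (z : β → ℕ) (S : ℕ) (l : List α) :
    ∀ y, (∀ l₁ z l₂, l = l₁ ++ z :: l₂ → s (l₁.foldl g y) z ≤ S) → z (l.foldl g y) ≤ S →
      iterSpace g s z y l ≤ S := by
  induction l with
  | nil => intro y _ h; simpa [iterSpace] using h
  | cons x l ih =>
    intro y h h'
    have h1 := h [] x l rfl
    have h2 := ih (g y x) (fun l₁ z l₂ e => h (x :: l₁) z l₂ (by rw [e]; rfl)) h'
    simp only [iterSpace, List.foldl_nil] at *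
    exact max_le h1 h2

lemma mul_pow_add_le {b L c : ℕ} (hb : 2 ≤ b) (hL : L ≤ b) :
    L * (b ^ c + 1) + 1 ≤ b ^ (c + 3) := by
  have h1 : 1 ≤ b ^ c := Nat.one_le_pow _ _ (by omega)
  have h2 : L * (b ^ c + 1) ≤ b * (b ^ c + b ^ c) := Nat.mul_le_mul hL (by omega)
  have h3 : b ^ (c + 3) = b * (b * (b * b ^ c)) := by ring
  have h4 : b * (b ^ c + b ^ c) + 1 ≤ b * (b * (b * b ^ c)) := by
    have h5 : 2 * (b * b ^ c) ≤ b * (b * b ^ c) := Nat.mul_le_mul_right _ hb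
    have h6 : 2 * (b * (b * b ^ c)) ≤ b * (b * (b * b ^ c)) := Nat.mul_le_mul_right _ hb
    have h7 : 1 ≤ b * b ^ c := Nat.mul_pos (by omega) h1
    rw [← two_mul, mul_left_comm]
    omega
  omega

/-- The cost of an iteration, from bounds for the accumulator and for the body. -/
lemma fold_cost_of_bounds {B N C A : ℕ} {e a b : Ty} {p : Code (prod e (prod a b)) b}
    {x : (prod e (prod (list a) b)).den} (hx : (prod e (prod (list a) b)).size B x ≤ N)
    (hp : ∀ l₁ z l₂, x.2.1 = l₁ ++ z :: l₂ →
      Cost B N C p (x.1, z, List.foldl (fun y z => p.eval (x.1, z, y)) x.2.2 l₁))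
    (hA : b.size B ((fold p).eval x) ≤ A * N) :
    Cost B N (C + A + 3) (fold p) x := by
  have h1 : (C + A + 3) * N = C * N + A * N + 3 * N := by ring
  simp only [Ty.size_prod] at hx
  have hl := Ty.length_lt_size B a x.2.1
  refine ⟨by omega, ?_, ?_⟩
  · simp only [space]
    have := iterSpace_le (fun y z => p.eval (x.1, z, y)) (fun y z => p.space B (x.1, z, y))
      (b.size B) (C * N + A * N) x.2.1 x.2.2
      (fun l₁ z l₂ h => by exact (hp l₁ z l₂ h).space_le.trans (Nat.le_add_right _ _))
      (by simp only [eval] at hA; omega)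
    omega
  · simp only [time]
    have := iterTime_le (fun y z => p.eval (x.1, z, y)) (fun y z => p.time (x.1, z, y))
      ((C * N + 1) ^ C) x.2.1 x.2.2 (fun l₁ z l₂ h => (hp l₁ z l₂ h).time_le)
    refine this.trans ?_
    have hb : (C * N + 1) ^ C ≤ ((C + A + 3) * N + 1) ^ C := Nat.pow_le_pow_left (by omega) _
    have := mul_pow_add_le (b := (C + A + 3) * N + 1) (L := x.2.1.length) (c := C) (by omega)
      (by omega)
    refine (Nat.add_le_add_right (Nat.mul_le_mul_left _ (Nat.add_le_add_right hb 1)) 1).trans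
      (this.trans (Nat.pow_le_pow_right (by omega) (by omega)))

/-- The number of runs is the value of a number and not its size, and the value can be exponential
in the size; hence the separate bound on the value. -/
lemma loop_cost_of_bounds {B N C A : ℕ} {e b : Ty} {p : Code (prod e (prod nat b)) b}
    {x : (prod e (prod nat b)).den} (hx : (prod e (prod nat b)).size B x ≤ N)
    (hn : (show ℕ from x.2.1) ≤ N)
    (hp : ∀ l₁ z l₂, List.range x.2.1 = l₁ ++ z :: l₂ →
      Cost B N C p (x.1, z, List.foldl (fun y z => p.eval (x.1, z, y)) x.2.2 l₁))
    (hA : b.size B ((loop p).eval x) ≤ A * N) :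
    Cost B N (C + A + 3) (loop p) x := by
  have h1 : (C + A + 3) * N = C * N + A * N + 3 * N := by ring
  simp only [Ty.size_prod] at hx
  have hx1 := Ty.one_le_size B e x.1
  refine ⟨by omega, ?_, ?_⟩
  · simp only [space]
    have := iterSpace_le (fun y z => p.eval (x.1, z, y)) (fun y z => p.space B (x.1, z, y))
      (b.size B) (C * N + A * N) (List.range x.2.1) x.2.2
      (fun l₁ z l₂ h => by exact (hp l₁ z l₂ h).space_le.trans (Nat.le_add_right _ _))
      (by simp only [eval] at hA; omega)
    omega
  · simp only [time]
    have := iterTime_le (fun y z => p.eval (x.1, z, y)) (fun y z => p.time (x.1, z, y))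
      ((C * N + 1) ^ C) (List.range x.2.1) x.2.2 (fun l₁ z l₂ h => (hp l₁ z l₂ h).time_le)
    refine this.trans ?_
    rw [List.length_range]
    have hb : (C * N + 1) ^ C ≤ ((C + A + 3) * N + 1) ^ C := Nat.pow_le_pow_left (by omega) _
    have := mul_pow_add_le (b := (C + A + 3) * N + 1) (L := x.2.1) (c := C) (by omega)
      (by simp only at hn; omega)
    refine (Nat.add_le_add_right (Nat.mul_le_mul_left _ (Nat.add_le_add_right hb 1)) 1).trans
      (this.trans (Nat.pow_le_pow_right (by omega) (by omega)))

/-- An iteration is linear where each run of its body increases the accumulator by at most a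
multiple of the size of the current entry. -/
lemma fold_cost {e a b : Ty} (p : Code (prod e (prod a b)) b) [hp : Lin p] (D : ℕ) :
    ∃ C, ∀ B, 2 ≤ B → ∀ N x, (prod e (prod (list a) b)).size B x ≤ N →
      (∀ z ∈ x.2.1, ∀ y, b.size B (p.eval (x.1, z, y)) ≤ b.size B y + D * a.size B z) →
      Cost B N C (fold p) x := by
  obtain ⟨C, hC⟩ := hp.cost
  refine ⟨C * (D + 1) + C + (D + 1) + 3, fun B hB N x hx h => ?_⟩
  -- The summand `D` on the left pays for the one word that an empty list occupies.
  have key : ∀ l : List a.den, (∀ z ∈ l, z ∈ x.2.1) → ∀ y,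
      b.size B (l.foldl (fun y z => p.eval (x.1, z, y)) y) + D ≤
        b.size B y + D * (list a).size B l := by
    intro l
    induction l with
    | nil => intro _ y; simp [Ty.size]
    | cons z l ih =>
      intro hl y
      have h1 := ih (fun z hz => hl z (List.mem_cons_of_mem _ hz)) (p.eval (x.1, z, y))
      have h2 := h z (hl z List.mem_cons_self) y
      rw [Ty.size_cons, mul_add]
      simp only [List.foldl_cons]
      omega
  simp only [Ty.size_prod] at hx
  have hDN : D * (list a).size B x.2.1 ≤ D * N := Nat.mul_le_mul_left _ (by omega)
  have h0 : (D + 1) * N = D * N + N := by ring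
  refine (fold_cost_of_bounds (C := C * (D + 1) + C) (A := D + 1) (by
    simpa only [Ty.size_prod] using hx) ?_ ?_).mono le_rfl le_rfl
  · intro l₁ z l₂ hl
    have h1 : l₁.foldl (fun y z => p.eval (x.1, z, y)) x.2.2 = _ := rfl
    have h2 := key l₁ (fun z hz => by rw [hl]; simp [hz]) x.2.2
    have h3 : (list a).size B x.2.1 + 1 = (list a).size B l₁ + (list a).size B (z :: l₂) := by
      rw [hl]; exact Ty.size_append B a _ _
    rw [Ty.size_cons] at h3
    have h5 := Ty.one_le_size B (list a) l₁
    have h6 := Ty.one_le_size B (list a) l₂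
    have h4 : D * (list a).size B l₁ ≤ D * N := Nat.mul_le_mul_left _ (by omega)
    have := hC B hB ((D + 1) * N)
      (x.1, z, l₁.foldl (fun y z => p.eval (x.1, z, y)) x.2.2) (by
        simp only [Ty.size_prod]
        omega)
    have e : C * ((D + 1) * N) ≤ (C * (D + 1) + C) * N := by nlinarith
    refine ⟨this.size_le.trans e, this.space_le.trans e, this.time_le.trans ?_⟩
    exact (Nat.pow_le_pow_left (by omega) _).trans (Nat.pow_le_pow_right (by omega) (by omega))
  · have h2 := key x.2.1 (fun z hz => hz) x.2.2
    simp only [eval]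
    omega

lemma lin_fold {e a b : Ty} (p : Code (prod e (prod a b)) b) [Lin p] (D : ℕ)
    (h : ∀ B, 2 ≤ B → ∀ x z y, b.size B (p.eval (x, z, y)) ≤ b.size B y + D * a.size B z) :
    Lin (fold p) := by
  obtain ⟨C, hC⟩ := fold_cost p D
  exact ⟨C, fun B hB N x hx => hC B hB N x hx fun z _ y => h B hB x.1 z y⟩

end Code

end MapReduce

namespace MapReduce

open Ty

namespace Code

/-! ## A library of codes -/

notation:65 p:65 "⊳" q:66 => Code.comp q p

section Library

variable {a b c e : Ty}

abbrev π₁ : Code (prod a b) a := prim .fst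
abbrev π₂ : Code (prod a b) b := prim .snd
abbrev num (k : ℕ) : Code a nat := prim (.const k)
abbrev nilC : Code a (list b) := prim .nil

/-- Apply a binary elementary operation to the results of two codes. -/
abbrev bin {d : Ty} (o : Prim (prod b c) d) (p : Code a b) (q : Code a c) : Code a d :=
  pair p q ⊳ prim o

lemma eval_prim (p : Prim a b) (x : a.den) : (prim p).eval x = p.eval x := by
  rw [eval]

lemma eval_comp (p : Code a b) (q : Code b c) (x : a.den) :
    (p ⊳ q).eval x = q.eval (p.eval x) := by
  rw [eval]

lemma eval_pair (p : Code a b) (q : Code a c) (x : a.den) :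
    (pair p q).eval x = (p.eval x, q.eval x) := by
  rw [eval]

lemma eval_ite (t : Code a nat) (p q : Code a b) (x : a.den) :
    (ite t p q).eval x = if t.eval x = (0 : ℕ) then q.eval x else p.eval x := by
  simp only [eval]
  by_cases h : t.eval x = (0 : ℕ) <;> simp [h]

lemma eval_fold (p : Code (prod e (prod a b)) b) (x : (prod e (prod (list a) b)).den) :
    (fold p).eval x = x.2.1.foldl (fun y z => p.eval (x.1, z, y)) x.2.2 := by
  rw [eval]

lemma eval_loop (p : Code (prod e (prod nat b)) b) (x : (prod e (prod nat b)).den) :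
    (loop p).eval x = (List.range x.2.1).foldl (fun y z => p.eval (x.1, z, y)) x.2.2 := by
  rw [eval]

/-- Equality of natural numbers. -/
def eqC : Code (prod nat nat) nat :=
  bin .mul (prim .le) (pair π₂ π₁ ⊳ prim .le)

@[simp] lemma eval_eqC (x : ℕ × ℕ) : eqC.eval x = if x.1 = x.2 then (1 : ℕ) else (0 : ℕ) := by
  obtain ⟨x, y⟩ := x
  simp only [eqC, eval_prim, eval_comp, eval_pair, eval_ite, eval_fold, Prim.eval]
  rcases lt_trichotomy x y with h | h | h
  · simp [h.le, h.not_ge, h.ne]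
  · simp [h]
  · simp [h.le, h.not_ge, h.ne']

instance : Lin eqC := by unfold eqC; infer_instance

/-- Whether a test succeeds on some entry of a list. -/
def anyC (t : Code (prod e a) nat) : Code (prod e (list a)) nat :=
  pair π₁ (pair π₂ (num 0)) ⊳ fold (ite (pair π₁ (π₂ ⊳ π₁) ⊳ t) (num 1) (π₂ ⊳ π₂))

lemma foldl_any {α : Type} (P : α → Prop) [DecidablePred P] (l : List α) (y : ℕ) :
    l.foldl (fun y z => if P z then y else 1) y = if ∃ z ∈ l, ¬ P z then 1 else y := by
  induction l generalizing y with
  | nil => simp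
  | cons x l ih =>
    rw [List.foldl_cons, ih]
    by_cases h : P x <;> by_cases h' : ∃ z ∈ l, ¬ P z <;> simp [h, h']

@[simp] lemma eval_anyC (t : Code (prod e a) nat) (x : e.den × List a.den) :
    (anyC t).eval x = if ∃ z ∈ x.2, t.eval (x.1, z) ≠ (0 : ℕ) then (1 : ℕ) else (0 : ℕ) := by
  simp only [anyC, eval_prim, eval_comp, eval_pair, eval_ite, eval_fold, Prim.eval]
  exact foldl_any (fun z => t.eval (x.1, z) = (0 : ℕ)) x.2 0

instance (t : Code (prod e a) nat) [Lin t] : Lin (anyC t) := by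
  have : Lin (fold (e := e) (ite (pair π₁ (π₂ ⊳ π₁) ⊳ t) (num 1) (π₂ ⊳ π₂))) := by
    refine lin_fold _ 1 fun B hB x z y => ?_
    have := Ty.one_le_size B nat y
    simp only [eval_prim, eval_comp, eval_pair, eval_ite, eval_fold, Prim.eval]
    split_ifs
    · omega
    · rw [Ty.size_nat_of_lt (by omega)]
      omega
  unfold anyC
  infer_instance

/-- Membership in a list of natural numbers. -/
def memC : Code (prod nat (list nat)) nat := anyC eqC

@[simp] lemma eval_memC (x : ℕ × List ℕ) :
    memC.eval x = if x.1 ∈ x.2 then (1 : ℕ) else (0 : ℕ) := by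
  rw [memC, eval_anyC]
  simp

instance : Lin memC := by unfold memC; infer_instance

/-- Reversal of a list. -/
def revC : Code (list a) (list a) :=
  pair (num 0) (pair (prim .id) nilC) ⊳ fold (π₂ ⊳ prim .cons)

@[simp] lemma eval_revC (l : List a.den) : (revC (a := a)).eval l = l.reverse := by
  simp [revC, eval_prim, eval_comp, eval_pair, eval_fold, Prim.eval]

instance : Lin (revC (a := a)) := by
  have : Lin (fold (e := nat) (π₂ ⊳ prim (.cons (a := a)))) := by
    refine lin_fold _ 1 fun B hB x z y => ?_
    simp only [eval_prim, eval_comp, eval_pair, eval_ite, eval_fold, Prim.eval, Ty.size_cons]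
    omega
  unfold revC
  infer_instance

/-- The entries of a list that pass a test. -/
def filterC (t : Code (prod e a) nat) : Code (prod e (list a)) (list a) :=
  pair π₁ (pair π₂ nilC) ⊳
    fold (ite (pair π₁ (π₂ ⊳ π₁) ⊳ t) (π₂ ⊳ prim .cons) (π₂ ⊳ π₂)) ⊳ revC

lemma foldl_filter {α : Type} (P : α → Prop) [DecidablePred P] (l : List α) (y : List α) :
    l.foldl (fun y z => if P z then y else z :: y) y =
      (l.filter fun z => ¬ P z).reverse ++ y := by
  induction l generalizing y with
  | nil => simp
  | cons x l ih =>
    rw [List.foldl_cons, ih]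
    by_cases h : P x <;> simp [h]

@[simp] lemma eval_filterC (t : Code (prod e a) nat) (x : e.den × List a.den) :
    (filterC t).eval x = x.2.filter fun z => t.eval (x.1, z) ≠ (0 : ℕ) := by
  simp only [filterC, eval_prim, eval_comp, eval_pair, eval_ite, eval_fold, Prim.eval, eval_revC]
  have := foldl_filter (fun z => t.eval (x.1, z) = (0 : ℕ)) x.2 []
  rw [List.append_nil] at this
  rw [← List.reverse_reverse (List.filter _ x.2)]
  exact congrArg List.reverse this

instance (t : Code (prod e a) nat) [Lin t] : Lin (filterC t) := by
  have : Lin (fold (ite (pair π₁ (π₂ ⊳ π₁) ⊳ t) (π₂ ⊳ prim .cons) (π₂ ⊳ π₂))) := by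
    refine lin_fold _ 1 fun B hB x z y => ?_
    simp only [eval_prim, eval_comp, eval_pair, eval_ite, eval_fold, Prim.eval]
    split_ifs
    · omega
    · rw [Ty.size_cons]
      omega
  unfold filterC
  infer_instance

/-- The images of the entries of a list. -/
def mapC (p : Code (prod e a) b) : Code (prod e (list a)) (list b) :=
  pair π₁ (pair π₂ nilC) ⊳
    fold (bin .cons (pair π₁ (π₂ ⊳ π₁) ⊳ p) (π₂ ⊳ π₂)) ⊳ revC

lemma foldl_map_cons {α β : Type} (f : α → β) (l : List α) (y : List β) :
    l.foldl (fun y z => f z :: y) y = (l.map f).reverse ++ y := by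
  induction l generalizing y with
  | nil => simp
  | cons x l ih => simp [ih]

@[simp] lemma eval_mapC (p : Code (prod e a) b) (x : e.den × List a.den) :
    (mapC p).eval x = x.2.map fun z => p.eval (x.1, z) := by
  simp only [mapC, eval_prim, eval_comp, eval_pair, eval_ite, eval_fold, Prim.eval, eval_revC]
  rw [foldl_map_cons (fun z => p.eval (x.1, z)) x.2 [], List.append_nil, List.reverse_reverse]

/-- The bound on the images is required only for the environment and the entries at hand. The
scatter code needs this generality, because its addresses depend on the environment. -/
lemma mapC_cost (p : Code (prod e a) b) [Lin p] (D : ℕ) :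
    ∃ C, ∀ B, 2 ≤ B → ∀ N x, (prod e (list a)).size B x ≤ N →
      (∀ z ∈ x.2, b.size B (p.eval (x.1, z)) ≤ D * a.size B z) → Cost B N C (mapC p) x := by
  obtain ⟨C₁, h₁⟩ := Lin.cost (p := (pair π₁ (pair π₂ nilC) :
    Code (prod e (list a)) (prod e (prod (list a) (list b)))))
  obtain ⟨C₂, h₂⟩ := fold_cost (bin .cons (pair π₁ (π₂ ⊳ π₁) ⊳ p) (π₂ ⊳ π₂)) D
  obtain ⟨C₃, h₃⟩ := Lin.cost (p := revC (a := b))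
  have key : ∀ B, 2 ≤ B → ∀ N x, (prod e (list a)).size B x ≤ N →
      (∀ z ∈ x.2, b.size B (p.eval (x.1, z)) ≤ D * a.size B z) →
      Cost B N _ (pair π₁ (pair π₂ nilC) ⊳
        fold (bin .cons (pair π₁ (π₂ ⊳ π₁) ⊳ p) (π₂ ⊳ π₂))) x := fun B hB N x hx h =>
    (h₁ B hB N x hx).comp ((Ty.one_le_size B _ x).trans hx)
      (h₂ B hB _ _ (h₁ B hB N x hx).size_le fun z hz y => by
        have := h z hz
        simp only [eval_prim, eval_comp, eval_pair, Prim.eval, Ty.size_cons] at this ⊢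
        omega)
  exact ⟨_, fun B hB N x hx h => (key B hB N x hx h).comp ((Ty.one_le_size B _ x).trans hx)
    (h₃ B hB _ _ (key B hB N x hx h).size_le)⟩

lemma lin_mapC (p : Code (prod e a) b) [Lin p] (D : ℕ)
    (h : ∀ B, 2 ≤ B → ∀ x z, b.size B (p.eval (x, z)) ≤ D * a.size B z) : Lin (mapC p) := by
  obtain ⟨C, hC⟩ := mapC_cost p D
  exact ⟨C, fun B hB N x hx => hC B hB N x hx fun z _ => h B hB _ z⟩

/-- The images of the entries of a list under a code without environment. -/
def map₀C (p : Code a b) : Code (list a) (list b) :=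
  pair (num 0) (prim .id) ⊳ mapC (π₂ ⊳ p)

@[simp] lemma eval_map₀C (p : Code a b) (l : List a.den) : (map₀C p).eval l = l.map p.eval := by
  simp only [map₀C, eval_prim, eval_comp, eval_pair, eval_ite, eval_fold, Prim.eval, eval_mapC]

instance (p : Code a b) [Lin p] : Lin (map₀C p) := by
  have : Lin (mapC (e := nat) (π₂ ⊳ p)) := by
    obtain ⟨C, hC⟩ := Lin.cost (p := p)
    exact lin_mapC _ C fun B hB _ z => (hC B hB _ z le_rfl).size_le
  unfold map₀C
  infer_instance

/-- Concatenation of two lists. -/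
def appendC : Code (prod (list a) (list a)) (list a) :=
  pair (num 0) (pair (π₁ ⊳ revC) π₂) ⊳ fold (π₂ ⊳ prim .cons)

@[simp] lemma eval_appendC (x : List a.den × List a.den) :
    (appendC (a := a)).eval x = x.1 ++ x.2 := by
  simp [appendC, eval_prim, eval_comp, eval_pair, eval_ite, eval_fold, Prim.eval]

instance : Lin (appendC (a := a)) := by
  have : Lin (fold (e := nat) (π₂ ⊳ prim (.cons (a := a)))) := by
    refine lin_fold _ 1 fun B hB x z y => ?_
    simp only [eval_prim, eval_comp, eval_pair, eval_ite, eval_fold, Prim.eval, Ty.size_cons]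
    omega
  unfold appendC
  infer_instance

/-- Concatenation of the entries of a list of lists. -/
def flatC : Code (list (list a)) (list a) :=
  pair (num 0) (pair revC nilC) ⊳ fold (π₂ ⊳ appendC)

@[simp] lemma eval_flatC (l : List (List a.den)) : (flatC (a := a)).eval l = l.flatten := by
  simp only [flatC, eval_prim, eval_comp, eval_pair, eval_ite, eval_fold, Prim.eval, eval_revC, eval_appendC]
  induction l with
  | nil => simp
  | cons x l ih => simp only [List.reverse_cons, List.foldl_append, ih]; simp

instance : Lin (flatC (a := a)) := by
  have : Lin (fold (e := nat) (π₂ ⊳ appendC (a := a))) := by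
    refine lin_fold _ 1 fun B hB x z y => ?_
    have := Ty.size_append B a z y
    simp only [eval_prim, eval_comp, eval_pair, eval_ite, eval_fold, Prim.eval, eval_appendC]
    omega
  unfold flatC
  infer_instance

/-- The length of a list. -/
def lenC : Code (list a) nat :=
  pair (num 0) (pair (prim .id) (num 0)) ⊳ fold (bin .add (π₂ ⊳ π₂) (num 1))

@[simp] lemma eval_lenC (l : List a.den) : (lenC (a := a)).eval l = l.length := by
  simp only [lenC, eval_prim, eval_comp, eval_pair, eval_ite, eval_fold, Prim.eval]
  have : ∀ k : ℕ, l.foldl (fun y _ => y + 1) k = k + l.length := by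
    induction l with
    | nil => simp
    | cons x l ih => intro k; rw [List.foldl_cons, ih, List.length_cons]; omega
  exact (this 0).trans (zero_add _)

instance : Lin (lenC (a := a)) := by
  have : Lin (fold (e := nat) (a := a) (bin .add (π₂ ⊳ π₂) (num 1))) := by
    refine lin_fold _ 1 fun B hB x z y => ?_
    have h1 := size_nat_add hB y 1
    have h2 := Ty.one_le_size B a z
    rw [Ty.size_nat_of_lt (x := 1) (by omega)] at h1
    simp only [eval_prim, eval_comp, eval_pair, eval_ite, eval_fold, Prim.eval]
    omega
  unfold lenC
  infer_instance

/-- The entry of a list of numbers at a given position. -/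
def nthC : Code (prod nat (list nat)) nat :=
  pair π₁ (pair π₂ (pair (num 0) (num 0))) ⊳
    fold (pair (bin .add (π₂ ⊳ π₂ ⊳ π₁) (num 1))
      (ite (pair (π₂ ⊳ π₂ ⊳ π₁) π₁ ⊳ eqC) (π₂ ⊳ π₁) (π₂ ⊳ π₂ ⊳ π₂))) ⊳ π₂

@[simp] lemma eval_nthC (x : ℕ × List ℕ) : nthC.eval x = x.2.getD x.1 0 := by
  obtain ⟨k, l⟩ := x
  -- The accumulator consists of the current position and the value found so far; the induction must
  -- allow an arbitrary starting pair.
  have : ∀ (l : List ℕ) (y : ℕ × ℕ),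
      (l.foldl (fun (y : ℕ × ℕ) z => (y.1 + 1, if y.1 = k then z else y.2)) y).2 =
        if y.1 ≤ k then l.getD (k - y.1) y.2 else y.2 := by
    intro l
    induction l with
    | nil => simp
    | cons z l ih =>
      intro y
      rw [List.foldl_cons, ih]
      rcases lt_trichotomy y.1 k with h | h | h
      · obtain ⟨d, hd⟩ : ∃ d, k - y.1 = d + 1 := ⟨k - y.1 - 1, by omega⟩
        have hd' : k - (y.1 + 1) = d := by omega
        simp [h.le, h.ne, hd, hd', Nat.succ_le_of_lt h]
      · simp [h]
      · simp [h.ne', h.not_ge, Nat.not_le_of_lt (Nat.lt_succ_of_lt h)]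
  have h := this l (0, 0)
  simp only [nthC, eval_prim, eval_comp, eval_pair, eval_ite, eval_fold, Prim.eval, eval_eqC]
  simp only [Nat.zero_le, if_true, Nat.sub_zero] at h
  rw [← h]
  congr 2
  ext y z : 2
  split_ifs <;> simp_all

instance : Lin nthC := by
  have : Lin (fold (a := nat) (pair (bin .add (π₂ ⊳ π₂ ⊳ π₁) (num 1))
      (ite (pair (π₂ ⊳ π₂ ⊳ π₁) π₁ ⊳ eqC) (π₂ ⊳ π₁) (π₂ ⊳ π₂ ⊳ π₂)))) := by
    refine lin_fold _ 2 fun B hB x z y => ?_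
    have h1 := size_nat_add hB y.1 1
    have h2 := Ty.one_le_size B nat z
    have h3 := Ty.one_le_size B nat y.2
    rw [Ty.size_nat_of_lt (x := 1) (by omega)] at h1
    simp only [eval_prim, eval_comp, eval_pair, eval_ite, eval_fold, Prim.eval, Ty.size_prod]
    split_ifs <;> omega
  unfold nthC
  infer_instance

end Library

end Code

end MapReduce

namespace MapReduce

open Ty

namespace Code

/-! ## Local ratio -/

abbrev resTy : Ty := list (prod nat real)

open Classical in
/-- A flag that tells whether the list `T` meets the indices of `res`, and in this case the minimum
of the residual weights of the common indices. -/
noncomputable def minRes (T : List ℕ) (res : List (ℕ × ℝ)) : ℕ × ℝ :=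
  res.foldl (fun y z => if z.1 ∈ T ∧ (y.1 = 0 ∨ z.2 ≤ y.2) then (1, z.2) else y) (0, 0)

/-- Subtract `ε` from the residual weights of the indices in `T`. -/
noncomputable def lower (T : List ℕ) (ε : ℝ) (res : List (ℕ × ℝ)) : List (ℕ × ℝ) :=
  res.map fun z => if z.1 ∈ T then (z.1, z.2 - ε) else z

open Classical in
/-- One step of the local ratio method: the element with the list of sets `T` is processed; it is
recorded if it decreases the residual weights. -/
noncomputable def lrStep (y : List (ℕ × ℝ) × List (List ℕ)) (T : List ℕ) :
    List (ℕ × ℝ) × List (List ℕ) :=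
  if (minRes T y.1).2 ≤ 0 then y else (lower T (minRes T y.1).2 y.1, T :: y.2)

def minBodyC : Code (prod (list nat) (prod (prod nat real) (prod nat real))) (prod nat real) :=
  ite (pair (π₂ ⊳ π₁ ⊳ π₁) π₁ ⊳ memC)
    (ite (π₂ ⊳ π₂ ⊳ π₁)
      (ite (bin .rle (π₂ ⊳ π₁ ⊳ π₂) (π₂ ⊳ π₂ ⊳ π₂)) (pair (num 1) (π₂ ⊳ π₁ ⊳ π₂)) (π₂ ⊳ π₂))
      (pair (num 1) (π₂ ⊳ π₁ ⊳ π₂)))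
    (π₂ ⊳ π₂)

def minC : Code (prod (list nat) resTy) (prod nat real) :=
  pair π₁ (pair π₂ (pair (num 0) (prim .rzero))) ⊳ fold minBodyC

def subC : Code (prod (prod (list nat) real) (prod nat real)) (prod nat real) :=
  ite (pair (π₂ ⊳ π₁) (π₁ ⊳ π₁) ⊳ memC)
    (pair (π₂ ⊳ π₁) (bin .rsub (π₂ ⊳ π₂) (π₁ ⊳ π₂))) π₂

def lrBodyC : Code (prod nat (prod (list nat) (prod resTy (list (list nat)))))
    (prod resTy (list (list nat))) :=
  pair (pair (π₂ ⊳ π₁) (π₂ ⊳ π₂ ⊳ π₁) ⊳ minC ⊳ π₂) π₂ ⊳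
    ite (bin .rle π₁ (prim .rzero)) (π₂ ⊳ π₂)
      (pair (pair (pair (π₂ ⊳ π₁) π₁) (π₂ ⊳ π₂ ⊳ π₁) ⊳ mapC subC)
        (bin .cons (π₂ ⊳ π₁) (π₂ ⊳ π₂ ⊳ π₂)))

/-- Run local ratio on a list of elements, with given weights. -/
def lrC : Code (prod (list (list nat)) (list (prod nat wt))) (prod resTy (list (list nat))) :=
  pair (num 0) (pair π₁ (pair (π₂ ⊳ map₀C (pair π₁ (π₂ ⊳ prim .read))) nilC)) ⊳ fold lrBodyC

@[simp] lemma eval_minC (x : List ℕ × List (ℕ × ℝ)) : minC.eval x = minRes x.1 x.2 := by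
  simp only [minC, eval_prim, eval_comp, eval_pair, eval_fold, Prim.eval, minRes]
  congr 1
  ext y z : 2
  simp only [minBodyC, eval_prim, eval_comp, eval_pair, eval_ite, eval_memC, Prim.eval]
  by_cases h1 : z.1 ∈ x.1 <;> by_cases h2 : y.1 = 0 <;> by_cases h3 : z.2 ≤ y.2 <;>
    simp [h1, h2, h3]

@[simp] lemma eval_subC (x : (List ℕ × ℝ) × (ℕ × ℝ)) :
    subC.eval x = if x.2.1 ∈ x.1.1 then (x.2.1, x.2.2 - x.1.2) else x.2 := by
  simp only [subC, eval_prim, eval_comp, eval_pair, eval_ite, eval_memC, Prim.eval]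
  by_cases h : x.2.1 ∈ x.1.1 <;> simp [h]

@[simp] lemma eval_lrBodyC (x : ℕ × List ℕ × List (ℕ × ℝ) × List (List ℕ)) :
    lrBodyC.eval x = lrStep x.2.2 x.2.1 := by
  simp only [lrBodyC, eval_prim, eval_comp, eval_pair, eval_ite, eval_minC, eval_mapC, eval_subC,
    Prim.eval, lrStep, lower]
  by_cases h : (minRes x.2.1 x.2.2.1).2 ≤ 0 <;> simp [h]

@[simp] lemma eval_lrC (x : List (List ℕ) × List (ℕ × ℝ)) :
    lrC.eval x = x.1.foldl lrStep (x.2, []) := by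
  simp only [lrC, eval_prim, eval_comp, eval_pair, eval_fold, eval_map₀C, Prim.eval,
    eval_lrBodyC]
  congr
  exact List.map_id _

instance : Lin minBodyC := by unfold minBodyC; infer_instance

instance : Lin minC := by
  have : Lin (fold minBodyC) := by
    refine lin_fold _ 1 fun B hB x z y => ?_
    have h1 := Ty.one_le_size B nat z.1
    have h2 := Ty.one_le_size B nat y.1
    have h3 : nat.size B 1 = 1 := Ty.size_nat_of_lt (by omega)
    simp only [minBodyC, eval_prim, eval_comp, eval_pair, eval_ite, eval_memC, Prim.eval]
    have h4 : ∀ r : ℝ, (prod nat real).size B (1, r) = 2 := fun r => by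
      simp only [Ty.size_prod, h3]; rfl
    have h5 : (prod nat real).size B z = nat.size B z.1 + 1 := rfl
    have h6 : (prod nat real).size B y = nat.size B y.1 + 1 := rfl
    split_ifs <;> simp only [h4, h5, h6] <;> omega
  unfold minC
  infer_instance

instance : Lin subC := by unfold subC; infer_instance

lemma size_subC (B : ℕ) (x : List ℕ × ℝ) (z : ℕ × ℝ) :
    (prod nat real).size B (subC.eval (x, z)) = (prod nat real).size B z := by
  rw [eval_subC]
  split_ifs <;> rfl

instance : Lin (mapC subC) :=
  lin_mapC _ 1 fun B _ x z => by rw [size_subC, one_mul]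

instance : Lin lrBodyC := by unfold lrBodyC; infer_instance

lemma size_lower (B : ℕ) (T : List ℕ) (ε : ℝ) (res : List (ℕ × ℝ)) :
    resTy.size B (lower T ε res) = resTy.size B res := by
  induction res with
  | nil => rfl
  | cons z res ih =>
    have h : lower T ε (z :: res) = (subC.eval ((T, ε), z) : ℕ × ℝ) :: lower T ε res := by
      rw [eval_subC]; rfl
    rw [h, Ty.size_cons, Ty.size_cons, ih, size_subC]

/-- Subtraction leaves the size of the residual weights unchanged, since a real number always takes
one word. So each run of the body adds at most the processed element to the record. -/
instance : Lin lrC := by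
  have : Lin (fold lrBodyC) := by
    refine lin_fold _ 1 fun B hB x z y => ?_
    rw [eval_lrBodyC, lrStep]
    split_ifs
    · exact Nat.le_add_right _ _
    · have h := Ty.size_cons B (list nat) z y.2
      simp only [Ty.size_prod, size_lower]
      omega
  unfold lrC
  infer_instance

end Code

/-! ## The algorithm -/

/-- One format serves three purposes: an element `(T, [])`, a weight `([], [(i, w)])`, and a single
set index `([i], [])`. -/
abbrev msgTy : Ty := prod (list nat) (list (prod nat wt))
-- The components are the input, the known chosen sets, the recorded elements, the threshold, the
-- mode and the number of informed machines. Residual weights are absent because they are not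
-- storable; the record replaces them.
abbrev stTy : Ty :=
  prod inputTy (prod (list nat) (prod (list (list nat)) (prod nat (prod nat nat))))
abbrev inTy : Ty := prod stTy (prod (list msgTy) (list nat))
abbrev outTy : Ty := prod stTy (list (prod nat msgTy))

namespace Code

abbrev inpA : Code inTy inputTy := π₁ ⊳ π₁
abbrev kA : Code inTy nat := inpA ⊳ π₁ ⊳ π₁
abbrev MA : Code inTy nat := inpA ⊳ π₁ ⊳ π₂ ⊳ π₁
abbrev nA : Code inTy nat := inpA ⊳ π₁ ⊳ π₂ ⊳ π₂ ⊳ π₁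
abbrev mA : Code inTy nat := inpA ⊳ π₁ ⊳ π₂ ⊳ π₂ ⊳ π₂ ⊳ π₁
abbrev sA : Code inTy nat := inpA ⊳ π₁ ⊳ π₂ ⊳ π₂ ⊳ π₂ ⊳ π₂
abbrev elsA : Code inTy (list (prod nat (list nat))) := inpA ⊳ π₂ ⊳ π₁
abbrev wtsA : Code inTy (list (prod nat wt)) := inpA ⊳ π₂ ⊳ π₂
abbrev XA : Code inTy (list nat) := π₁ ⊳ π₂ ⊳ π₁
abbrev EA : Code inTy (list (list nat)) := π₁ ⊳ π₂ ⊳ π₂ ⊳ π₁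
abbrev thetaA : Code inTy nat := π₁ ⊳ π₂ ⊳ π₂ ⊳ π₂ ⊳ π₁
abbrev modeA : Code inTy nat := π₁ ⊳ π₂ ⊳ π₂ ⊳ π₂ ⊳ π₂ ⊳ π₁
abbrev qA : Code inTy nat := π₁ ⊳ π₂ ⊳ π₂ ⊳ π₂ ⊳ π₂ ⊳ π₂
abbrev inboxA : Code inTy (list msgTy) := π₂ ⊳ π₁
abbrev wordsA : Code inTy (list nat) := π₂ ⊳ π₂

/-- The number of stored elements with a smaller index. -/
def rank (els : List (ℕ × List ℕ)) (j : ℕ) : ℕ := (els.filter fun z => z.1 < j).length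

/-- Whether the element `z` is not covered by `X` and its random word is below `θ`. -/
def Sampled (els : List (ℕ × List ℕ)) (X words : List ℕ) (θ : ℕ) (z : ℕ × List ℕ) : Prop :=
  (∀ i ∈ z.2, i ∉ X) ∧ words.getD (rank els z.1) 0 < θ

abbrev envTy : Ty := prod (list (prod nat (list nat))) (prod (list nat) (prod (list nat) nat))

def rankC : Code (prod nat (list (prod nat (list nat)))) nat :=
  filterC (ite (bin .le π₁ (π₂ ⊳ π₁)) (num 0) (num 1)) ⊳ lenC

def sampleTestC : Code (prod envTy (prod nat (list nat))) nat :=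
  ite (pair (π₁ ⊳ π₂ ⊳ π₁) (π₂ ⊳ π₂) ⊳ anyC (pair π₂ π₁ ⊳ memC)) (num 0)
    (ite (bin .le (π₁ ⊳ π₂ ⊳ π₂ ⊳ π₂)
        (pair (pair (π₂ ⊳ π₁) (π₁ ⊳ π₁) ⊳ rankC) (π₁ ⊳ π₂ ⊳ π₂ ⊳ π₁) ⊳ nthC))
      (num 0) (num 1))

/-- Rebuild the state from a list of sets, a list of recorded elements, a threshold, a mode and a
number of informed machines. -/
abbrev mkSt {a : Ty} (i : Code a inputTy) (X : Code a (list nat)) (E : Code a (list (list nat)))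
    (t mode q : Code a nat) : Code a stTy :=
  pair i (pair X (pair E (pair t (pair mode q))))

/-- Every machine sends its weights and a sample of its uncovered elements to machine `0`. -/
def sampleC : Code inTy outTy :=
  pair (mkSt inpA XA EA thetaA (num 1) qA)
    (pair
      (pair (pair elsA (pair XA (pair wordsA thetaA))) elsA ⊳ filterC sampleTestC ⊳
        map₀C (pair (num 0) (pair π₂ nilC)))
      (wtsA ⊳ map₀C (pair (num 0) (pair nilC (bin .cons (prim .id) nilC)))) ⊳ appendC)

/-- Growth stops once the threshold reaches the word capacity. From then on every uncovered element
is sampled, and the threshold keeps fitting into a bounded number of words. -/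
def thresholdC : Code inTy nat :=
  ite (bin .le (bin .add (bin .add (bin .add nA mA) sA) (num 2)) thetaA) thetaA
    (bin .div (bin .mul (bin .mul (num 2) sA) thetaA) nA)

/-- Local ratio on the recorded elements and those received. -/
def localRatioC : Code inTy outTy :=
  pair (pair (pair EA (inboxA ⊳ map₀C π₁) ⊳ appendC) (inboxA ⊳ map₀C π₂ ⊳ flatC) ⊳ lrC)
      (prim .id) ⊳
    pair (mkSt (π₂ ⊳ inpA)
      (pair (num 0) (π₁ ⊳ π₁) ⊳ filterC (bin .rle (π₂ ⊳ π₂) (prim .rzero)) ⊳ map₀C π₁)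
      (π₁ ⊳ π₂ ⊳ revC) (π₂ ⊳ thresholdC) (num 2) (num 1)) nilC

/-- The size of the group of machines that starts at `b`. -/
def groupSize (s M b : ℕ) : ℕ := s - (s - (M - b))

/-- Two truncated subtractions produce the minimum of `s` and `M - b`. -/
def groupSizeC : Code (prod nat (prod nat nat)) nat :=
  bin .sub π₁ (bin .sub π₁ (bin .sub (π₂ ⊳ π₁) (π₂ ⊳ π₂)))

/-- An index goes to the member given by its residue modulo the group size; the residue is computed
by a division. Residue classes split any set of indices below `n` into shares of size at most about
`n / g`. -/
def scatterMsgC : Code (prod (prod nat nat) nat) (prod nat msgTy) :=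
  pair (bin .add (π₁ ⊳ π₁) (bin .sub π₂ (bin .mul (bin .div π₂ (π₁ ⊳ π₂)) (π₁ ⊳ π₂))))
    (pair (bin .cons π₂ nilC) nilC)

/-- Unless all machines are informed, distribute the list of sets over a group of machines. -/
def scatterC : Code inTy outTy :=
  ite (bin .le MA qA) (pair (mkSt inpA XA EA thetaA (num 0) qA) nilC)
    (pair (mkSt inpA XA EA thetaA (num 3) qA)
      (pair (pair (bin .mul kA sA) (pair sA (pair MA (bin .mul kA sA)) ⊳ groupSizeC)) XA ⊳
        mapC scatterMsgC))

def forwardBodyC : Code (prod (prod nat msgTy) (prod nat (list (prod nat msgTy))))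
    (list (prod nat msgTy)) :=
  bin .cons (pair (bin .add (π₁ ⊳ π₁) (π₂ ⊳ π₁)) (π₁ ⊳ π₂)) (π₂ ⊳ π₂)

def forwardLoopC : Code (prod (prod nat nat) (prod msgTy (list (prod nat msgTy))))
    (list (prod nat msgTy)) :=
  pair (pair (π₁ ⊳ π₁) (π₂ ⊳ π₁)) (pair (π₁ ⊳ π₂) (π₂ ⊳ π₂)) ⊳
    loop forwardBodyC

/-- Forward all messages to all members of the group. -/
def gatherC : Code inTy outTy :=
  pair (mkSt inpA XA EA thetaA (num 4) qA)
    (pair (bin .mul (bin .div kA sA) sA) (prim .id) ⊳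
      pair (pair π₁ (pair (π₂ ⊳ sA) (pair (π₂ ⊳ MA) π₁) ⊳ groupSizeC))
        (pair (π₂ ⊳ inboxA) nilC) ⊳ fold forwardLoopC)

/-- Collect the list of sets. -/
def receiveC : Code inTy outTy :=
  pair (mkSt inpA (inboxA ⊳ map₀C π₁ ⊳ flatC) EA thetaA (num 2) (bin .mul qA sA)) nilC

/-- Modes: `0` sample, `1` local ratio, `2` scatter or start a new phase, `3` forward within the
group, `4` receive. All machines are always in the same mode. -/
def stepC : Code inTy outTy :=
  ite modeA
    (ite (bin .le modeA (num 1)) localRatioC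
      (ite (bin .le modeA (num 2)) scatterC (ite (bin .le modeA (num 3)) gatherC receiveC)))
    sampleC

/-- The first sampling probability is about `4 * s / m`, which makes the expected first sample at
most `4 * s`. -/
def initC : Code inputTy stTy :=
  mkSt (prim .id) nilC nilC
    (bin .div (bin .mul (bin .mul (num 4) (π₁ ⊳ π₂ ⊳ π₂ ⊳ π₂ ⊳ π₂))
      (bin .add (bin .add (bin .add (π₁ ⊳ π₂ ⊳ π₂ ⊳ π₁) (π₁ ⊳ π₂ ⊳ π₂ ⊳ π₂ ⊳ π₁))
        (π₁ ⊳ π₂ ⊳ π₂ ⊳ π₂ ⊳ π₂)) (num 2))) (π₁ ⊳ π₂ ⊳ π₂ ⊳ π₂ ⊳ π₁))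
    (num 0) (num 1)

end Code

open Code

/-- Randomized local ratio. -/
abbrev randomizedLocalRatio : Algorithm where
  state := stTy
  msg := msgTy
  state_storable := by simp [Ty.Storable]
  msg_storable := by simp [Ty.Storable]
  init := initC
  step := stepC
  output := π₂ ⊳ π₁

namespace Code

/-! ### Values of the codes for the single rounds -/

@[simp] lemma eval_rankC (x : ℕ × List (ℕ × List ℕ)) : rankC.eval x = rank x.2 x.1 := by
  simp only [rankC, eval_prim, eval_comp, eval_pair, eval_ite, eval_filterC, eval_lenC, Prim.eval,
    rank]
  congr 2
  ext z
  by_cases h : x.1 ≤ z.1 <;> simp [h]; omega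

open Classical in
@[simp] lemma eval_sampleTestC (x : envTy.den × (ℕ × List ℕ)) :
    sampleTestC.eval x =
      if Sampled x.1.1 x.1.2.1 x.1.2.2.1 x.1.2.2.2 x.2 then (1 : ℕ) else (0 : ℕ) := by
  obtain ⟨⟨els, X, words, θ⟩, z⟩ := x
  have e : sampleTestC.eval ((els, X, words, θ), z) = if ∃ i ∈ z.2, i ∈ X then (0 : ℕ) else
      if θ ≤ words.getD (rank els z.1) 0 then (0 : ℕ) else (1 : ℕ) := by
    simp only [sampleTestC, eval_prim, eval_comp, eval_pair, eval_ite, eval_anyC, eval_memC,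
      eval_rankC, eval_nthC, Prim.eval]
    by_cases h : ∃ i ∈ z.2, i ∈ X
    · simp [h]
    · by_cases h2 : θ ≤ words.getD (rank els z.1) 0
      · simp only [ne_eq, ite_eq_right_iff, one_ne_zero, imp_false, not_not, h, h2, if_false,
          if_true]
      · simp only [ne_eq, ite_eq_right_iff, one_ne_zero, imp_false, not_not, h, h2, if_false,
          if_true]
  rw [e]
  by_cases hs : Sampled els X words θ z
  · have h' : ¬ ∃ i ∈ z.2, i ∈ X := by push Not; exact hs.1
    rw [if_pos hs, if_neg h', if_neg (not_le.mpr hs.2)]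
  · rw [if_neg hs]
    by_cases h : ∃ i ∈ z.2, i ∈ X
    · rw [if_pos h]
    · rw [if_neg h, if_pos]
      by_contra h2
      push Not at h
      exact hs ⟨h, not_le.mp h2⟩

open Classical in
lemma eval_stepC_sample (k M n m s : ℕ) (els : List (ℕ × List ℕ)) (wts : List (ℕ × ℝ))
    (X : List ℕ) (E : List (List ℕ)) (θ q : ℕ) (inbox : List msgTy.den) (words : List ℕ) :
    stepC.eval ((((k, M, n, m, s), els, wts), X, E, θ, (0 : ℕ), q), inbox, words) =
      ((((k, M, n, m, s), els, wts), X, E, θ, (1 : ℕ), q),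
        (els.filter fun z => Sampled els X words θ z).map (fun z => ((0 : ℕ), z.2, [])) ++
          wts.map fun z => ((0 : ℕ), [], [z])) := by
  simp only [stepC, sampleC, eval_prim, eval_comp, eval_pair, eval_ite, eval_filterC, eval_map₀C,
    eval_sampleTestC, eval_appendC, Prim.eval, if_true]
  congr 3
  congr 1
  ext z
  by_cases h : Sampled els X words θ z <;> simp [h]

lemma eval_map₀C_fst {a b : Ty} (l : List (prod a b).den) :
    (map₀C (π₁ : Code (prod a b) a)).eval l = l.map Prod.fst :=
  (eval_map₀C _ l).trans (List.map_congr_left fun _ _ => eval_prim _ _)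

lemma eval_map₀C_snd {a b : Ty} (l : List (prod a b).den) :
    (map₀C (π₂ : Code (prod a b) b)).eval l = l.map Prod.snd :=
  (eval_map₀C _ l).trans (List.map_congr_left fun _ _ => eval_prim _ _)

open Classical in
lemma eval_stepC_localRatio (k M n m s : ℕ) (els : List (ℕ × List ℕ)) (wts : List (ℕ × ℝ))
    (X : List ℕ) (E : List (List ℕ)) (θ q : ℕ) (inbox : List msgTy.den) (words : List ℕ) :
    stepC.eval ((((k, M, n, m, s), els, wts), X, E, θ, (1 : ℕ), q), inbox, words) =
      ((((k, M, n, m, s), els, wts),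
        (((E ++ inbox.map Prod.fst).foldl lrStep ((inbox.map Prod.snd).flatten, [])).1.filter
          fun z => z.2 ≤ 0).map Prod.fst,
        ((E ++ inbox.map Prod.fst).foldl lrStep ((inbox.map Prod.snd).flatten, [])).2.reverse,
        (if n + m + s + 2 ≤ θ then θ else 2 * s * θ / n), (2 : ℕ), (1 : ℕ)), []) := by
  simp only [stepC, localRatioC, thresholdC, eval_prim, eval_comp, eval_pair, eval_ite,
    eval_filterC, eval_map₀C_fst, eval_map₀C_snd, eval_appendC, eval_flatC, eval_lrC, eval_revC, Prim.eval]
  by_cases hc : n + m + s + 2 ≤ θ <;> simp [hc]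

lemma eval_stepC_scatter (k M n m s : ℕ) (els : List (ℕ × List ℕ)) (wts : List (ℕ × ℝ))
    (X : List ℕ) (E : List (List ℕ)) (θ q : ℕ) (inbox : List msgTy.den) (words : List ℕ) :
    stepC.eval ((((k, M, n, m, s), els, wts), X, E, θ, (2 : ℕ), q), inbox, words) =
      if M ≤ q then ((((k, M, n, m, s), els, wts), X, E, θ, (0 : ℕ), q), [])
      else ((((k, M, n, m, s), els, wts), X, E, θ, (3 : ℕ), q),
        X.map fun i => (k * s + i % groupSize s M (k * s), [i], [])) := by
  simp only [stepC, scatterC, groupSizeC, scatterMsgC, eval_prim, eval_comp, eval_pair, eval_ite,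
    eval_mapC, Prim.eval]
  by_cases hc : M ≤ q
  · simp [hc]
  · simp only [hc, if_false, if_true]
    simp only [groupSize, Nat.mod_eq_sub_div_mul]
    norm_num

lemma foldl_append_reverse {α β : Type} (f : α → List β) (l : List α) (y : List β) :
    l.foldl (fun y z => (f z).reverse ++ y) y = (l.flatMap f).reverse ++ y := by
  induction l generalizing y with
  | nil => simp
  | cons x l ih => simp [ih]

lemma eval_forwardLoopC (b g : ℕ) (z : msgTy.den) (y : List (ℕ × msgTy.den)) :
    forwardLoopC.eval ((b, g), z, y) = ((List.range g).map fun t => (b + t, z)).reverse ++ y := by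
  simp only [forwardLoopC, forwardBodyC, eval_prim, eval_comp, eval_pair, eval_loop, Prim.eval]
  exact foldl_map_cons (fun t : ℕ => (b + t, z)) _ _

lemma foldl_forwardLoopC (b g : ℕ) (l : List msgTy.den) (y : List (ℕ × msgTy.den)) :
    l.foldl (fun y z => forwardLoopC.eval ((b, g), z, y)) y =
      (l.flatMap fun z => (List.range g).map fun t => (b + t, z)).reverse ++ y := by
  rw [← foldl_append_reverse (fun z : msgTy.den => (List.range g).map fun t => (b + t, z))]
  congr 1
  funext y z
  exact eval_forwardLoopC b g z y

lemma eval_stepC_gather (k M n m s : ℕ) (els : List (ℕ × List ℕ)) (wts : List (ℕ × ℝ))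
    (X : List ℕ) (E : List (List ℕ)) (θ q : ℕ) (inbox : List msgTy.den) (words : List ℕ) :
    stepC.eval ((((k, M, n, m, s), els, wts), X, E, θ, (3 : ℕ), q), inbox, words) =
      ((((k, M, n, m, s), els, wts), X, E, θ, (4 : ℕ), q),
        (inbox.flatMap fun z => (List.range (groupSize s M (k / s * s))).map
          fun t => (k / s * s + t, z)).reverse) := by
  have := foldl_forwardLoopC (k / s * s) (groupSize s M (k / s * s)) inbox []
  rw [List.append_nil] at this
  rw [← this]
  simp only [stepC, gatherC, groupSizeC, eval_prim, eval_comp, eval_pair, eval_ite, eval_fold,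
    Prim.eval, groupSize]
  simp

lemma eval_stepC_receive (k M n m s : ℕ) (els : List (ℕ × List ℕ)) (wts : List (ℕ × ℝ))
    (X : List ℕ) (E : List (List ℕ)) (θ q : ℕ) (inbox : List msgTy.den) (words : List ℕ) :
    stepC.eval ((((k, M, n, m, s), els, wts), X, E, θ, (4 : ℕ), q), inbox, words) =
      ((((k, M, n, m, s), els, wts), (inbox.map Prod.fst).flatten, E, θ, (2 : ℕ), q * s),
        []) := by
  simp only [stepC, receiveC, eval_prim, eval_comp, eval_pair, eval_ite, eval_map₀C_fst, eval_flatC,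
    Prim.eval]
  simp

end Code

end MapReduce

namespace MapReduce

open Ty

namespace Code

/-! ## Cost of the algorithm -/

instance : Lin rankC := by unfold rankC; infer_instance
instance : Lin sampleTestC := by unfold sampleTestC; infer_instance
instance : Lin sampleC := by unfold sampleC; infer_instance
instance : Lin thresholdC := by unfold thresholdC; infer_instance
instance : Lin localRatioC := by unfold localRatioC; infer_instance
instance : Lin groupSizeC := by unfold groupSizeC; infer_instance
instance : Lin scatterMsgC := by unfold scatterMsgC; infer_instance
instance : Lin receiveC := by unfold receiveC; infer_instance
instance : Lin initC := by unfold initC; infer_instance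

lemma eval_scatterMsgC (x : (ℕ × ℕ) × ℕ) :
    scatterMsgC.eval x = (x.1.1 + x.2 % x.1.2, [x.2], []) := by
  simp only [scatterMsgC, eval_prim, eval_comp, eval_pair, Prim.eval, Nat.mod_eq_sub_div_mul]

lemma size_index_msg (B d i : ℕ) :
    (prod nat msgTy).size B (d, [i], []) = nat.size B d + nat.size B i + 2 := by
  simp [Ty.size]
  omega

/-- The code is not linear by itself: each index acquires an address whose length is not controlled
by that of the index. Addresses below `B ^ 2` take at most two words, which restores linearity. -/
lemma scatterC_cost : ∃ C, ∀ B, 2 ≤ B → ∀ N (x : inTy.den), inTy.size B x ≤ N →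
    (∀ i ∈ XA.eval x, ((kA.eval x : ℕ) * (sA.eval x : ℕ) +
      i % groupSize (sA.eval x) (MA.eval x) ((kA.eval x : ℕ) * (sA.eval x : ℕ)) : ℕ) < B ^ 2) →
    Cost B N C scatterC x := by
  obtain ⟨C₁, h₁⟩ := Lin.cost (p := (bin .le MA qA : Code inTy nat))
  obtain ⟨C₂, h₂⟩ := Lin.cost (p := (pair (mkSt inpA XA EA thetaA (num 0) qA) nilC :
    Code inTy outTy))
  obtain ⟨C₃, h₃⟩ := Lin.cost (p := (mkSt inpA XA EA thetaA (num 3) qA : Code inTy stTy))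
  obtain ⟨C₄, h₄⟩ := Lin.cost (p := (pair (pair (bin .mul kA sA)
    (pair sA (pair MA (bin .mul kA sA)) ⊳ groupSizeC)) XA :
      Code inTy (prod (prod nat nat) (list nat))))
  -- A message consists of an address of at most two words, the index and two list terminators,
  -- hence at most five times the size of the index.
  obtain ⟨C₅, h₅⟩ := mapC_cost scatterMsgC 5
  have key : ∀ B, 2 ≤ B → ∀ N (x : inTy.den), inTy.size B x ≤ N →
      (∀ i ∈ XA.eval x, ((kA.eval x : ℕ) * (sA.eval x : ℕ) +
        i % groupSize (sA.eval x) (MA.eval x) ((kA.eval x : ℕ) * (sA.eval x : ℕ)) : ℕ) < B ^ 2) →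
      Cost B N _ (pair (mkSt inpA XA EA thetaA (num 3) qA) _) x := fun B hB N x hx h =>
    Cost.pair hx (h₃ B hB N x hx) ((h₄ B hB N x hx).comp ((Ty.one_le_size B _ x).trans hx)
      (h₅ B hB _ _ (h₄ B hB N x hx).size_le fun i hi => by
        have h1 := Ty.size_nat_le (h i hi) two_ne_zero
        have h2 := Ty.one_le_size B nat i
        rw [eval_scatterMsgC]
        refine (size_index_msg B _ _).le.trans ?_
        simp only [groupSizeC, groupSize, eval_prim, eval_comp, eval_pair, Prim.eval] at h1 ⊢
        omega))
  exact ⟨_, fun B hB N x hx h => Cost.ite hx (h₁ B hB N x hx)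
    (fun _ => (h₂ B hB N x hx).mono le_rfl (le_max_left C₂ _))
    (fun _ => (key B hB N x hx h).mono le_rfl (le_max_right C₂ _))⟩

lemma size_forward_le {B b g : ℕ} (hb : b + g ≤ B ^ 2) (z : msgTy.den) (l : List ℕ)
    (hl : ∀ t ∈ l, t < g) :
    (list (prod nat msgTy)).size B (l.map fun t => (b + t, z)) ≤
      l.length * (3 * msgTy.size B z) + 1 := by
  refine (Ty.size_list_le B _ (k := 3 * msgTy.size B z) ?_).trans (by rw [List.length_map])
  simp only [List.mem_map, forall_exists_index, and_imp]
  rintro _ t ht rfl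
  have h1 : nat.size B (b + t) ≤ 2 := Ty.size_nat_le (by have := hl t ht; omega) two_ne_zero
  have h2 := Ty.one_le_size B msgTy z
  simp only [Ty.size_prod] at h1 h2 ⊢
  omega

lemma size_append_le (B : ℕ) (a : Ty) {l l' : List a.den} {x y : ℕ}
    (h : (list a).size B l ≤ x) (h' : (list a).size B l' ≤ y + 1) :
    (list a).size B (l ++ l') ≤ x + y := by
  have := Ty.size_append B a l l'
  omega

lemma size_forward_le' {B b g : ℕ} (hb : b + g ≤ B ^ 2) (l : List msgTy.den) :
    (list (prod nat msgTy)).size B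
        (l.flatMap fun z => (List.range g).map fun t => (b + t, z)).reverse ≤
      3 * (g * ((list msgTy).size B l - 1)) + 1 := by
  rw [Ty.size_perm B _ (List.reverse_perm _)]
  induction l with
  | nil => exact Nat.le_add_left 1 _
  | cons z l ih =>
    have h1 := size_forward_le hb z (List.range g) (by simp)
    rw [List.length_range] at h1
    rw [Ty.size_cons, List.flatMap_cons]
    refine (size_append_le B (prod nat msgTy) h1 ih).trans ?_
    have h2 := Ty.one_le_size B (list msgTy) l
    rw [Nat.add_sub_assoc h2, mul_add, mul_add]
    have h3 : g * (3 * msgTy.size B z) = 3 * (g * msgTy.size B z) := by ring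
    omega

instance : Lin forwardBodyC := by unfold forwardBodyC; infer_instance

/-- The loop makes `g` copies of a message, so its output is not linear in its input; the product `g
* msgTy.size B z` is made part of the budget `N` instead. -/
lemma forwardLoopC_cost : ∃ C, ∀ B, 2 ≤ B → ∀ N (b g : ℕ) (z : msgTy.den)
    (y : List (ℕ × msgTy.den)), b + g ≤ B ^ 2 → g ≤ N → g * msgTy.size B z ≤ N →
    (prod (prod nat nat) (prod msgTy (list (prod nat msgTy)))).size B ((b, g), z, y) ≤ N →
    Cost B N C forwardLoopC ((b, g), z, y) := by
  obtain ⟨C₁, h₁⟩ := Lin.cost (p := (pair (pair (π₁ ⊳ π₁) (π₂ ⊳ π₁)) (pair (π₁ ⊳ π₂) (π₂ ⊳ π₂)) :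
    Code (prod (prod nat nat) (prod msgTy (list (prod nat msgTy))))
      (prod (prod nat msgTy) (prod nat (list (prod nat msgTy))))))
  obtain ⟨C₂, h₂⟩ := Lin.cost (p := forwardBodyC)
  have key : ∀ B, 2 ≤ B → ∀ N (b g : ℕ) (z : msgTy.den)
      (y : List (ℕ × msgTy.den)), b + g ≤ B ^ 2 → g ≤ N → g * msgTy.size B z ≤ N →
      (prod (prod nat msgTy) (prod nat (list (prod nat msgTy)))).size B ((b, z), g, y) ≤ N →
      Cost B (6 * N) (C₂ + 1 + 3) (loop forwardBodyC) ((b, z), g, y) := by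
    intro B hB N b g z y hb hg hz hN
    have e : ∀ l : List ℕ, l.foldl (fun y t => forwardBodyC.eval ((b, z), t, y)) y =
        (l.map fun t => (b + t, z)).reverse ++ y := by
      intro l
      simp only [forwardBodyC, eval_prim, eval_comp, eval_pair, Prim.eval]
      exact foldl_map_cons (fun t : ℕ => (b + t, z)) _ _
    have e' : ∀ l : List ℕ, l.length ≤ g → (∀ t ∈ l, t < g) →
        (list (prod nat msgTy)).size B ((l.map fun t => (b + t, z)).reverse ++ y) ≤ 3 * N +
          (list (prod nat msgTy)).size B y := by
      intro l hl hl'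
      have h1 := size_forward_le hb z l hl'
      have h3 : l.length * (3 * msgTy.size B z) ≤ g * (3 * msgTy.size B z) :=
        Nat.mul_le_mul_right _ hl
      have h4 : g * (3 * msgTy.size B z) = 3 * (g * msgTy.size B z) := by ring
      have h5 := Ty.one_le_size B (list (prod nat msgTy)) y
      exact (size_append_le B (prod nat msgTy) (x := 3 * N + 1)
        (y := (list (prod nat msgTy)).size B y - 1)
        ((Ty.size_perm B _ (List.reverse_perm _)).le.trans (h1.trans (by omega)))
        (by omega)).trans (by omega)
    simp only [Ty.size_prod] at hN
    refine loop_cost_of_bounds (by simp only [Ty.size_prod]; omega) (by simp only; omega) ?_ ?_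
    · intro l₁ t l₂ hl
      have ht : ∀ t' ∈ l₁, t' < g := fun t' ht' => by
        rw [← List.mem_range, hl]; simp [ht']
      have hlen : l₁.length ≤ g := by
        have := congrArg List.length hl
        simp at this
        omega
      have htg : t < g := by
        rw [← List.mem_range, hl]; simp
      have hs := Ty.size_nat_mono (B := B) htg.le
      have := e' l₁ hlen ht
      refine h₂ B hB _ _ ?_
      simp only [e]
      simp only [Ty.size_prod] at this ⊢
      omega
    · have := e' (List.range g) (by simp) (by simp)
      rw [eval_loop]
      simp only [e]
      omega
  -- This dominates the constant of `Cost.comp`. The first factor is raised to `C₁ + 1` to be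
  -- positive, so that the intermediate budget is at least `N`.
  refine ⟨C₁ + (6 * (C₂ + 1 + 3)) + 6 * (C₂ + 1 + 3) * (C₁ + 1) + C₁ + 1 + 2,
    fun B hB N b g z y hb hg hz hN => ?_⟩
  have hN1 := (Ty.one_le_size B _ _).trans hN
  have k₁ := h₁ B hB N ((b, g), z, y) hN
  have k₂ := key B hB N b g z y hb hg hz (by
    simp only [Ty.size_prod] at hN ⊢
    omega)
  have k₁' : Cost B N (C₁ + 1) _ _ := k₁.mono le_rfl (Nat.le_succ C₁)
  have k₃ : Cost B ((C₁ + 1) * N) (6 * (C₂ + 1 + 3)) (loop forwardBodyC) ((b, z), g, y) := by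
    have e6 : (C₂ + 1 + 3) * (6 * N) ≤ 6 * (C₂ + 1 + 3) * ((C₁ + 1) * N) := by
      have : N ≤ (C₁ + 1) * N := Nat.le_mul_of_pos_left _ (by omega)
      calc (C₂ + 1 + 3) * (6 * N) = 6 * (C₂ + 1 + 3) * N := by ring
        _ ≤ _ := Nat.mul_le_mul_left _ this
    exact ⟨k₂.size_le.trans e6, k₂.space_le.trans e6, k₂.time_le.trans
      ((Nat.pow_le_pow_left (by omega) _).trans (Nat.pow_le_pow_right (by omega) (by omega)))⟩
  exact (k₁'.comp hN1 k₃).mono le_rfl (by omega)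

/-- The total volume of forwarded copies is the group size times the volume received. Bounding this
product, instead of its factors, keeps the cost linear. -/
lemma gatherC_cost : ∃ C, ∀ B, 2 ≤ B → ∀ N (x : inTy.den) (b g : ℕ), inTy.size B x ≤ N →
    b = (kA.eval x : ℕ) / (sA.eval x : ℕ) * (sA.eval x : ℕ) →
    g = groupSize (sA.eval x) (MA.eval x) b →
    b + g ≤ B ^ 2 → g ≤ N → g * ((list msgTy).size B (inboxA.eval x) - 1) ≤ N →
    Cost B N C gatherC x := by
  obtain ⟨C₃, h₃⟩ := Lin.cost (p := (mkSt inpA XA EA thetaA (num 4) qA : Code inTy stTy))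
  obtain ⟨C₄, h₄⟩ := Lin.cost (p := (pair (bin .mul (bin .div kA sA) sA) (prim .id) ⊳
      pair (pair π₁ (pair (π₂ ⊳ sA) (pair (π₂ ⊳ MA) π₁) ⊳ groupSizeC))
        (pair (π₂ ⊳ inboxA) nilC) :
        Code inTy (prod (prod nat nat) (prod (list msgTy) (list (prod nat msgTy))))))
  obtain ⟨C₅, h₅⟩ := forwardLoopC_cost
  have key : ∀ B, 2 ≤ B → ∀ N (b g : ℕ) (l : List msgTy.den), b + g ≤ B ^ 2 → g ≤ N →
      g * ((list msgTy).size B l - 1) ≤ N →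
      (prod (prod nat nat) (prod (list msgTy) (list (prod nat msgTy)))).size B ((b, g), l, []) ≤ N →
      Cost B (5 * N) (C₅ + 1 + 3) (fold forwardLoopC) ((b, g), l, []) := by
    intro B hB N b g l hb hg hl hN
    have e := fun l' : List msgTy.den => foldl_forwardLoopC b g l' []
    simp only [List.append_nil] at e
    have e' : ∀ l₁ l₂, l = l₁ ++ l₂ → (list (prod nat msgTy)).size B
        (l₁.flatMap fun z => (List.range g).map fun t => (b + t, z)).reverse ≤ 1 + 3 * N := by
      rintro l₁ l₂ rfl
      have h1 := size_forward_le' hb l₁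
      have h2 := Ty.size_append B msgTy l₁ l₂
      have h4 := Ty.one_le_size B (list msgTy) l₂
      have h5 : g * ((list msgTy).size B l₁ - 1) ≤ N :=
        (Nat.mul_le_mul_left _ (by omega)).trans hl
      omega
    simp only [Ty.size_prod] at hN
    have hN1 : 1 ≤ N := by have := Ty.one_le_size B (list msgTy) l; omega
    refine fold_cost_of_bounds (by simp only [Ty.size_prod]; omega) ?_ ?_
    · intro l₁ z l₂ hz
      have h1 := e' l₁ (z :: l₂) hz
      have h2 := Ty.size_mem_le B msgTy (l := l) (x := z)
        (by simp only at hz; rw [hz]; simp)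
      simp only [e]
      refine h₅ B hB _ b g z _ hb (by omega) ?_ ?_
      · have : g * msgTy.size B z ≤ N := (Nat.mul_le_mul_left _ (by omega)).trans hl
        omega
      · simp only [Ty.size_prod] at h1 h2 ⊢
        omega
    · have := e' l [] (List.append_nil l).symm
      rw [eval_fold]
      simp only [e]
      omega
  refine ⟨C₃ + (C₄ + 1 + (5 * (C₅ + 1 + 3)) + 5 * (C₅ + 1 + 3) * (C₄ + 1) + 2) + 2,
    fun B hB N x b g hx hb hg hbg hgN hl => ?_⟩
  have hN1 := (Ty.one_le_size B _ _).trans hx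
  refine Cost.pair hx (h₃ B hB N x hx) (Cost.comp hN1
    ((h₄ B hB N x hx).mono le_rfl (Nat.le_succ C₄)) ?_)
  have k₄ := ((h₄ B hB N x hx).mono le_rfl (Nat.le_succ C₄)).size_le
  have hN2 : N ≤ (C₄ + 1) * N := Nat.le_mul_of_pos_left _ (by omega)
  have e1 : (pair (bin .mul (bin .div kA sA) sA) (prim .id) ⊳
      pair (pair π₁ (pair (π₂ ⊳ sA) (pair (π₂ ⊳ MA) π₁) ⊳ groupSizeC))
        (pair (π₂ ⊳ inboxA) nilC) :
        Code inTy (prod (prod nat nat) (prod (list msgTy) (list (prod nat msgTy))))).eval x =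
      ((b, g), (inboxA.eval x), []) := by
    rw [hg, hb]
    simp only [groupSizeC, groupSize, eval_prim, eval_comp, eval_pair, Prim.eval]
  rw [e1] at k₄ ⊢
  have k₅ := key B hB ((C₄ + 1) * N) b g _ hbg (by omega) (by omega) k₄
  have e5 : (C₅ + 1 + 3) * (5 * ((C₄ + 1) * N)) = 5 * (C₅ + 1 + 3) * ((C₄ + 1) * N) := by ring
  refine ⟨k₅.size_le.trans e5.le, k₅.space_le.trans e5.le, k₅.time_le.trans ?_⟩
  rw [e5]
  exact Nat.pow_le_pow_right (by omega) (by omega)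

/-- Bounds on the addresses and on the number of messages in a round. -/
structure Admissible (B N : ℕ) (x : inTy.den) : Prop where
  scatter : modeA.eval x = (2 : ℕ) → ∀ i ∈ XA.eval x, ((kA.eval x : ℕ) * (sA.eval x : ℕ) +
      i % groupSize (sA.eval x) (MA.eval x) ((kA.eval x : ℕ) * (sA.eval x : ℕ)) : ℕ) < B ^ 2
  gather : modeA.eval x = (3 : ℕ) → ∃ b g : ℕ,
    b = (kA.eval x : ℕ) / (sA.eval x : ℕ) * (sA.eval x : ℕ) ∧
    g = groupSize (sA.eval x) (MA.eval x) b ∧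
    b + g ≤ B ^ 2 ∧ g ≤ N ∧ g * ((list msgTy).size B (inboxA.eval x) - 1) ≤ N

lemma eval_le_num {a : Ty} (p : Code a nat) (c : ℕ) (x : a.den) :
    (bin .le p (num c)).eval x = if (p.eval x : ℕ) ≤ c then (1 : ℕ) else (0 : ℕ) := by
  simp only [eval_prim, eval_comp, eval_pair, Prim.eval]

lemma le_of_eval_ne {a : Ty} {p : Code a nat} {c : ℕ} {x : a.den}
    (h : (bin .le p (num c)).eval x ≠ (0 : ℕ)) : (p.eval x : ℕ) ≤ c := by
  by_contra H
  rw [eval_le_num, if_neg H] at h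
  exact h rfl

lemma lt_of_eval_eq {a : Ty} {p : Code a nat} {c : ℕ} {x : a.den}
    (h : (bin .le p (num c)).eval x = (0 : ℕ)) : c < (p.eval x : ℕ) := by
  by_contra H
  rw [eval_le_num, if_pos (not_lt.mp H)] at h
  exact one_ne_zero h

lemma stepC_cost : ∃ C, ∀ B, 2 ≤ B → ∀ N (x : inTy.den), inTy.size B x ≤ N → Admissible B N x →
    Cost B N C stepC x := by
  obtain ⟨C₁, h₁⟩ := Lin.cost (p := modeA)
  obtain ⟨C₂, h₂⟩ := Lin.cost (p := (bin .le modeA (num 1) : Code inTy nat))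
  obtain ⟨C₃, h₃⟩ := Lin.cost (p := (bin .le modeA (num 2) : Code inTy nat))
  obtain ⟨C₄, h₄⟩ := Lin.cost (p := (bin .le modeA (num 3) : Code inTy nat))
  obtain ⟨D₀, k₀⟩ := Lin.cost (p := sampleC)
  obtain ⟨D₁, k₁⟩ := Lin.cost (p := localRatioC)
  obtain ⟨D₂, k₂⟩ := scatterC_cost
  obtain ⟨D₃, k₃⟩ := gatherC_cost
  obtain ⟨D₄, k₄⟩ := Lin.cost (p := receiveC)
  refine ⟨_, fun B hB N x hx h => Cost.ite hx (h₁ B hB N x hx) (fun e0 =>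
    Cost.mono (Cost.ite hx (h₂ B hB N x hx) (fun e1 => Cost.mono (k₁ B hB N x hx) le_rfl
      (le_max_left D₁ _)) (fun e1 => Cost.mono (Cost.ite hx (h₃ B hB N x hx) (fun e2 =>
        Cost.mono (k₂ B hB N x hx (h.scatter ?_)) le_rfl (le_max_left D₂ _))
        (fun e2 => Cost.mono (Cost.ite hx (h₄ B hB N x hx) (fun e3 =>
          Cost.mono (?_ : Cost B N D₃ gatherC x) le_rfl (le_max_left D₃ D₄))
          fun _ => Cost.mono (k₄ B hB N x hx) le_rfl (le_max_right D₃ D₄))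
        le_rfl (le_max_right D₂ _))) le_rfl (le_max_right D₁ _))) le_rfl (le_max_right D₀ _))
    (fun _ => Cost.mono (k₀ B hB N x hx) le_rfl (le_max_left D₀ _))⟩
  · exact le_antisymm (le_of_eval_ne e2) (lt_of_eval_eq e1)
  · obtain ⟨b, g, hb, hg, h5, h6, h7⟩ :=
      h.gather (le_antisymm (le_of_eval_ne e3) (lt_of_eval_eq e2))
    exact k₃ B hB N x b g hx hb hg h5 h6 h7

end Code

end MapReduce

namespace MapReduce

open Ty Code

/-! ## Analysis of local ratio -/

/-- The flag separates an empty minimum from a minimum of value zero. The value for an empty minimum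
is `0`, so that `lrStep` then does nothing. Induction from the right end follows the fold. -/
lemma minRes_spec (T : List ℕ) (res : List (ℕ × ℝ)) :
    ((minRes T res).1 = 0 → (∀ z ∈ res, z.1 ∉ T) ∧ (minRes T res).2 = 0) ∧
    ((minRes T res).1 ≠ 0 → (∃ z ∈ res, z.1 ∈ T ∧ z.2 = (minRes T res).2) ∧
      ∀ z ∈ res, z.1 ∈ T → (minRes T res).2 ≤ z.2) := by
  classical
  induction res using List.reverseRecOn with
  | nil => simp [minRes]
  | append_singleton l z ih =>
    have e : minRes T (l ++ [z]) = if z.1 ∈ T ∧ ((minRes T l).1 = 0 ∨ z.2 ≤ (minRes T l).2) then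
        (1, z.2) else minRes T l := by
      simp only [minRes, List.foldl_append, List.foldl_cons, List.foldl_nil]
      congr
    generalize minRes T l = y at e ih
    by_cases h : z.1 ∈ T ∧ (y.1 = 0 ∨ z.2 ≤ y.2)
    · rw [if_pos h] at e
      rw [e]
      refine ⟨by simp, fun _ => ⟨⟨z, by simp, h.1, rfl⟩, fun z' hz' hT => ?_⟩⟩
      rcases List.mem_append.mp hz' with h1 | h1
      · by_cases hy : y.1 = 0
        · exact absurd hT ((ih.1 hy).1 z' h1)
        · exact (h.2.resolve_left hy).trans ((ih.2 hy).2 z' h1 hT)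
      · rw [List.mem_singleton.mp h1]
    · rw [if_neg h] at e
      rw [e]
      refine ⟨fun hy => ⟨fun z' hz' hT => ?_, (ih.1 hy).2⟩, fun hy => ?_⟩
      · rcases List.mem_append.mp hz' with h1 | h1
        · exact (ih.1 hy).1 z' h1 hT
        · rw [List.mem_singleton.mp h1] at hT
          exact h ⟨hT, Or.inl hy⟩
      · obtain ⟨⟨z₀, hz₀, hT₀, e₀⟩, hmin⟩ := ih.2 hy
        refine ⟨⟨z₀, by simp [hz₀], hT₀, e₀⟩, fun z' hz' hT => ?_⟩
        rcases List.mem_append.mp hz' with h1 | h1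
        · exact hmin z' h1 hT
        · rw [List.mem_singleton.mp h1] at hT ⊢
          by_contra hlt
          exact h ⟨hT, Or.inr (not_le.mp hlt).le⟩

/-- The residual weights and the recorded elements (last one first) after local ratio has processed
the list `L`, starting from the weights `W`. -/
noncomputable def lrRun (W : List (ℕ × ℝ)) (L : List (List ℕ)) : List (ℕ × ℝ) × List (List ℕ) :=
  L.foldl lrStep (W, [])

lemma lrRun_append (W : List (ℕ × ℝ)) (L L' : List (List ℕ)) :
    lrRun W (L ++ L') = L'.foldl lrStep (lrRun W L) := List.foldl_append

/-- Only the recorded elements matter. -/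
lemma lrRun_reverse_snd (W : List (ℕ × ℝ)) (L : List (List ℕ)) :
    lrRun W (lrRun W L).2.reverse = lrRun W L := by
  induction L using List.reverseRecOn with
  | nil => rfl
  | append_singleton L T ih =>
    have e : lrRun W (L ++ [T]) = lrStep (lrRun W L) T := by simp [lrRun_append]
    rw [e]
    by_cases h : (minRes T (lrRun W L).1).2 ≤ 0
    · have e' : lrStep (lrRun W L) T = lrRun W L := by rw [lrStep, if_pos h]
      rw [e', ih]
    · have e' : (lrStep (lrRun W L) T).2 = T :: (lrRun W L).2 := by rw [lrStep, if_neg h]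
      rw [e', List.reverse_cons, lrRun_append, ih]
      rfl

open Classical in
/-- The indices of the sets whose residual weight is zero. -/
noncomputable def zeros (res : List (ℕ × ℝ)) : List ℕ :=
  (res.filter fun z => z.2 ≤ 0).map Prod.fst

variable {n m : ℕ} (I : SetCover n m)

/-- The list of the sets that contain `j`. -/
def setsOf (j : Fin m) : List ℕ :=
  ((List.finRange n).filter fun i => decide (i ∈ I.T j)).map (fun i : Fin n => (i : ℕ))

lemma mem_setsOf {j : Fin m} {k : ℕ} : k ∈ setsOf I j ↔ ∃ i ∈ I.T j, (i : ℕ) = k := by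
  simp [setsOf]

lemma coe_mem_setsOf {j : Fin m} {i : Fin n} : (i : ℕ) ∈ setsOf I j ↔ i ∈ I.T j := by
  rw [mem_setsOf]
  exact ⟨fun ⟨_, h, e⟩ => Fin.val_injective e ▸ h, fun h => ⟨i, h, rfl⟩⟩

lemma length_setsOf (j : Fin m) : (setsOf I j).length ≤ I.maxFreq := by
  refine le_trans (le_of_eq ?_) (Finset.le_sup (f := fun j => (I.T j).card) (mem_univ j))
  rw [setsOf, List.length_map]
  have h1 : ((List.finRange n).filter fun i => decide (i ∈ I.T j)).Nodup :=
    (List.nodup_finRange n).filter _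
  rw [← List.toFinset_card_of_nodup h1]
  congr 1
  ext i
  simp

/-- The weights, or residual weights, in a given order. -/
def enc (idx : List (Fin n)) (r : Fin n → ℝ) : List (ℕ × ℝ) := idx.map fun i : Fin n => ((i : ℕ), r i)

lemma mem_zeros_enc {idx : List (Fin n)} (hidx : ∀ i, i ∈ idx) (r : Fin n → ℝ) {k : ℕ} :
    k ∈ zeros (enc idx r) ↔ ∃ i : Fin n, (i : ℕ) = k ∧ r i ≤ 0 := by
  classical
  simp only [zeros, enc, List.mem_map, List.mem_filter, decide_eq_true_eq]
  constructor
  · rintro ⟨_, ⟨⟨i, _, rfl⟩, h⟩, rfl⟩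
    exact ⟨i, rfl, h⟩
  · rintro ⟨i, rfl, h⟩
    exact ⟨_, ⟨⟨i, hidx i, rfl⟩, h⟩, rfl⟩

lemma nodup_zeros_enc {idx : List (Fin n)} (hidx : idx.Nodup) (r : Fin n → ℝ) :
    (zeros (enc idx r)).Nodup := by
  classical
  have h : (zeros (enc idx r)).Sublist (idx.map fun i : Fin n => (i : ℕ)) := by
    have := (List.filter_sublist (p := fun z : ℕ × ℝ => decide (z.2 ≤ 0))
      (l := enc idx r)).map Prod.fst
    simpa [zeros, enc, Function.comp_def] using this
  exact h.nodup (hidx.map Fin.val_injective)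

/-- The invariant of local ratio: residual weights `r` and a lower bound `D` for all covers. -/
structure LRInv (idx : List (Fin n)) (y : List (ℕ × ℝ) × List (List ℕ)) (r : Fin n → ℝ) (D : ℝ) :
    Prop where
  enc_eq : y.1 = enc idx r
  nonneg : ∀ i, 0 ≤ r i
  le_w : ∀ i, r i ≤ I.w i
  sum_le : ∑ i, (I.w i - r i) ≤ I.maxFreq * D
  le_sum : ∀ Y, I.IsCover Y → D ≤ ∑ i ∈ Y, (I.w i - r i)
  length_le : y.2.length ≤ (univ.filter fun i => r i ≤ 0).card
  mem : ∀ T ∈ y.2, ∃ j, T = setsOf I j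

lemma LRInv.init (idx : List (Fin n)) : LRInv I idx (enc idx I.w, []) I.w 0 where
  enc_eq := rfl
  nonneg i := (I.w_pos i).le
  le_w _ := le_rfl
  sum_le := by simp
  le_sum := by simp
  length_le := Nat.zero_le _
  mem := by simp

variable {I}

/-- Messages that carry a weight have an empty element part. They are processed together with the
real elements and must have no effect. -/
lemma lrStep_nil (y : List (ℕ × ℝ) × List (List ℕ)) : lrStep y [] = y := by
  rw [lrStep, if_pos]
  have h := minRes_spec [] y.1
  by_cases h0 : (minRes [] y.1).1 = 0
  · exact (h.1 h0).2.le
  · obtain ⟨⟨z, _, hz, _⟩, _⟩ := h.2 h0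
    simp at hz

/-- The local ratio argument. Subtracting the minimum `ε` on `I.T j` removes at most `maxFreq * ε`
in total, while every cover meets `I.T j` and so is charged at least `ε`. The minimizing set ends
with residual zero, and zeros are never lost. -/
lemma LRInv.step {idx : List (Fin n)} (hidx : ∀ i, i ∈ idx)
    {y : List (ℕ × ℝ) × List (List ℕ)} {r : Fin n → ℝ} {D : ℝ} (h : LRInv I idx y r D)
    (j : Fin m) : ∃ r' D', LRInv I idx (lrStep y (setsOf I j)) r' D' ∧ (∀ i, r' i ≤ r i) ∧
      ∃ i ∈ I.T j, r' i ≤ 0 := by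
  classical
  have hspec := minRes_spec (setsOf I j) y.1
  obtain ⟨i₀, hi₀⟩ := I.feasible j
  have hi₀' : i₀ ∈ I.T j := by simp [SetCover.T, hi₀]
  have hmem : ∀ i : Fin n, ((i : ℕ), r i) ∈ y.1 := fun i => by
    rw [h.enc_eq, enc]
    exact List.mem_map_of_mem (hidx i)
  have hne : (minRes (setsOf I j) y.1).1 ≠ 0 := fun h0 =>
    (hspec.1 h0).1 _ (hmem i₀) ((coe_mem_setsOf I).mpr hi₀')
  obtain ⟨⟨z, hz, hzT, hze⟩, hmin⟩ := hspec.2 hne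
  rw [h.enc_eq, enc, List.mem_map] at hz
  obtain ⟨i₁, _, rfl⟩ := hz
  have hi₁ : i₁ ∈ I.T j := (coe_mem_setsOf I).mp hzT
  simp only at hze
  rw [lrStep, ← hze]
  by_cases h0 : r i₁ ≤ 0
  · rw [if_pos h0]
    exact ⟨r, D, h, fun _ => le_rfl, i₁, hi₁, h0⟩
  rw [if_neg h0]
  push Not at h0
  have hmin' : ∀ i ∈ I.T j, r i₁ ≤ r i := fun i hi => by
    rw [hze]
    exact hmin _ (hmem i) ((coe_mem_setsOf I).mpr hi)
  have hle : ∀ i, (if i ∈ I.T j then r i - r i₁ else r i) ≤ r i := fun i => by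
    split_ifs <;> linarith
  have hsum : ∀ Y : Finset (Fin n), ∑ i ∈ Y, (I.w i - if i ∈ I.T j then r i - r i₁ else r i) =
      ∑ i ∈ Y, (I.w i - r i) + (Y.filter fun i => i ∈ I.T j).card * r i₁ := fun Y => by
    rw [← nsmul_eq_mul, ← Finset.sum_const, Finset.sum_filter, ← Finset.sum_add_distrib]
    refine Finset.sum_congr rfl fun i _ => ?_
    split_ifs <;> ring
  refine ⟨fun i => if i ∈ I.T j then r i - r i₁ else r i, D + r i₁,
    ⟨?_, fun i => ?_, fun i => (hle i).trans (h.le_w i), ?_, fun Y hY => ?_, ?_, ?_⟩, hle, i₁, hi₁,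
    by simp [hi₁]⟩
  · rw [h.enc_eq]
    simp only [lower, enc, List.map_map]
    refine List.map_congr_left fun i _ => ?_
    simp only [Function.comp, coe_mem_setsOf]
    split_ifs <;> rfl
  · split_ifs with hi
    · linarith [hmin' i hi]
    · exact h.nonneg i
  · rw [hsum, mul_add]
    have : ((univ.filter fun i => i ∈ I.T j).card : ℝ) ≤ I.maxFreq := by
      rw [Finset.filter_mem_eq_inter, Finset.univ_inter]
      exact_mod_cast Finset.le_sup (f := fun j => (I.T j).card) (mem_univ j)
    exact add_le_add h.sum_le (mul_le_mul_of_nonneg_right this h0.le)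
  · rw [hsum]
    obtain ⟨i, hi, hij⟩ := hY j
    have : (1 : ℝ) ≤ (Y.filter fun i => i ∈ I.T j).card := by
      exact_mod_cast Finset.card_pos.mpr ⟨i, by simp [hi, SetCover.T, hij]⟩
    nlinarith [h.le_sum Y hY]
  · rw [List.length_cons]
    refine Nat.succ_le_of_lt (h.length_le.trans_lt (Finset.card_lt_card ?_))
    -- A recorded element had a positive minimum, so `i₁` is a new zero. Thus the record never
    -- outgrows the number of zeros.
    refine Finset.ssubset_iff_subset_ne.mpr ⟨fun i hi => ?_, fun e => ?_⟩
    · simp only [mem_filter, mem_univ, true_and] at hi ⊢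
      exact (hle i).trans hi
    · have : i₁ ∈ univ.filter fun i => r i ≤ 0 := by
        rw [e]
        simp [hi₁]
      simp only [mem_filter, mem_univ, true_and] at this
      linarith
  · intro T hT
    rcases List.mem_cons.mp hT with rfl | hT
    · exact ⟨j, rfl⟩
    · exact h.mem T hT

/-- Residual weights only decrease, so an element that has acquired a set of residual zero keeps it
while later elements are processed. -/
lemma LRInv.foldl {idx : List (Fin n)} (hidx : ∀ i, i ∈ idx) (L : List (List ℕ)) :
    ∀ {y : List (ℕ × ℝ) × List (List ℕ)} {r : Fin n → ℝ} {D : ℝ}, LRInv I idx y r D →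
    (∀ T ∈ L, T = [] ∨ ∃ j, T = setsOf I j) →
    ∃ r' D', LRInv I idx (L.foldl lrStep y) r' D' ∧ (∀ i, r' i ≤ r i) ∧
      ∀ j, setsOf I j ∈ L → ∃ i ∈ I.T j, r' i ≤ 0 := by
  induction L with
  | nil => exact fun h _ => ⟨_, _, h, fun _ => le_rfl, by simp⟩
  | cons T L ih =>
    intro y r D h hL
    have hL' : ∀ T ∈ L, T = [] ∨ ∃ j, T = setsOf I j := fun T' hT' =>
      hL T' (List.mem_cons_of_mem _ hT')
    rw [List.foldl_cons]
    rcases hL T List.mem_cons_self with rfl | ⟨j, rfl⟩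
    · rw [lrStep_nil]
      obtain ⟨r', D', h1, h2, h3⟩ := ih h hL'
      refine ⟨r', D', h1, h2, fun j hj => ?_⟩
      rcases List.mem_cons.mp hj with e | hj
      · obtain ⟨i₀, hi₀⟩ := I.feasible j
        have hi₀' : i₀ ∈ I.T j := by simp [SetCover.T, hi₀]
        have := (coe_mem_setsOf I).mpr hi₀'
        rw [e] at this
        simp at this
      · exact h3 j hj
    · obtain ⟨r₁, D₁, h1, h2, i, hi, hri⟩ := h.step hidx j
      obtain ⟨r', D', h1', h2', h3'⟩ := ih h1 hL'
      refine ⟨r', D', h1', fun i => (h2' i).trans (h2 i), fun j' hj' => ?_⟩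
      rcases List.mem_cons.mp hj' with e | hj'
      · have hij : i ∈ I.T j' := by
          rw [← coe_mem_setsOf, e, coe_mem_setsOf]
          exact hi
        exact ⟨i, hij, (h2' i).trans hri⟩
      · exact h3' j' hj'

/-- A chosen set has lost its whole weight, so the cost is at most the total reduction, hence at
most `maxFreq * D`; and `D` is at most the reduction within any cover, hence at most its cost. -/
lemma LRInv.isApprox {idx : List (Fin n)} {y : List (ℕ × ℝ) × List (List ℕ)} {r : Fin n → ℝ}
    {D : ℝ} (h : LRInv I idx y r D) {X : Finset (Fin n)} (hX : ∀ i, i ∈ X ↔ r i ≤ 0)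
    (hcov : ∀ j, ∃ i ∈ I.T j, r i ≤ 0) : I.IsApprox I.maxFreq X := by
  refine ⟨fun j => ?_, fun Y hY => ?_⟩
  · obtain ⟨i, hi, h0⟩ := hcov j
    exact ⟨i, (hX i).mpr h0, by simpa [SetCover.T] using hi⟩
  · calc I.cost X = ∑ i ∈ X, (I.w i - r i) := by
          refine Finset.sum_congr rfl fun i hi => ?_
          have := le_antisymm ((hX i).mp hi) (h.nonneg i)
          rw [this, sub_zero]
      _ ≤ ∑ i, (I.w i - r i) := Finset.sum_le_sum_of_subset_of_nonneg (subset_univ _)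
          fun i _ _ => sub_nonneg.mpr (h.le_w i)
      _ ≤ I.maxFreq * D := h.sum_le
      _ ≤ I.maxFreq * I.cost Y := by
          refine mul_le_mul_of_nonneg_left ((h.le_sum Y hY).trans ?_) (Nat.cast_nonneg _)
          exact Finset.sum_le_sum fun i _ => by linarith [h.nonneg i]

/-! ### The state of the central machine -/

variable (I)

/-- `E` is a list of recorded elements that local ratio reproduces. -/
structure Recorded (idx : List (Fin n)) (E : List (List ℕ)) : Prop where
  inv : ∃ r D, LRInv I idx (lrRun (enc idx I.w) E) r D
  replay : (lrRun (enc idx I.w) E).2.reverse = E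

/-- The sets chosen after the recorded elements `E` are processed. -/
noncomputable def chosen (idx : List (Fin n)) (E : List (List ℕ)) : List ℕ :=
  zeros (lrRun (enc idx I.w) E).1

open Classical in
/-- The elements not covered by the chosen sets. -/
noncomputable def uncovered (idx : List (Fin n)) (E : List (List ℕ)) : Finset (Fin m) :=
  univ.filter fun j => ∀ i ∈ setsOf I j, i ∉ chosen I idx E

/-- The recorded elements after local ratio has processed the elements in `F`, too. -/
noncomputable def record (idx : List (Fin n)) (E F : List (List ℕ)) : List (List ℕ) :=
  (lrRun (enc idx I.w) (E ++ F)).2.reverse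

variable {I} {idx : List (Fin n)} {E F : List (List ℕ)}

lemma Recorded.nil : Recorded I idx [] := ⟨⟨_, _, LRInv.init I idx⟩, rfl⟩

lemma Recorded.record_inv (hidx : ∀ i, i ∈ idx) (h : Recorded I idx E)
    (hF : ∀ T ∈ F, T = [] ∨ ∃ j, T = setsOf I j) : Recorded I idx (record I idx E F) := by
  obtain ⟨r, D, hr⟩ := h.inv
  obtain ⟨r', D', h1, _, _⟩ := hr.foldl hidx F hF
  rw [← lrRun_append] at h1
  have e : lrRun (enc idx I.w) (record I idx E F) = lrRun (enc idx I.w) (E ++ F) :=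
    lrRun_reverse_snd _ _
  exact ⟨⟨r', D', by rw [e]; exact h1⟩, by rw [e]; rfl⟩

lemma chosen_record : chosen I idx (record I idx E F) = zeros (lrRun (enc idx I.w) (E ++ F)).1 := by
  rw [chosen, record, lrRun_reverse_snd]

lemma Recorded.mem_uncovered (hidx : ∀ i, i ∈ idx) {r : Fin n → ℝ} {D : ℝ}
    (hr : LRInv I idx (lrRun (enc idx I.w) E) r D) {j : Fin m} :
    j ∈ uncovered I idx E ↔ ∀ i ∈ I.T j, ¬ r i ≤ 0 := by
  classical
  simp only [uncovered, mem_filter, mem_univ, true_and, mem_setsOf, chosen, hr.enc_eq,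
    mem_zeros_enc hidx]
  constructor
  · exact fun h i hi h0 => h i ⟨i, hi, rfl⟩ ⟨i, rfl, h0⟩
  · rintro h _ ⟨i, hi, rfl⟩ ⟨i', e, h0⟩
    rw [Fin.val_injective e] at h0
    exact h i hi h0

/-- The sets of residual zero only increase in number, and every processed element gets one. Hence
any element that remains uncovered was uncovered before and was not in the sample. -/
lemma Recorded.uncovered_record (hidx : ∀ i, i ∈ idx) (h : Recorded I idx E)
    (hF : ∀ T ∈ F, T = [] ∨ ∃ j, T = setsOf I j) :
    uncovered I idx (record I idx E F) ⊆
      (uncovered I idx E).filter fun j => setsOf I j ∉ F := by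
  classical
  obtain ⟨r, D, hr⟩ := h.inv
  obtain ⟨r', D', h1, h2, h3⟩ := hr.foldl hidx F hF
  rw [← lrRun_append] at h1
  have e : lrRun (enc idx I.w) (record I idx E F) = lrRun (enc idx I.w) (E ++ F) :=
    lrRun_reverse_snd _ _
  rw [← e] at h1
  intro j hj
  rw [mem_filter, Recorded.mem_uncovered hidx hr]
  rw [Recorded.mem_uncovered hidx h1] at hj
  refine ⟨fun i hi h0 => hj i hi ((h2 i).trans h0), fun hjF => ?_⟩
  obtain ⟨i, hi, h0⟩ := h3 j hjF
  exact hj i hi h0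

lemma Recorded.length_le (h : Recorded I idx E) : E.length ≤ n := by
  obtain ⟨r, D, hr⟩ := h.inv
  have := hr.length_le
  rw [← List.length_reverse, h.replay] at this
  exact this.trans ((Finset.card_le_univ _).trans (by simp))

lemma Recorded.mem (h : Recorded I idx E) {T : List ℕ} (hT : T ∈ E) : ∃ j, T = setsOf I j := by
  obtain ⟨r, D, hr⟩ := h.inv
  rw [← h.replay, List.mem_reverse] at hT
  exact hr.mem T hT

lemma Recorded.nodup_chosen (hidx : idx.Nodup) (h : Recorded I idx E) :
    (chosen I idx E).Nodup := by
  obtain ⟨r, D, hr⟩ := h.inv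
  rw [chosen, hr.enc_eq]
  exact nodup_zeros_enc hidx r

lemma Recorded.lt_of_mem_chosen (hidx : ∀ i, i ∈ idx) (h : Recorded I idx E) {k : ℕ}
    (hk : k ∈ chosen I idx E) : k < n := by
  obtain ⟨r, D, hr⟩ := h.inv
  rw [chosen, hr.enc_eq, mem_zeros_enc hidx] at hk
  obtain ⟨i, rfl, _⟩ := hk
  exact i.2

lemma chosen_nil (hidx : ∀ i, i ∈ idx) : chosen I idx [] = [] := by
  rw [List.eq_nil_iff_forall_not_mem]
  intro k hk
  change k ∈ zeros (enc idx I.w) at hk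
  rw [mem_zeros_enc hidx] at hk
  obtain ⟨i, _, h0⟩ := hk
  exact absurd (I.w_pos i) (not_lt.mpr h0)

lemma Recorded.isApprox (hidx : ∀ i, i ∈ idx) (h : Recorded I idx E)
    (hU : uncovered I idx E = ∅) {X : Finset (Fin n)}
    (hX : ∀ i : Fin n, i ∈ X ↔ (i : ℕ) ∈ chosen I idx E) : I.IsApprox I.maxFreq X := by
  obtain ⟨r, D, hr⟩ := h.inv
  refine hr.isApprox (fun i => ?_) fun j => ?_
  · rw [hX, chosen, hr.enc_eq, mem_zeros_enc hidx]
    exact ⟨fun ⟨i', e, h0⟩ => Fin.val_injective e ▸ h0, fun h0 => ⟨i, rfl, h0⟩⟩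
  · have : j ∉ uncovered I idx E := by simp [hU]
    rw [Recorded.mem_uncovered hidx hr] at this
    push Not at this
    exact this

end MapReduce

namespace MapReduce

open Ty Code

/-! ## The run of the algorithm -/

/-- All indices, sorted by the machines that they are assigned to. -/
def byMachine {p M : ℕ} (f : Fin p → Fin M) : List (Fin p) :=
  (List.finRange M).flatMap fun k => (List.finRange p).filter fun j => decide (f j = k)

lemma mem_byMachine {p M : ℕ} (f : Fin p → Fin M) (j : Fin p) : j ∈ byMachine f := by
  simp [byMachine]

lemma nodup_byMachine {p M : ℕ} (f : Fin p → Fin M) : (byMachine f).Nodup := by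
  rw [byMachine, List.nodup_flatMap]
  refine ⟨fun k _ => (List.nodup_finRange p).filter _, ?_⟩
  refine (List.nodup_finRange M).imp fun {a b} hab => ?_
  intro j h1 h2
  simp only [List.mem_filter, decide_eq_true_eq] at h1 h2
  exact hab (h1.2.symm.trans h2.2)

lemma length_byMachine {p M : ℕ} (f : Fin p → Fin M) : (byMachine f).length = p := by
  have h := List.toFinset_card_of_nodup (nodup_byMachine f)
  rw [← h, show (byMachine f).toFinset = univ by ext j; simp [mem_byMachine], Finset.card_univ,
    Fintype.card_fin]

variable {n m s : ℕ} (I : SetCover n m) (H : Placement n m s)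

/-- The elements on machine `k`. -/
def eltList (k : Fin (numMachines m s)) : List (Fin m) :=
  (List.finRange m).filter fun j => decide (H.elt j = k)

/-- The elements on machine `k`, with the sets that contain them. -/
def els (k : Fin (numMachines m s)) : List (ℕ × List ℕ) :=
  (eltList H k).map fun j : Fin m => ((j : ℕ), setsOf I j)

/-- The weights on machine `k`. -/
def wts (k : Fin (numMachines m s)) : List (ℕ × ℝ) :=
  enc ((List.finRange n).filter fun i => decide (H.set i = k)) I.w

lemma localInput_eq (k : Fin (numMachines m s)) :
    localInput I H k = (((k : ℕ), numMachines m s, n, m, s), els I H k, wts I H k) := rfl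

/-- The order in which the weights arrive at machine `0`. -/
abbrev idx : List (Fin n) := byMachine H.set

/-- The position of an element on its machine. -/
def pos (j : Fin m) : ℕ := rank (els I H (H.elt j)) j

open Classical in
/-- The elements that are sent to machine `0`, for random words `ρ` and the threshold `θ`. -/
noncomputable def sampledSet (E : List (List ℕ)) (θ : ℕ)
    (ρ : Fin (numMachines m s) → List ℕ) : Finset (Fin m) :=
  (uncovered I (idx H) E).filter fun j => (ρ (H.elt j)).getD (pos I H j) 0 < θ

lemma mem_sampledSet {E : List (List ℕ)} {θ : ℕ} {ρ : Fin (numMachines m s) → List ℕ} {j : Fin m} :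
    j ∈ sampledSet I H E θ ρ ↔ (∀ i ∈ setsOf I j, i ∉ chosen I (idx H) E) ∧
      (ρ (H.elt j)).getD (pos I H j) 0 < θ := by
  classical
  simp [sampledSet, uncovered]

lemma mul_add_div_of_lt {a y s : ℕ} (h : y < s) : (a * s + y) / s = a := by
  rw [Nat.add_comm, Nat.add_mul_div_right _ _ (by omega), Nat.div_eq_of_lt h, zero_add]

lemma mul_add_mod_of_lt {a y s : ℕ} (h : y < s) : (a * s + y) % s = y := by
  rw [Nat.add_comm, Nat.add_mul_mod_self_right, Nat.mod_eq_of_lt h]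

open Classical in
/-- The messages to machine `0` if the elements in `Q` are sampled. -/
noncomputable def inbox₀ (Q : Finset (Fin m)) : List msgTy.den :=
  (List.finRange (numMachines m s)).flatMap fun k =>
    ((eltList H k).filter fun j => decide (j ∈ Q)).map (fun j => (setsOf I j, [])) ++
      (wts I H k).map fun z => ([], [z])

/-- The recorded elements after a phase in which the elements in `Q` are sampled. -/
noncomputable def nextE (E : List (List ℕ)) (Q : Finset (Fin m)) : List (List ℕ) :=
  record I (idx H) E ((inbox₀ I H Q).map Prod.fst)

/-- The threshold for the next phase. -/
def nextTheta (n m s θ : ℕ) : ℕ := if n + m + s + 2 ≤ θ then θ else 2 * s * θ / n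

lemma mem_inbox₀_fst {Q : Finset (Fin m)} {T : List ℕ} (hT : T ∈ (inbox₀ I H Q).map Prod.fst) :
    T = [] ∨ ∃ j, T = setsOf I j := by
  simp only [inbox₀, List.mem_map, List.mem_flatMap, List.mem_append] at hT
  obtain ⟨_, ⟨k, _, ⟨j, _, rfl⟩ | ⟨z, _, rfl⟩⟩, rfl⟩ := hT
  · exact Or.inr ⟨j, rfl⟩
  · exact Or.inl rfl

lemma setsOf_mem_inbox₀ {Q : Finset (Fin m)} {j : Fin m} (hj : j ∈ Q) :
    setsOf I j ∈ (inbox₀ I H Q).map Prod.fst := by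
  simp only [inbox₀, List.mem_map, List.mem_flatMap, List.mem_append]
  exact ⟨_, ⟨H.elt j, List.mem_finRange _, Or.inl ⟨j, by simp [eltList, hj], rfl⟩⟩, rfl⟩

/-- The weights reach machine `0` in the same order in every phase, independently of the sample. The
replay of recorded elements therefore always starts from the same list. -/
lemma inbox₀_snd (Q : Finset (Fin m)) :
    ((inbox₀ I H Q).map Prod.snd).flatten = enc (idx H) I.w := by
  simp only [inbox₀, idx, byMachine, enc, List.map_flatMap]
  rw [List.flatMap, List.flatten_flatten, List.map_map, List.flatMap]
  congr 1
  refine List.map_congr_left fun k _ => ?_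
  simp only [Function.comp, List.map_append, List.map_map, List.flatten_append, wts, enc]
  induction (eltList H k).filter fun j => decide (j ∈ Q) with
  | nil =>
    induction (List.finRange n).filter fun i => decide (H.set i = k) with
    | nil => rfl
    | cons i l ih => simpa using ih
  | cons j l ih => simpa using ih

lemma size_enc_le {B : ℕ} (hB : n < B) (l : List (Fin n)) (r : Fin n → ℝ) :
    (list (prod nat wt)).size B (enc l r) ≤ l.length * 2 + 1 := by
  refine (Ty.size_list_le B _ (k := 2) ?_).trans (by simp [enc])
  simp only [enc, List.mem_map]
  rintro _ ⟨i, _, rfl⟩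
  have : nat.size B i = 1 := Ty.size_nat_of_lt (i.2.trans hB)
  simp only [Ty.size_prod, this]
  exact le_rfl

lemma size_setsOf_le {B : ℕ} (hB : n < B) (j : Fin m) :
    (list nat).size B (setsOf I j) ≤ I.maxFreq + 1 := by
  refine (Ty.size_list_le B _ (k := 1) ?_).trans ?_
  · intro k hk
    obtain ⟨i, _, rfl⟩ := (mem_setsOf I).mp hk
    exact (Ty.size_nat_of_lt (i.2.trans hB)).le
  · have := length_setsOf I j
    omega

lemma size_inbox₀_le {B : ℕ} (hB : n < B) (Q : Finset (Fin m)) :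
    (list msgTy).size B (inbox₀ I H Q) ≤ Q.card * (I.maxFreq + 2) + n * 4 + 1 := by
  classical
  -- Each machine sends its elements before its weights, so both kinds alternate in the inbox; size
  -- is invariant under permutation, and the kinds can be counted apart.
  have hp : (inbox₀ I H Q).Perm
      ((((byMachine H.elt).filter fun j => decide (j ∈ Q)).map fun j => (setsOf I j, [])) ++
        (enc (idx H) I.w).map fun z => ([], [z])) := by
    refine (List.flatMap_append_perm _ _ _).symm.trans (List.Perm.of_eq ?_)
    simp only [byMachine, idx, enc, wts, eltList, List.filter_flatMap, List.map_flatMap]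
  have h1 : (list msgTy).size B (((byMachine H.elt).filter fun j => decide (j ∈ Q)).map
      fun j => (setsOf I j, [])) ≤ Q.card * (I.maxFreq + 2) + 1 := by
    refine (Ty.size_list_le B _ (k := I.maxFreq + 2) ?_).trans ?_
    · simp only [List.mem_map]
      rintro _ ⟨j, _, rfl⟩
      have := size_setsOf_le I hB j
      simp only [Ty.size_prod]
      exact Nat.add_le_add_right this 1
    · rw [List.length_map]
      refine Nat.add_le_add_right (Nat.mul_le_mul_right _ ?_) 1
      rw [← List.toFinset_card_of_nodup ((nodup_byMachine H.elt).filter _)]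
      refine Finset.card_le_card fun j hj => ?_
      simpa [mem_byMachine] using hj
  have h2 : (list msgTy).size B ((enc (idx H) I.w).map fun z => ([], [z])) ≤ n * 4 + 1 := by
    refine (Ty.size_list_le B _ (k := 4) ?_).trans ?_
    · simp only [List.mem_map, enc]
      rintro _ ⟨_, ⟨i, _, rfl⟩, rfl⟩
      have h := Ty.size_nat_of_lt (i.2.trans hB)
      simp only [Ty.size, List.map_cons, List.map_nil, List.sum_cons, List.sum_nil] at h ⊢
      omega
    · simp [enc, idx, length_byMachine]
  rw [Ty.size_perm B msgTy hp]
  exact (size_append_le B msgTy (y := n * 4) h1 h2).trans (by omega)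

/-- The state of all machines, except for the messages that wait. -/
def HasState (C : Config randomizedLocalRatio (numMachines m s)) (mode q θ : ℕ)
    (E : List (List ℕ)) (X : Fin (numMachines m s) → List ℕ) : Prop :=
  ∀ k, C.state k = (localInput I H k, X k, (if k = 0 then E else []), θ, mode, q)

/-- The list `X` is an enumeration of the chosen sets. -/
def Informed (E : List (List ℕ)) (X : List ℕ) : Prop :=
  X.Nodup ∧ ∀ i, i ∈ X ↔ i ∈ chosen I (idx H) E

/-- The machines with numbers below `q` know the chosen sets. -/
def InformedBelow (q : ℕ) (E : List (List ℕ)) (X : Fin (numMachines m s) → List ℕ) : Prop :=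
  ∀ k : Fin (numMachines m s), ((k : ℕ) < q → Informed I H E (X k)) ∧ (q ≤ (k : ℕ) → X k = [])

variable {I H} {C : Config randomizedLocalRatio (numMachines m s)} {q θ : ℕ} {E : List (List ℕ)}
  {X : Fin (numMachines m s) → List ℕ} {ρ : Fin (numMachines m s) → List ℕ}

/-! ### The effect of one round in each mode -/

lemma state_next (k : Fin (numMachines m s)) :
    (randomizedLocalRatio.next C ρ).state k =
      (stepC.eval (C.state k, C.inbox k, ρ k)).1 := rfl

lemma inbox_next (k : Fin (numMachines m s)) :
    (randomizedLocalRatio.next C ρ).inbox k =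
      (List.finRange (numMachines m s)).flatMap fun i =>
        (List.filter (fun z : ℕ × msgTy.den => decide (z.1 = (k : ℕ)))
          (stepC.eval (C.state i, C.inbox i, ρ i)).2).map Prod.snd := rfl

lemma map_snd_filter_const {α : Type} (d k : ℕ) (l : List α) :
    ((l.map fun z => (d, z)).filter fun z => decide (z.1 = k)).map Prod.snd =
      if d = k then l else [] := by
  induction l with
  | nil => simp
  | cons z l ih => by_cases h : d = k <;> simp_all

/-- All machines know the same chosen sets, so their local tests for uncovered elements together
yield one global sample. -/
lemma HasState.sample (h : HasState I H C 0 q θ E X) (hX : ∀ k, Informed I H E (X k)) :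
    HasState I H (randomizedLocalRatio.next C ρ) 1 q θ E X ∧
      ∀ k, (randomizedLocalRatio.next C ρ).inbox k =
        if k = 0 then inbox₀ I H (sampledSet I H E θ ρ) else [] := by
  classical
  have key : ∀ k, stepC.eval (C.state k, C.inbox k, ρ k) =
      ((localInput I H k, X k, (if k = 0 then E else []), θ, 1, q),
        (((eltList H k).filter fun j => decide (j ∈ sampledSet I H E θ ρ)).map
            (fun j => (setsOf I j, [])) ++ (wts I H k).map fun z => ([], [z])).map
              fun z => ((0 : ℕ), z)) := by
    intro k
    rw [h k, localInput_eq, eval_stepC_sample]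
    congr 1
    rw [List.map_append, List.map_map, List.map_map]
    congr 1
    rw [els, List.filter_map, List.map_map]
    refine congrArg (List.map _) (List.filter_congr fun j hj => ?_)
    have hjk : H.elt j = k := by simpa [eltList] using hj
    refine decide_eq_decide.mpr ?_
    rw [mem_sampledSet]
    simp only [Sampled, pos, hjk, els, (hX k).2]
  refine ⟨fun k => ?_, fun k => ?_⟩
  · rw [state_next, key]
  · rw [inbox_next]
    simp only [key]
    split_ifs with hk
    · subst hk
      rw [inbox₀]
      exact congrArg (fun f => List.flatMap f _) (funext fun i =>
        (map_snd_filter_const 0 0 _).trans (if_pos rfl))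
    · rw [List.flatMap_eq_nil_iff]
      intro i _
      have hk' : ¬ (0 : ℕ) = k := fun e => hk (Fin.ext e.symm)
      exact (map_snd_filter_const 0 k _).trans (if_neg hk')

/-- Every machine runs the same code, but all except machine `0` have an empty record and an empty
inbox and end with no chosen sets. Hence the count of informed machines restarts at `1`. -/
lemma HasState.localRatio {Q : Finset (Fin m)} (h : HasState I H C 1 q θ E X)
    (hC : ∀ k, C.inbox k = if k = 0 then inbox₀ I H Q else []) :
    ∃ X', HasState I H (randomizedLocalRatio.next C ρ) 2 1 (nextTheta n m s θ) (nextE I H E Q) X' ∧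
      X' 0 = chosen I (idx H) (nextE I H E Q) ∧ (∀ k, k ≠ 0 → X' k = []) ∧
      ∀ k, (randomizedLocalRatio.next C ρ).inbox k = [] := by
  have key : ∀ k, stepC.eval (C.state k, C.inbox k, ρ k) =
      ((localInput I H k, if k = 0 then chosen I (idx H) (nextE I H E Q) else [],
        (if k = 0 then nextE I H E Q else []), nextTheta n m s θ, 2, 1), []) := by
    intro k
    rw [h k, hC k, localInput_eq, eval_stepC_localRatio]
    by_cases hk : k = 0
    · simp only [hk, if_true]
      rw [nextE, chosen_record, record, lrRun, ← inbox₀_snd I H Q]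
      rfl
    · simp only [hk, if_false]
      rfl
  refine ⟨fun k => if k = 0 then chosen I (idx H) (nextE I H E Q) else [], fun k => ?_, ?_, ?_,
    fun k => ?_⟩
  · rw [state_next, key]
  · exact if_pos rfl
  · intro k hk
    exact if_neg hk
  · rw [inbox_next]
    simp only [key]
    simp

lemma HasState.done (h : HasState I H C 2 q θ E X) (hq : numMachines m s ≤ q) :
    HasState I H (randomizedLocalRatio.next C ρ) 0 q θ E X ∧
      ∀ k, (randomizedLocalRatio.next C ρ).inbox k = [] := by
  have key : ∀ k, stepC.eval (C.state k, C.inbox k, ρ k) =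
      ((localInput I H k, X k, (if k = 0 then E else []), θ, 0, q), []) := by
    intro k
    rw [h k, localInput_eq, eval_stepC_scatter, if_pos hq]
  refine ⟨fun k => ?_, fun k => ?_⟩
  · rw [state_next, key]
  · rw [inbox_next]
    simp only [key]
    simp

/-- The machine that distributes the list of sets to the group of machine `k`. -/
def leader (k : Fin (numMachines m s)) : Fin (numMachines m s) :=
  ⟨(k : ℕ) / s, (Nat.div_le_self _ _).trans_lt k.2⟩

/-- The size of the group of machine `k`. -/
def groupOf (k : Fin (numMachines m s)) : ℕ := groupSize s (numMachines m s) ((k : ℕ) / s * s)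

/-- The message that carries the index `x`. -/
abbrev idxMsg (x : ℕ) : msgTy.den := ([x], [])

/-- The indices that machine `k` gets from its leader. -/
def share (X : Fin (numMachines m s) → List ℕ) (k : Fin (numMachines m s)) : List ℕ :=
  (X (leader k)).filter fun x => decide (x % groupOf k = (k : ℕ) % s)

/-- The indices that machine `k` gets from its group. -/
def gathered (X : Fin (numMachines m s) → List ℕ) (k : Fin (numMachines m s)) : List ℕ :=
  (List.finRange (numMachines m s)).flatMap fun i : Fin (numMachines m s) =>
    if (i : ℕ) / s = (k : ℕ) / s then (share X i).reverse else []

lemma groupSize_eq (s M b : ℕ) : groupSize s M b = min s (M - b) := by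
  unfold groupSize
  omega

lemma flatMap_finRange_single {α : Type} {M : ℕ} (f : Fin M → List α) (a : Fin M)
    (h : ∀ i, i ≠ a → f i = []) : (List.finRange M).flatMap f = f a := by
  have key : ∀ l : List (Fin M), l.Nodup → l.flatMap f = if a ∈ l then f a else [] := by
    intro l hl
    induction l with
    | nil => rfl
    | cons i l ih =>
      rw [List.nodup_cons] at hl
      rw [List.flatMap_cons, ih hl.2]
      by_cases hi : i = a
      · subst hi
        simp [hl.1]
      · simp [h i hi, Ne.symm hi]
  rw [key _ (List.nodup_finRange M), if_pos (List.mem_finRange a)]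

/-- Machine `i` writes only into the block of `s` addresses starting at `i * s`, so machine `k` can
hear only from machine `k / s`. -/
lemma HasState.scatter (hs : 0 < s) (h : HasState I H C 2 q θ E X)
    (hq : ¬ numMachines m s ≤ q) :
    HasState I H (randomizedLocalRatio.next C ρ) 3 q θ E X ∧
      ∀ k, (randomizedLocalRatio.next C ρ).inbox k = (share X k).map idxMsg := by
  have key : ∀ k, stepC.eval (C.state k, C.inbox k, ρ k) =
      ((localInput I H k, X k, (if k = 0 then E else []), θ, 3, q),
        (X k).map fun x => ((k : ℕ) * s +
          x % groupSize s (numMachines m s) ((k : ℕ) * s), idxMsg x)) := by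
    intro k
    rw [h k, localInput_eq, eval_stepC_scatter, if_neg hq]
  refine ⟨fun k => ?_, fun k => ?_⟩
  · rw [state_next, key]
  · rw [inbox_next]
    simp only [key]
    have hk := Nat.div_add_mod' (k : ℕ) s
    have hlt := Nat.mod_lt (k : ℕ) hs
    refine (flatMap_finRange_single _ (leader k) ?_).trans ?_
    · intro i hi
      rw [List.filter_map, List.map_map]
      rw [List.filter_eq_nil_iff.mpr, List.map_nil]
      intro x _
      simp only [Function.comp, decide_eq_true_eq]
      intro e
      apply hi
      apply Fin.ext
      rw [groupSize_eq] at e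
      simp only [leader]
      have hkM := k.2
      -- If the sender had an empty group, its addresses would be at least the number of machines,
      -- hence not `k`.
      have hg : 0 < min s (numMachines m s - (i : ℕ) * s) := by
        by_contra h0
        have : numMachines m s - (i : ℕ) * s = 0 := by omega
        have h1 : numMachines m s ≤ (i : ℕ) * s := by omega
        omega
      have hx := Nat.mod_lt x hg
      rw [← e, mul_add_div_of_lt (by omega)]
    · rw [List.filter_map, List.map_map, share]
      congr 1
      refine List.filter_congr fun x _ => decide_eq_decide.mpr ?_
      simp only [leader, groupOf]
      omega

lemma map_snd_filter_range {α : Type} (b g k : ℕ) (z : α) :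
    (((List.range g).map fun t => (b + t, z)).filter fun y => decide (y.1 = k)).map Prod.snd =
      if b ≤ k ∧ k < b + g then [z] else [] := by
  induction g with
  | zero =>
    rw [if_neg (by omega)]
    rfl
  | succ g ih =>
    rw [List.range_succ, List.map_append, List.filter_append, List.map_append, ih]
    by_cases h1 : b ≤ k ∧ k < b + g
    · have h2 : ¬ b + g = k := by omega
      have h3 : b ≤ k ∧ k < b + (g + 1) := by omega
      rw [if_pos h1, if_pos h3]
      simp [h2]
    · by_cases h2 : b + g = k
      · have h3 : b ≤ k ∧ k < b + (g + 1) := by omega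
        rw [if_neg h1, if_pos h3]
        simp [h2]
      · have h3 : ¬ (b ≤ k ∧ k < b + (g + 1)) := by omega
        rw [if_neg h1, if_neg h3]
        simp [h2]

lemma map_snd_filter_forward {α : Type} (b g k : ℕ) (l : List α) :
    ((l.flatMap fun z => (List.range g).map fun t => (b + t, z)).reverse.filter
      fun y => decide (y.1 = k)).map Prod.snd =
      if b ≤ k ∧ k < b + g then l.reverse else [] := by
  rw [List.filter_reverse, List.map_reverse, List.filter_flatMap, List.map_flatMap]
  simp only [map_snd_filter_range]
  by_cases h : b ≤ k ∧ k < b + g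
  · simp [h]
  · simp [h]

/-- The addresses used by a member are precisely the machines of its own block, the last block being
cut off at the number of machines. -/
lemma HasState.gather (hs : 0 < s) (h : HasState I H C 3 q θ E X)
    (hC : ∀ k, C.inbox k = (share X k).map idxMsg) :
    HasState I H (randomizedLocalRatio.next C ρ) 4 q θ E X ∧
      ∀ k, (randomizedLocalRatio.next C ρ).inbox k = (gathered X k).map idxMsg := by
  have key : ∀ k, stepC.eval (C.state k, C.inbox k, ρ k) =
      ((localInput I H k, X k, (if k = 0 then E else []), θ, 4, q),
        (((share X k).map idxMsg).flatMap fun z => (List.range (groupOf k)).map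
          fun t => ((k : ℕ) / s * s + t, z)).reverse) := by
    intro k
    rw [h k, hC k, localInput_eq, eval_stepC_gather]
    rfl
  refine ⟨fun k => ?_, fun k => ?_⟩
  · rw [state_next, key]
  · rw [inbox_next]
    simp only [key]
    rw [gathered, List.map_flatMap]
    refine congrArg (fun f => List.flatMap f _) (funext fun i => ?_)
    refine (map_snd_filter_forward _ _ _ _).trans ?_
    have hi := Nat.div_add_mod' (i : ℕ) s
    have hi' := Nat.mod_lt (i : ℕ) hs
    have hk := Nat.div_add_mod' (k : ℕ) s
    have hk' := Nat.mod_lt (k : ℕ) hs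
    have hkM := k.2
    have hiff : ((i : ℕ) / s * s ≤ k ∧ (k : ℕ) < (i : ℕ) / s * s + groupOf i) ↔
        (i : ℕ) / s = (k : ℕ) / s := by
      rw [groupOf, groupSize_eq]
      constructor
      · rintro ⟨h1, h2⟩
        have h3 : (k : ℕ) < (i : ℕ) / s * s + s := by omega
        symm
        rw [Nat.div_eq_iff hs]
        omega
      · intro e
        rw [e]
        omega
    by_cases hik : (i : ℕ) / s = (k : ℕ) / s
    · rw [if_pos (hiff.mpr hik), if_pos hik, List.map_reverse]
    · rw [if_neg (fun h => hik (hiff.mp h)), if_neg hik, List.map_nil]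

lemma HasState.receive (h : HasState I H C 4 q θ E X)
    (hC : ∀ k, C.inbox k = (gathered X k).map idxMsg) :
    HasState I H (randomizedLocalRatio.next C ρ) 2 (q * s) θ E (gathered X) ∧
      ∀ k, (randomizedLocalRatio.next C ρ).inbox k = [] := by
  have key : ∀ k, stepC.eval (C.state k, C.inbox k, ρ k) =
      ((localInput I H k, gathered X k, (if k = 0 then E else []), θ, 2, q * s), []) := by
    intro k
    have e : (((gathered X k).map idxMsg).map Prod.fst).flatten = gathered X k := by
      induction gathered X k with
      | nil => rfl
      | cons x l ih => simpa using ih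
    rw [h k, hC k, localInput_eq, eval_stepC_receive, e]
  refine ⟨fun k => ?_, fun k => ?_⟩
  · rw [state_next, key]
  · rw [inbox_next]
    simp only [key]
    simp

lemma share_eq {k i : Fin (numMachines m s)} (h : (i : ℕ) / s = (k : ℕ) / s) :
    share X i = (X (leader k)).filter fun x => decide (x % groupOf k = (i : ℕ) % s) := by
  have h1 : leader i = leader k := Fin.ext h
  rw [share, h1, groupOf, groupOf, h]

lemma gathered_nil {k : Fin (numMachines m s)} (h : X (leader k) = []) : gathered X k = [] := by
  rw [gathered, List.flatMap_eq_nil_iff]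
  intro i _
  split_ifs with hi
  · rw [share_eq hi, h]
    rfl
  · rfl

lemma groupOf_pos (hs : 0 < s) (k : Fin (numMachines m s)) : 0 < groupOf k := by
  have h1 := Nat.div_mul_le_self (k : ℕ) s
  have h2 := k.2
  rw [groupOf, groupSize_eq]
  omega

/-- Residues modulo the group size partition the leader's list among the members, so collecting all
shares yields each index exactly once. The order may change, which is why being informed refers only
to membership and absence of duplicates. -/
lemma Informed.gathered (hs : 0 < s) {k : Fin (numMachines m s)} (h : Informed I H E (X (leader k))) :
    Informed I H E (gathered X k) := by
  constructor
  · rw [MapReduce.gathered, List.nodup_flatMap]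
    refine ⟨fun i _ => ?_, ?_⟩
    · split_ifs with hi
      · rw [share_eq hi]
        exact List.nodup_reverse.mpr (h.1.filter _)
      · exact List.nodup_nil
    · refine (List.nodup_finRange _).imp fun {a b} hab => ?_
      intro x hxa hxb
      by_cases ha : (a : ℕ) / s = (k : ℕ) / s
      · by_cases hb : (b : ℕ) / s = (k : ℕ) / s
        · simp only [if_pos ha, if_pos hb, share_eq ha, share_eq hb, List.mem_reverse,
            List.mem_filter, decide_eq_true_eq] at hxa hxb
          apply hab
          apply Fin.ext
          rw [← Nat.div_add_mod (a : ℕ) s, ← Nat.div_add_mod (b : ℕ) s, ha, hb, ← hxa.2, ← hxb.2]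
        · simp [if_neg hb] at hxb
      · simp [if_neg ha] at hxa
  · intro x
    rw [← h.2]
    simp only [MapReduce.gathered, List.mem_flatMap, List.mem_finRange, true_and]
    constructor
    · rintro ⟨i, hi⟩
      split_ifs at hi with hik
      · rw [share_eq hik, List.mem_reverse] at hi
        exact (List.mem_filter.mp hi).1
      · simp at hi
    · intro hx
      have hg := Nat.mod_lt x (groupOf_pos hs k)
      have hg' : groupOf k = min s (numMachines m s - (k : ℕ) / s * s) := groupSize_eq _ _ _
      have hdiv : ((k : ℕ) / s * s + x % groupOf k) / s = (k : ℕ) / s := mul_add_div_of_lt (by omega)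
      have hmod : ((k : ℕ) / s * s + x % groupOf k) % s = x % groupOf k := mul_add_mod_of_lt (by omega)
      refine ⟨⟨(k : ℕ) / s * s + x % groupOf k, by omega⟩, ?_⟩
      rw [if_pos hdiv, share_eq hdiv, List.mem_reverse, List.mem_filter]
      exact ⟨hx, by simp only [hmod, decide_true]⟩

/-- The leader `k / s` is below `q` exactly if `k` is below `q * s`. -/
lemma InformedBelow.gathered (hs : 0 < s) (h : InformedBelow I H q E X) :
    InformedBelow I H (q * s) E (gathered X) := by
  intro k
  have h1 : (k : ℕ) / s < q ↔ (k : ℕ) < q * s := Nat.div_lt_iff_lt_mul hs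
  refine ⟨fun hk => Informed.gathered hs ((h (leader k)).1 (h1.mpr hk)), fun hk => ?_⟩
  exact gathered_nil ((h (leader k)).2 (not_lt.mp fun h2 => absurd (h1.mp h2) (not_lt.mpr hk)))

end MapReduce

namespace MapReduce

open Ty Code

/-! ## Memory and time -/

variable {n m s : ℕ} {I : SetCover n m} {H : Placement n m s}

lemma one_le_maxFreq (I : SetCover n m) (hm : 1 ≤ m) : 1 ≤ I.maxFreq := by
  obtain ⟨i, hi⟩ := I.feasible ⟨0, hm⟩
  have hi' : i ∈ I.T ⟨0, hm⟩ := by simp [SetCover.T, hi]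
  exact Nat.succ_le_of_lt ((Finset.card_pos.mpr ⟨i, hi'⟩).trans_le
    (Finset.le_sup (f := fun j => (I.T j).card) (mem_univ _)))

lemma one_le_of_feasible (I : SetCover n m) (hm : 1 ≤ m) : 1 ≤ n := by
  obtain ⟨i, _⟩ := I.feasible ⟨0, hm⟩
  exact Nat.one_le_of_lt i.2

lemma numMachines_le (hm : 1 ≤ m) : numMachines m s ≤ m := by
  have := Nat.div_le_self (m - 1) s
  unfold numMachines
  omega

lemma length_le_of_nodup {l : List ℕ} (h : l.Nodup) (hl : ∀ x ∈ l, x < n) : l.length ≤ n := by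
  rw [← List.toFinset_card_of_nodup h]
  refine (Finset.card_le_card (t := Finset.range n) fun x hx => ?_).trans (by simp)
  simpa using hl x (by simpa using hx)

lemma size_list_nat_le {B : ℕ} {l : List ℕ} (hl : ∀ x ∈ l, x < B) :
    (list nat).size B l ≤ l.length + 1 := by
  simpa using Ty.size_list_le B nat (k := 1) (l := l) fun x hx => (Ty.size_nat_of_lt (hl x hx)).le

lemma size_idxMsg_le {B : ℕ} {l : List ℕ} (hl : ∀ x ∈ l, x < B) :
    (list msgTy).size B (l.map idxMsg) ≤ l.length * 3 + 1 := by
  refine (Ty.size_list_le B msgTy (k := 3) ?_).trans (by simp)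
  simp only [List.mem_map]
  rintro _ ⟨x, hx, rfl⟩
  have := Ty.size_nat_of_lt (hl x hx)
  simp only [Ty.size, List.map_cons, List.map_nil, List.sum_cons, List.sum_nil] at this ⊢
  omega

lemma length_eltList_le (H : Placement n m s) (k : Fin (numMachines m s)) :
    (eltList H k).length ≤ s := by
  rw [eltList, ← List.toFinset_card_of_nodup ((List.nodup_finRange m).filter _)]
  refine le_trans (Finset.card_le_card fun j hj => ?_) (H.balanced k)
  simpa using hj

lemma size_els_le {B : ℕ} (hn : n < B) (hm : m ≤ B) (k : Fin (numMachines m s)) :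
    (list (prod nat (list nat))).size B (els I H k) ≤ s * (I.maxFreq + 2) + 1 := by
  refine (Ty.size_list_le B _ (k := I.maxFreq + 2) ?_).trans ?_
  · simp only [els, List.mem_map]
    rintro _ ⟨j, _, rfl⟩
    have h1 : nat.size B (j : ℕ) = 1 := Ty.size_nat_of_lt (j.2.trans_le hm)
    have h2 := size_setsOf_le I hn j
    simp only [Ty.size_prod, h1]
    omega
  · rw [els, List.length_map]
    exact Nat.add_le_add_right (Nat.mul_le_mul_right _ (length_eltList_le H k)) 1

lemma size_wts_le {B : ℕ} (hn : n < B) (k : Fin (numMachines m s)) :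
    (list (prod nat wt)).size B (wts I H k) ≤ n * 2 + 1 := by
  refine (size_enc_le hn _ _).trans ?_
  have : ((List.finRange n).filter fun i => decide (H.set i = k)).length ≤ n :=
    (List.length_filter_le _ _).trans (by simp)
  omega

lemma size_localInput_le (hm : 1 ≤ m) (k : Fin (numMachines m s)) :
    inputTy.size (wordCap n m s) (localInput I H k) ≤ s * (I.maxFreq + 2) + n * 2 + 7 := by
  have hM := numMachines_le (s := s) hm
  have hk := k.2
  have h1 : nat.size (wordCap n m s) (k : ℕ) = 1 :=
    Ty.size_nat_of_lt (by unfold wordCap; omega)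
  have h2 : nat.size (wordCap n m s) (numMachines m s) = 1 :=
    Ty.size_nat_of_lt (by unfold wordCap; omega)
  have h3 : nat.size (wordCap n m s) n = 1 := Ty.size_nat_of_lt (by unfold wordCap; omega)
  have h4 : nat.size (wordCap n m s) m = 1 := Ty.size_nat_of_lt (by unfold wordCap; omega)
  have h5 : nat.size (wordCap n m s) s = 1 := Ty.size_nat_of_lt (by unfold wordCap; omega)
  have h6 := size_els_le (I := I) (H := H) (B := wordCap n m s) (by unfold wordCap; omega)
    (by unfold wordCap; omega) k
  have h7 := size_wts_le (I := I) (H := H) (B := wordCap n m s) (by unfold wordCap; omega) k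
  rw [localInput_eq]
  simp only [Ty.size_prod, h1, h2, h3, h4, h5]
  omega

lemma Recorded.size_le {ι : List (Fin n)} {E : List (List ℕ)} (h : Recorded I ι E) {B : ℕ}
    (hn : n < B) : (list (list nat)).size B E ≤ n * (I.maxFreq + 1) + 1 := by
  refine (Ty.size_list_le B _ (k := I.maxFreq + 1) fun T hT => ?_).trans
    (Nat.add_le_add_right (Nat.mul_le_mul_right _ h.length_le) 1)
  obtain ⟨j, rfl⟩ := h.mem hT
  exact size_setsOf_le I hn j

lemma Informed.lt {E : List (List ℕ)} (hE : Recorded I (idx H) E) {X : List ℕ}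
    (h : Informed I H E X) : X.Nodup ∧ ∀ x ∈ X, x < n :=
  ⟨h.1, fun _ hx => hE.lt_of_mem_chosen (mem_byMachine _) ((h.2 _).mp hx)⟩

lemma InformedBelow.lt {q : ℕ} {E : List (List ℕ)} (hE : Recorded I (idx H) E)
    {X : Fin (numMachines m s) → List ℕ} (h : InformedBelow I H q E X)
    (k : Fin (numMachines m s)) : (X k).Nodup ∧ ∀ x ∈ X k, x < n := by
  by_cases hk : (k : ℕ) < q
  · exact ((h k).1 hk).lt hE
  · rw [(h k).2 (not_lt.mp hk)]
    simp

/-- The bound for the size of the data of a machine. -/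
def sizeBound (I : SetCover n m) (s : ℕ) : ℕ := 60 * (I.maxFreq * s)

variable {C : Config randomizedLocalRatio (numMachines m s)} {mode q θ : ℕ} {E : List (List ℕ)}
  {X : Fin (numMachines m s) → List ℕ} {ρ : Fin (numMachines m s) → List ℕ}

/-- The random words of a round. -/
def IsWords (n m s : ℕ) (ρ : Fin (numMachines m s) → List ℕ) : Prop :=
  ∀ k, (ρ k).length ≤ s ∧ ∀ x ∈ ρ k, x < wordCap n m s

/-- In the next round all machines stay within the bounds. -/
def Fits (I : SetCover n m) (C : Config randomizedLocalRatio (numMachines m s))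
    (ρ : Fin (numMachines m s) → List ℕ) : Prop :=
  ∀ k, inTy.size (wordCap n m s) (randomizedLocalRatio.stepInput C ρ k) ≤ sizeBound I s ∧
    Admissible (wordCap n m s) (sizeBound I s) (randomizedLocalRatio.stepInput C ρ k)

lemma HasState.size_le (hm : 1 ≤ m) (hns : n ≤ s) (h : HasState I H C mode q θ E X)
    (hmode : mode ≤ 4) (hq : q < wordCap n m s ^ 2) (hθ : θ < wordCap n m s ^ 3)
    (hE : Recorded I (idx H) E) (hX : ∀ k, (X k).Nodup ∧ ∀ x ∈ X k, x < n)
    (hin : ∀ k, (list msgTy).size (wordCap n m s) (C.inbox k) ≤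
      9 * s * (I.maxFreq + 2) + n * 4 + 1)
    (hρ : IsWords n m s ρ) (k : Fin (numMachines m s)) :
    inTy.size (wordCap n m s) (randomizedLocalRatio.stepInput C ρ k) ≤ sizeBound I s := by
  have hn := one_le_of_feasible I hm
  have hf := one_le_maxFreq I hm
  have hB : n < wordCap n m s := by unfold wordCap; omega
  have h1 := size_localInput_le (I := I) (H := H) hm k
  have h2 : (list nat).size (wordCap n m s) (X k) ≤ n + 1 :=
    (size_list_nat_le fun x hx => ((hX k).2 x hx).trans hB).trans
      (Nat.add_le_add_right (length_le_of_nodup (hX k).1 (hX k).2) 1)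
  have h3 : (list (list nat)).size (wordCap n m s) (if k = 0 then E else []) ≤
      n * (I.maxFreq + 1) + 1 := by
    split_ifs
    · exact hE.size_le hB
    · rw [Ty.size_nil]
      omega
  have h4 : nat.size (wordCap n m s) θ ≤ 3 := Ty.size_nat_le hθ (by norm_num)
  have h5 : nat.size (wordCap n m s) q ≤ 2 := Ty.size_nat_le hq (by norm_num)
  have h6 : nat.size (wordCap n m s) mode = 1 := Ty.size_nat_of_lt (by unfold wordCap; omega)
  have h7 : (list nat).size (wordCap n m s) (ρ k) ≤ s + 1 :=
    (size_list_nat_le (hρ k).2).trans (Nat.add_le_add_right (hρ k).1 1)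
  have h8 := hin k
  have e : randomizedLocalRatio.stepInput C ρ k =
      ((localInput I H k, X k, (if k = 0 then E else []), θ, mode, q), C.inbox k, ρ k) := by
    rw [Algorithm.stepInput, h k]
  rw [e]
  have h9 : n * I.maxFreq ≤ s * I.maxFreq := Nat.mul_le_mul_right _ hns
  have h10 : s ≤ s * I.maxFreq := Nat.le_mul_of_pos_right _ hf
  have e1 : 9 * s * (I.maxFreq + 2) = 9 * (s * I.maxFreq) + 18 * s := by ring
  have e2 : s * (I.maxFreq + 2) = s * I.maxFreq + 2 * s := by ring
  have e3 : n * (I.maxFreq + 1) = n * I.maxFreq + n := by ring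
  have e4 : sizeBound I s = 60 * (s * I.maxFreq) := by unfold sizeBound; ring
  rw [e1] at h8
  rw [e2] at h1
  rw [e3] at h3
  rw [e4]
  -- In units of `s * I.maxFreq` the pieces add up to at most `57`: `11` from products with the
  -- frequency, `29` from multiples of `s` and `n`, and `17` from constants.
  refine le_trans (le_of_eq (?_ : _ =
    inputTy.size (wordCap n m s) (localInput I H k) +
      ((list nat).size (wordCap n m s) (X k) +
        ((list (list nat)).size (wordCap n m s) (if k = 0 then E else []) +
          (nat.size (wordCap n m s) θ + (nat.size (wordCap n m s) mode +
            nat.size (wordCap n m s) q)))) +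
      ((list msgTy).size (wordCap n m s) (C.inbox k) +
        (list nat).size (wordCap n m s) (ρ k)))) ?_
  · rfl
  · omega

lemma HasState.admissible (h : HasState I H C mode q θ E X)
    (h2 : mode = 2 → ∀ k : Fin (numMachines m s), ∀ i ∈ X k, (k : ℕ) * s +
      i % groupSize s (numMachines m s) ((k : ℕ) * s) < wordCap n m s ^ 2)
    (h3 : mode = 3 → ∀ k : Fin (numMachines m s), (k : ℕ) / s * s + groupOf k ≤ wordCap n m s ^ 2 ∧
      groupOf k ≤ sizeBound I s ∧
      groupOf k * ((list msgTy).size (wordCap n m s) (C.inbox k) - 1) ≤ sizeBound I s)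
    (k : Fin (numMachines m s)) :
    Admissible (wordCap n m s) (sizeBound I s) (randomizedLocalRatio.stepInput C ρ k) := by
  have e : randomizedLocalRatio.stepInput C ρ k =
      ((localInput I H k, X k, (if k = 0 then E else []), θ, mode, q), C.inbox k, ρ k) := by
    rw [Algorithm.stepInput, h k]
  rw [e, localInput_eq]
  constructor
  · simp only [eval_prim, eval_comp, Prim.eval]
    exact fun e => h2 e k
  · simp only [eval_prim, eval_comp, Prim.eval]
    exact fun e => ⟨_, _, rfl, rfl, h3 e k⟩

/-- The groups share the work of forwarding evenly. -/
lemma groupOf_mul_length_share (hs : 0 < s) (hX : ∀ k, (X k).Nodup ∧ ∀ x ∈ X k, x < n)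
    (k : Fin (numMachines m s)) : groupOf k * (share X k).length ≤ n + groupOf k := by
  have hg := groupOf_pos hs k
  have h1 : (share X k).length ≤ n / groupOf k + 1 := by
    rw [share, ← List.toFinset_card_of_nodup ((hX _).1.filter _)]
    -- Indices in one residue class are told apart by their quotients, which are at most `n /
    -- groupOf k`.
    refine (Finset.card_le_card_of_injOn (t := Finset.range (n / groupOf k + 1))
      (fun x => x / groupOf k) ?_ ?_).trans (by simp)
    · intro x hx
      simp only [List.coe_toFinset, Set.mem_ofPred_eq, List.mem_filter] at hx
      simp only [coe_range, Set.mem_Iio]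
      exact Nat.lt_succ_of_le (Nat.div_le_div_right ((hX _).2 x hx.1).le)
    · intro x hx y hy hxy
      simp only [List.coe_toFinset, Set.mem_ofPred_eq, List.mem_filter, decide_eq_true_eq] at hx hy
      simp only at hxy
      rw [← Nat.div_add_mod x (groupOf k), ← Nat.div_add_mod y (groupOf k), hxy, hx.2, hy.2]
  calc groupOf k * (share X k).length ≤ groupOf k * (n / groupOf k + 1) :=
        Nat.mul_le_mul_left _ h1
    _ ≤ n + groupOf k := by
        rw [mul_add, mul_one]
        exact Nat.add_le_add_right (Nat.mul_div_le _ _) _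

lemma length_share_le (hX : ∀ k, (X k).Nodup ∧ ∀ x ∈ X k, x < n) (k : Fin (numMachines m s)) :
    (share X k).length ≤ n :=
  (List.length_filter_le _ _).trans (length_le_of_nodup (hX _).1 (hX _).2)

/-! ## Phases -/

variable (I H) in
/-- A phase begins. -/
def AtSample (C : Config randomizedLocalRatio (numMachines m s)) (θ : ℕ)
    (E : List (List ℕ)) : Prop :=
  ∃ q X, HasState I H C 0 q θ E X ∧ q < wordCap n m s ^ 2 ∧ (∀ k, Informed I H E (X k)) ∧
    ∀ k, C.inbox k = []

variable (I H) in
/-- The first `q` machines know the chosen sets. -/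
def AtScatter (C : Config randomizedLocalRatio (numMachines m s)) (q θ : ℕ)
    (E : List (List ℕ)) : Prop :=
  ∃ X, HasState I H C 2 q θ E X ∧ 0 < q ∧ q < wordCap n m s ^ 2 ∧ InformedBelow I H q E X ∧
    ∀ k, C.inbox k = []

variable (I H) in
/-- The output would be the chosen sets. -/
def Shows (C : Config randomizedLocalRatio (numMachines m s)) (E : List (List ℕ)) : Prop :=
  Informed I H E (C.state 0).2.1

lemma HasState.shows (h : HasState I H C mode q θ E X) (hX : Informed I H E (X 0)) :
    Shows I H C E := by
  rw [Shows, h 0]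
  exact hX

variable {Cs : ℕ → Config randomizedLocalRatio (numMachines m s)}
  {ρs : ℕ → Fin (numMachines m s) → List ℕ} {a : ℕ}

lemma two_mul_lt_wordCap_sq (n m s : ℕ) : m * s + n + m + s < wordCap n m s ^ 2 := by
  unfold wordCap
  nlinarith [Nat.zero_le (n * m), Nat.zero_le (n * s), Nat.zero_le (m * s), sq_nonneg n,
    sq_nonneg m, sq_nonneg s]

lemma size_nil_le {B y : ℕ} {l : List msgTy.den} (h : l = []) :
    (list msgTy).size B l ≤ y + 1 := by
  rw [h, Ty.size_nil]
  omega

/-- The bound on the sample is the only probabilistic input here; it keeps the inbox of machine `0`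
within memory. -/
lemma AtSample.step (hCs : ∀ r, Cs (r + 1) = randomizedLocalRatio.next (Cs r) (ρs r))
    (hρ : ∀ r, IsWords n m s (ρs r)) (hm : 1 ≤ m) (hns : n ≤ s)
    (hE : Recorded I (idx H) E) (h : AtSample I H (Cs a) θ E) (hθ : θ < wordCap n m s ^ 3)
    (hQ : (sampledSet I H E θ (ρs a)).card ≤ 9 * s) :
    (∀ t < 2, Fits I (Cs (a + t)) (ρs (a + t)) ∧ Shows I H (Cs (a + t)) E) ∧
      AtScatter I H (Cs (a + 2)) 1 (nextTheta n m s θ)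
        (nextE I H E (sampledSet I H E θ (ρs a))) := by
  obtain ⟨q, X, h0, hq, hX, hin⟩ := h
  obtain ⟨h1, hin1⟩ := h0.sample (ρ := ρs a) hX
  rw [← hCs] at h1 hin1
  obtain ⟨X', h2, hX0, hX', hin2⟩ := h1.localRatio (ρ := ρs (a + 1)) hin1
  rw [← hCs] at h2 hin2
  have hX1 : ∀ k, (X k).Nodup ∧ ∀ x ∈ X k, x < n := fun k => (hX k).lt hE
  refine ⟨fun t ht => ?_, X', h2, one_pos, ?_, fun k => ⟨fun hk => ?_, fun hk => ?_⟩, hin2⟩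
  · interval_cases t
    · refine ⟨fun k => ⟨?_, ?_⟩, h0.shows (hX 0)⟩
      · exact h0.size_le hm hns (by norm_num) hq hθ hE hX1 (fun k => size_nil_le (hin k)) (hρ _) k
      · exact h0.admissible (by norm_num) (by norm_num) k
    · refine ⟨fun k => ⟨?_, ?_⟩, h1.shows (hX 0)⟩
      · refine h1.size_le hm hns (by norm_num) hq hθ hE hX1 (fun k => ?_) (hρ _) k
        rw [hin1]
        split_ifs
        · refine (size_inbox₀_le I H (by unfold wordCap; omega) _).trans ?_
          have := Nat.mul_le_mul_right (I.maxFreq + 2) hQ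
          omega
        · exact size_nil_le rfl
      · exact h1.admissible (by norm_num) (by norm_num) k
  · have := two_mul_lt_wordCap_sq n m s
    have := one_le_of_feasible I hm
    omega
  · have hk0 : k = 0 := Fin.ext (by simpa using hk)
    have hE' : Recorded I (idx H) (nextE I H E (sampledSet I H E θ (ρs a))) :=
      hE.record_inv (mem_byMachine _) fun T hT => mem_inbox₀_fst I H hT
    rw [hk0, hX0]
    exact ⟨hE'.nodup_chosen (nodup_byMachine _), fun _ => Iff.rfl⟩
  · refine hX' k fun hk0 => ?_
    rw [hk0] at hk
    simp at hk

lemma AtScatter.done (hCs : ∀ r, Cs (r + 1) = randomizedLocalRatio.next (Cs r) (ρs r))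
    (hρ : ∀ r, IsWords n m s (ρs r)) (hm : 1 ≤ m) (hns : n ≤ s)
    (hE : Recorded I (idx H) E) (h : AtScatter I H (Cs a) q θ E) (hθ : θ < wordCap n m s ^ 3) :
    Fits I (Cs a) (ρs a) ∧ Shows I H (Cs a) E ∧
      (numMachines m s ≤ q → AtSample I H (Cs (a + 1)) θ E) := by
  obtain ⟨X, h0, hq0, hq, hX, hin⟩ := h
  have hX1 := hX.lt hE
  refine ⟨fun k => ⟨?_, ?_⟩, h0.shows ((hX 0).1 hq0), fun hM => ?_⟩
  · exact h0.size_le hm hns (by norm_num) hq hθ hE hX1 (fun k => size_nil_le (hin k)) (hρ _) k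
  · refine h0.admissible (fun _ k i hi => ?_) (by norm_num) k
    have h1 := Nat.mod_le i (groupSize s (numMachines m s) ((k : ℕ) * s))
    have h2 := (hX1 k).2 i hi
    have h3 := Nat.mul_le_mul_right s (k.2.le.trans (numMachines_le (s := s) hm))
    have h4 := two_mul_lt_wordCap_sq n m s
    omega
  · obtain ⟨h1, hin1⟩ := h0.done (ρ := ρs a) hM
    rw [← hCs] at h1 hin1
    exact ⟨q, X, h1, hq, fun k => (hX k).1 (k.2.trans_le hM), hin1⟩

/-- One scatter, gather and receive cycle; the informed machines remain informed because the first
groups contain them. -/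
lemma AtScatter.round (hCs : ∀ r, Cs (r + 1) = randomizedLocalRatio.next (Cs r) (ρs r))
    (hρ : ∀ r, IsWords n m s (ρs r)) (hm : 1 ≤ m) (hns : n ≤ s)
    (hE : Recorded I (idx H) E) (h : AtScatter I H (Cs a) q θ E) (hθ : θ < wordCap n m s ^ 3)
    (hq : q < numMachines m s) :
    (∀ t < 3, Fits I (Cs (a + t)) (ρs (a + t)) ∧ Shows I H (Cs (a + t)) E) ∧
      AtScatter I H (Cs (a + 3)) (q * s) θ E := by
  have hh := h.done hCs hρ hm hns hE hθ
  have hn := one_le_of_feasible I hm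
  have hs : 0 < s := by omega
  have hf := one_le_maxFreq I hm
  have hB : n < wordCap n m s := by unfold wordCap; omega
  have hsq := two_mul_lt_wordCap_sq n m s
  have hσ : s ≤ I.maxFreq * s := Nat.le_mul_of_pos_left _ hf
  obtain ⟨X, h0, hq0, hq2, hX, hin⟩ := h
  have hX1 := hX.lt hE
  obtain ⟨h1, hin1⟩ := h0.scatter (ρ := ρs a) hs hq.not_ge
  rw [← hCs] at h1 hin1
  obtain ⟨h2, hin2⟩ := h1.gather (ρ := ρs (a + 1)) hs hin1
  rw [← hCs] at h2 hin2
  obtain ⟨h3, hin3⟩ := h2.receive (ρ := ρs (a + 2)) hin2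
  rw [← hCs] at h3 hin3
  have hX' := hX.gathered hs
  have hX1' := hX'.lt hE
  have hb1 : ∀ k, (list msgTy).size (wordCap n m s) ((share X k).map idxMsg) ≤
      (share X k).length * 3 + 1 := fun k => size_idxMsg_le fun x hx =>
    ((hX1 (leader k)).2 x (List.mem_filter.mp hx).1).trans hB
  have hb2 : ∀ k, (list msgTy).size (wordCap n m s) ((gathered X k).map idxMsg) ≤ n * 3 + 1 :=
    fun k => (size_idxMsg_le fun x hx => ((hX1' k).2 x hx).trans hB).trans (by
      have := length_le_of_nodup (hX1' k).1 (hX1' k).2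
      omega)
  refine ⟨fun t ht => ?_, _, h3, Nat.mul_pos hq0 hs, ?_, hX', hin3⟩
  · interval_cases t
    · exact ⟨hh.1, hh.2.1⟩
    · refine ⟨fun k => ⟨?_, ?_⟩, h1.shows ((hX 0).1 hq0)⟩
      · refine h1.size_le hm hns (by norm_num) hq2 hθ hE hX1 (fun k => ?_) (hρ _) k
        rw [hin1]
        have := length_share_le hX1 k
        exact (hb1 k).trans (by omega)
      · refine h1.admissible (by norm_num) (fun _ k => ?_) k
        have hk1 := Nat.div_mul_le_self (k : ℕ) s
        have hk2 := k.2
        have hk3 := numMachines_le (s := s) hm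
        have hk4 : groupOf k = min s (numMachines m s - (k : ℕ) / s * s) := groupSize_eq _ _ _
        refine ⟨by omega, by unfold sizeBound; omega, ?_⟩
        rw [hin1]
        -- A member holds at most about `n / g` indices and sends `g` copies of each, so it sends at
        -- most `n + g` messages, which is linear in `s`.
        have h5 := groupOf_mul_length_share hs hX1 k
        have h6 : groupOf k * ((list msgTy).size (wordCap n m s) ((share X k).map idxMsg) - 1) ≤
            groupOf k * ((share X k).length * 3) := Nat.mul_le_mul_left _ (by have := hb1 k; omega)
        rw [← mul_assoc] at h6
        unfold sizeBound
        omega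
    · refine ⟨fun k => ⟨?_, ?_⟩, h2.shows ((hX 0).1 hq0)⟩
      · refine h2.size_le hm hns (by norm_num) hq2 hθ hE hX1 (fun k => ?_) (hρ _) k
        rw [hin2]
        exact (hb2 k).trans (by omega)
      · exact h2.admissible (by norm_num) (by norm_num) k
  · have := Nat.mul_le_mul_right s (hq.le.trans (numMachines_le (s := s) hm))
    omega

/-- The hypothesis `hL` ensures that no machine finds the broadcast complete before the last cycle,
since the mode would then switch to sampling. -/
lemma AtScatter.relay (hCs : ∀ r, Cs (r + 1) = randomizedLocalRatio.next (Cs r) (ρs r))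
    (hρ : ∀ r, IsWords n m s (ρs r)) (hm : 1 ≤ m) (hns : n ≤ s)
    (hE : Recorded I (idx H) E) (h : AtScatter I H (Cs a) 1 θ E) (hθ : θ < wordCap n m s ^ 3)
    {L : ℕ} (hL : ∀ i < L, s ^ i < numMachines m s) :
    (∀ t < 3 * L, Fits I (Cs (a + t)) (ρs (a + t)) ∧ Shows I H (Cs (a + t)) E) ∧
      AtScatter I H (Cs (a + 3 * L)) (s ^ L) θ E := by
  induction L with
  | zero => exact ⟨by simp, by simpa using h⟩
  | succ L ih =>
    obtain ⟨h1, h2⟩ := ih fun i hi => hL i (by omega)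
    obtain ⟨h3, h4⟩ := h2.round hCs hρ hm hns hE hθ (hL L (by omega))
    refine ⟨fun t ht => ?_, by rw [pow_succ]; exact h4⟩
    by_cases ht' : t < 3 * L
    · exact h1 t ht'
    · obtain ⟨u, rfl⟩ := Nat.exists_eq_add_of_le (not_lt.mp ht')
      rw [← add_assoc]
      exact h3 u (by omega)

/-- The threshold is enlarged only while it is below the word capacity, and by a factor of at most
`2 * s`. -/
lemma nextTheta_lt {n m s θ : ℕ} (hθ : θ ≤ 4 * s * wordCap n m s) :
    nextTheta n m s θ ≤ 4 * s * wordCap n m s := by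
  unfold nextTheta
  split_ifs with h
  · exact hθ
  · refine (Nat.div_le_self _ _).trans ?_
    unfold wordCap
    nlinarith

lemma lt_wordCap_pow {n m s θ : ℕ} (hn : 1 ≤ n) (hm : 1 ≤ m) (hθ : θ ≤ 4 * s * wordCap n m s) :
    θ < wordCap n m s ^ 3 := by
  refine hθ.trans_lt ?_
  have h4 : 4 ≤ wordCap n m s := by unfold wordCap; omega
  have hs : s < wordCap n m s := by unfold wordCap; omega
  calc 4 * s * wordCap n m s < wordCap n m s * wordCap n m s * wordCap n m s := by
        refine Nat.mul_lt_mul_of_pos_right ?_ (by omega)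
        nlinarith
    _ = _ := by ring

/-- A phase takes two rounds for sampling and local ratio, three for each of the `L` relay cycles,
and one to notice that everyone is informed. In its first two rounds machine `0` still shows the
previous choice. -/
lemma AtSample.phase (hCs : ∀ r, Cs (r + 1) = randomizedLocalRatio.next (Cs r) (ρs r))
    (hρ : ∀ r, IsWords n m s (ρs r)) (hm : 1 ≤ m) (hns : n ≤ s)
    (hE : Recorded I (idx H) E) (h : AtSample I H (Cs a) θ E)
    (hθ : θ ≤ 4 * s * wordCap n m s) (hQ : (sampledSet I H E θ (ρs a)).card ≤ 9 * s)
    {L : ℕ} (hL : ∀ i < L, s ^ i < numMachines m s) (hL' : numMachines m s ≤ s ^ L) :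
    (∀ t < 3 * L + 3, Fits I (Cs (a + t)) (ρs (a + t)) ∧ (Shows I H (Cs (a + t)) E ∨
        Shows I H (Cs (a + t)) (nextE I H E (sampledSet I H E θ (ρs a))))) ∧
      AtSample I H (Cs (a + (3 * L + 3))) (nextTheta n m s θ)
        (nextE I H E (sampledSet I H E θ (ρs a))) := by
  have hn := one_le_of_feasible I hm
  obtain ⟨h1, h2⟩ := h.step hCs hρ hm hns hE (lt_wordCap_pow hn hm hθ) hQ
  have hE' : Recorded I (idx H) (nextE I H E (sampledSet I H E θ (ρs a))) :=
    hE.record_inv (mem_byMachine _) fun T hT => mem_inbox₀_fst I H hT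
  have hθ' := lt_wordCap_pow hn hm (nextTheta_lt hθ)
  obtain ⟨h3, h4⟩ := h2.relay hCs hρ hm hns hE' hθ' hL
  obtain ⟨h5, h6, h7⟩ := h4.done hCs hρ hm hns hE' hθ'
  refine ⟨fun t ht => ?_, ?_⟩
  · by_cases ht2 : t < 2
    · exact ⟨(h1 t ht2).1, Or.inl (h1 t ht2).2⟩
    obtain ⟨u, rfl⟩ := Nat.exists_eq_add_of_le (not_lt.mp ht2)
    rw [← add_assoc]
    by_cases hu : u < 3 * L
    · exact ⟨(h3 u hu).1, Or.inr (h3 u hu).2⟩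
    · have : u = 3 * L := by omega
      rw [this]
      exact ⟨h5, Or.inr h6⟩
  · have := h7 hL'
    rwa [show a + 2 + 3 * L + 1 = a + (3 * L + 3) by ring] at this

end MapReduce

namespace MapReduce

open Ty Code

/-! ## Counting -/

/-- The generating function of the number of hits factors by independence, and `1 + x ≤ exp x`
bounds each factor. Taking `z = 2` serves the upper tail; `z = 0` counts the outcomes without any
hit. -/
lemma sum_pow_card_le {ι : Type*} [Fintype ι] [DecidableEq ι] {B θ : ℕ} (hB : 0 < B)
    (hθ : θ ≤ B) (W : Finset ι) {z : ℝ} (hz : 0 ≤ z) :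
    ∑ ν : ι → Fin B, z ^ (W.filter fun x => (ν x : ℕ) < θ).card ≤
      Fintype.card (ι → Fin B) * Real.exp ((z - 1) * (W.card * θ / B)) := by
  have hB' : (0 : ℝ) < B := by exact_mod_cast hB
  have h1 : ∀ ν : ι → Fin B, z ^ (W.filter fun x => (ν x : ℕ) < θ).card =
      ∏ x, if x ∈ W ∧ (ν x : ℕ) < θ then z else 1 := fun ν => by
    rw [Finset.prod_ite, Finset.prod_const, Finset.prod_const_one, mul_one]
    congr 2
    ext x
    simp
  have h2 : ∀ x, (∑ v : Fin B, if x ∈ W ∧ (v : ℕ) < θ then z else 1) ≤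
      B * (if x ∈ W then Real.exp ((z - 1) * (θ / B)) else 1) := fun x => by
    by_cases hx : x ∈ W
    · simp only [hx, true_and, if_true]
      have h3 : ((univ : Finset (Fin B)).filter fun v : Fin B => (v : ℕ) < θ).card = θ := by
        rw [Fin.card_filter_val_lt]
        exact min_eq_right hθ
      have h4 : ((univ : Finset (Fin B)).filter fun v : Fin B => ¬ (v : ℕ) < θ).card = B - θ := by
        rw [← h3, ← Finset.compl_filter, Finset.card_compl, Fintype.card_fin]
        exact congrArg (B - ·) (by convert h3)
      rw [Finset.sum_ite, Finset.sum_const, Finset.sum_const, h3, h4, nsmul_eq_mul, nsmul_eq_mul,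
        Nat.cast_sub hθ, mul_one]
      calc (θ : ℝ) * z + (B - θ) = B * ((z - 1) * (θ / B) + 1) := by field_simp; ring
        _ ≤ _ := mul_le_mul_of_nonneg_left (Real.add_one_le_exp _) hB'.le
    · simp [hx]
  calc ∑ ν : ι → Fin B, z ^ (W.filter fun x => (ν x : ℕ) < θ).card
      = ∏ x : ι, ∑ v : Fin B, if x ∈ W ∧ (v : ℕ) < θ then z else 1 := by
        rw [Finset.prod_univ_sum, Fintype.piFinset_univ]
        exact Finset.sum_congr rfl fun ν _ => h1 ν
    _ ≤ ∏ x : ι, (B * (if x ∈ W then Real.exp ((z - 1) * (θ / B)) else 1) : ℝ) :=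
        Finset.prod_le_prod (fun x _ => Finset.sum_nonneg fun v _ => by split_ifs <;> positivity)
          fun x _ => h2 x
    _ = _ := by
        rw [Finset.prod_mul_distrib, Finset.prod_const, Finset.prod_ite, Finset.prod_const,
          Finset.prod_const_one, mul_one, ← Real.exp_nat_mul, Finset.card_univ]
        simp only [Fintype.card_pi, Fintype.card_fin, Finset.prod_const, Finset.card_univ,
          Nat.cast_pow, Finset.filter_mem_eq_inter, Finset.univ_inter]
        congr 2
        ring

/-- A property of all rows that is unlikely for random values in one row is unlikely. -/
lemma card_le_of_row {κ α : Type*} [Fintype κ] [DecidableEq κ] [Fintype α] [Nonempty α] (r : κ)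
    (A : (κ → α) → Prop) [DecidablePred A] {δ : ℝ}
    (h : ∀ ω, ((univ.filter fun σ => A (Function.update ω r σ)).card : ℝ) ≤
      δ * Fintype.card α) :
    ((univ.filter A).card : ℝ) ≤ δ * Fintype.card (κ → α) := by
  have hα : (0 : ℝ) < Fintype.card α := by exact_mod_cast Fintype.card_pos
  have e : (univ.filter A).card * Fintype.card α =
      ∑ ω : κ → α, (univ.filter fun σ => A (Function.update ω r σ)).card := by
    rw [← Finset.card_univ (α := α), ← Finset.card_product, ← Finset.card_sigma]
    -- Exchanging row `r` of `ω` with the fresh row `σ` is an involution on pairs.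
    refine Finset.card_bij' (fun x _ => ⟨Function.update x.1 r x.2, x.1 r⟩)
      (fun y _ => (Function.update y.1 r y.2, y.1 r)) ?_ ?_ ?_ ?_
    · intro x hx
      simpa using hx
    · intro y hy
      simpa using hy
    · intro x _
      simp
    · intro y _
      simp
  have hle : ((univ.filter A).card : ℝ) * Fintype.card α ≤
      δ * Fintype.card (κ → α) * Fintype.card α := by
    calc ((univ.filter A).card : ℝ) * Fintype.card α
        = ∑ ω : κ → α, ((univ.filter fun σ => A (Function.update ω r σ)).card : ℝ) := by
          exact_mod_cast e
      _ ≤ ∑ _ω : κ → α, δ * Fintype.card α := Finset.sum_le_sum fun ω _ => h ω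
      _ = _ := by
          rw [Finset.sum_const, nsmul_eq_mul, Finset.card_univ]
          ring
  exact le_of_mul_le_mul_right hle hα

/-! ## Sampling -/

variable {n m s : ℕ} (I : SetCover n m) (H : Placement n m s)

/-- The position counts earlier elements on the same machine, of which there are fewer than `s`; so
the `s` random words of the machine suffice. -/
lemma pos_lt (j : Fin m) : pos I H j < s := by
  refine lt_of_lt_of_le ?_ (length_eltList_le H (H.elt j))
  rw [pos, rank, els, List.filter_map, List.length_map]
  refine List.length_filter_lt_length_iff_exists.mpr ⟨j, by simp [eltList], by simp⟩

/-- The random word that decides about the element `j`. -/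
def slot (j : Fin m) : Fin (numMachines m s) × Fin s := (H.elt j, ⟨pos I H j, pos_lt I H j⟩)

lemma pos_lt_pos {j j' : Fin m} (h : j < j') (hk : H.elt j = H.elt j') :
    pos I H j < pos I H j' := by
  simp only [pos, rank, els, List.filter_map, List.length_map, hk, eltList]
  rw [← List.toFinset_card_of_nodup (((List.nodup_finRange m).filter _).filter _),
    ← List.toFinset_card_of_nodup (((List.nodup_finRange m).filter _).filter _)]
  refine Finset.card_lt_card (Finset.ssubset_iff_of_subset ?_ |>.mpr ⟨j, ?_, ?_⟩)
  · intro x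
    simp only [List.mem_toFinset, List.mem_filter, Function.comp, decide_eq_true_eq]
    have : (j : ℕ) < j' := h
    exact fun hx => ⟨hx.1, by omega⟩
  · simpa [hk] using h
  · simp

/-- Distinct elements consult distinct random words, which is what makes their sampling decisions
independent. -/
lemma slot_injective : Function.Injective (slot I H) := by
  intro j j' h
  simp only [slot, Prod.mk.injEq, Fin.mk.injEq] at h
  rcases lt_trichotomy j j' with h1 | h1 | h1
  · exact absurd h.2 (pos_lt_pos I H h1 h.1).ne
  · exact h1
  · exact absurd h.2 (pos_lt_pos I H h1 h.1.symm).ne'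

/-- The random words of one round. -/
abbrev Row (n m s : ℕ) : Type := Fin (numMachines m s) → Fin s → Fin (wordCap n m s)

/-- The random words of a round, as lists. -/
def Row.words (σ : Row n m s) (k : Fin (numMachines m s)) : List ℕ :=
  List.ofFn fun t => (σ k t : ℕ)

lemma Row.getD_words (σ : Row n m s) (j : Fin m) :
    (σ.words (H.elt j)).getD (pos I H j) 0 = (σ (slot I H j).1 (slot I H j).2 : ℕ) := by
  have h := pos_lt I H j
  simp [Row.words, List.getD_eq_getElem?_getD, h, slot]

instance (n m s : ℕ) : NeZero (wordCap n m s) := ⟨by unfold wordCap; omega⟩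

open Classical in
lemma sum_row_le {θ : ℕ} (hθ : θ ≤ wordCap n m s) (W : Finset (Fin m)) {z : ℝ} (hz : 0 ≤ z) :
    ∑ σ : Row n m s,
      z ^ (W.filter fun j => (σ.words (H.elt j)).getD (pos I H j) 0 < θ).card ≤
      Fintype.card (Row n m s) * Real.exp ((z - 1) * (W.card * θ / wordCap n m s)) := by
  have h := sum_pow_card_le (B := wordCap n m s) (NeZero.pos _) hθ
    (W.map ⟨slot I H, slot_injective I H⟩) hz
  rw [Finset.card_map] at h
  rw [← Fintype.card_congr (Equiv.curry (Fin (numMachines m s)) (Fin s) (Fin (wordCap n m s)))]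
  refine le_trans (le_of_eq ?_) h
  rw [← Equiv.sum_comp (Equiv.curry (Fin (numMachines m s)) (Fin s) (Fin (wordCap n m s)))]
  refine Finset.sum_congr rfl fun ν _ => ?_
  congr 1
  rw [Finset.filter_map, Finset.card_map]
  congr 1
  refine Finset.filter_congr fun j _ => ?_
  rw [Row.getD_words]
  rfl

open Classical in
/-- The sample is rarely too large. -/
lemma card_large_sample_le {θ : ℕ} (hθ : θ ≤ wordCap n m s) (hns : n ≤ s) {E : List (List ℕ)}
    (hU : (uncovered I (idx H) E).card * θ ≤ 4 * s * wordCap n m s) :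
    ((univ.filter fun σ : Row n m s => 9 * s < (sampledSet I H E θ σ.words).card).card : ℝ) ≤
      Real.exp (-n) * Fintype.card (Row n m s) := by
  have hB : (0 : ℝ) < wordCap n m s := by exact_mod_cast NeZero.pos (wordCap n m s)
  -- Markov's inequality is applied to `2 ^ (sample size)`, whose mean is at most `exp (4 * s)`.
  have h := sum_row_le I H hθ (uncovered I (idx H) E) (z := 2) (by norm_num)
  have h1 : ((univ.filter fun σ : Row n m s =>
      9 * s < (sampledSet I H E θ σ.words).card).card : ℝ) * 2 ^ (9 * s) ≤
      Fintype.card (Row n m s) * Real.exp (4 * s) := by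
    rw [← nsmul_eq_mul, ← Finset.sum_const]
    refine le_trans (Finset.sum_le_sum fun σ hσ => ?_) ((Finset.sum_le_sum_of_subset_of_nonneg
      (filter_subset _ _) fun σ _ _ => ?_).trans (h.trans ?_))
    · refine pow_le_pow_right₀ (by norm_num) ?_
      rw [mem_filter] at hσ
      refine hσ.2.le.trans (le_of_eq ?_)
      rw [sampledSet]
    · positivity
    · refine mul_le_mul_of_nonneg_left (Real.exp_le_exp.mpr ?_) (Nat.cast_nonneg _)
      have : ((uncovered I (idx H) E).card * θ : ℝ) ≤ 4 * s * wordCap n m s := by exact_mod_cast hU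
      rw [show (2 : ℝ) - 1 = 1 by norm_num, one_mul, div_le_iff₀ hB]
      exact this
  -- The constant `9` works because `9 * log 2 > 5` and `n ≤ s`.
  have h2 : Real.exp (4 * s) * Real.exp n ≤ 2 ^ (9 * s) := by
    have h3 : (2 : ℝ) ^ (9 * s) = Real.exp (9 * s * Real.log 2) := by
      rw [mul_comm (9 * (s : ℝ)), ← Real.rpow_def_of_pos (by norm_num), ← Real.rpow_natCast]
      push_cast
      rfl
    rw [h3, ← Real.exp_add, Real.exp_le_exp]
    have h4 := Real.log_two_gt_d9
    have h5 : (n : ℝ) ≤ s := by exact_mod_cast hns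
    have h6 : (0 : ℝ) ≤ s := Nat.cast_nonneg _
    nlinarith
  rw [Real.exp_neg, inv_mul_eq_div, le_div_iff₀ (Real.exp_pos _)]
  have h7 : (0 : ℝ) < Real.exp (4 * s) := Real.exp_pos _
  refine le_of_mul_le_mul_right ?_ h7
  refine le_trans ?_ h1
  rw [mul_assoc, mul_comm (Real.exp n)]
  exact mul_le_mul_of_nonneg_left h2 (Nat.cast_nonneg _)

open Classical in
/-- After sampling there are rarely many uncovered elements. -/
lemma card_large_rest_le {θ : ℕ} (hθ : θ ≤ wordCap n m s) {E : List (List ℕ)}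
    (hE : Recorded I (idx H) E) :
    ((univ.filter fun σ : Row n m s => 2 * n * wordCap n m s <
        (uncovered I (idx H) (nextE I H E (sampledSet I H E θ σ.words))).card * θ).card : ℝ) ≤
      Real.exp (-n) * Fintype.card (Row n m s) := by
  have hB : (0 : ℝ) < wordCap n m s := by exact_mod_cast NeZero.pos (wordCap n m s)
  -- The uncovered set after the phase depends on the sample, so a tail bound does not apply to it
  -- directly. But it is `rest Y` for one of at most `2 ^ n` fixed sets `Y`.
  let rest (Y : Finset (Fin n)) : Finset (Fin m) := univ.filter fun j => ∀ i ∈ I.T j, i ∉ Y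
  let bad := (univ : Finset (Finset (Fin n))).filter fun Y =>
    2 * n * wordCap n m s < (rest Y).card * θ
  have hone : ∀ Y ∈ bad, ((univ.filter fun σ : Row n m s =>
      ∀ j ∈ rest Y, ¬ (σ.words (H.elt j)).getD (pos I H j) 0 < θ).card : ℝ) ≤
      Fintype.card (Row n m s) * Real.exp (-(2 * n)) := by
    intro Y hY
    have h := sum_row_le I H hθ (rest Y) (z := 0) le_rfl
    rw [Finset.card_eq_sum_ones, Nat.cast_sum, Finset.sum_filter]
    refine le_trans (le_of_eq (Finset.sum_congr rfl fun σ _ => ?_)) (h.trans ?_)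
    · by_cases hσ : ∀ j ∈ rest Y, ¬ (σ.words (H.elt j)).getD (pos I H j) 0 < θ
      · rw [if_pos hσ, Finset.filter_false_of_mem hσ]
        simp
      · rw [if_neg hσ, zero_pow]
        rw [Finset.card_ne_zero]
        push Not at hσ
        obtain ⟨j, hj, hjθ⟩ := hσ
        exact ⟨j, mem_filter.mpr ⟨hj, hjθ⟩⟩
    · refine mul_le_mul_of_nonneg_left (Real.exp_le_exp.mpr ?_) (Nat.cast_nonneg _)
      have : (2 * n * wordCap n m s : ℝ) ≤ (rest Y).card * θ := by
        exact_mod_cast (mem_filter.mp hY).2.le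
      rw [zero_sub, neg_one_mul, neg_le_neg_iff, le_div_iff₀ hB]
      exact this
  have hsub : (univ.filter fun σ : Row n m s => 2 * n * wordCap n m s <
      (uncovered I (idx H) (nextE I H E (sampledSet I H E θ σ.words))).card * θ) ⊆
      bad.biUnion fun Y => univ.filter fun σ : Row n m s =>
        ∀ j ∈ rest Y, ¬ (σ.words (H.elt j)).getD (pos I H j) 0 < θ := by
    intro σ hσ
    rw [mem_filter] at hσ
    have hnew := hE.uncovered_record (mem_byMachine _)
      fun T hT => mem_inbox₀_fst I H (Q := sampledSet I H E θ σ.words) hT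
    have hrest : rest (univ.filter fun i : Fin n =>
        (i : ℕ) ∈ chosen I (idx H) (nextE I H E (sampledSet I H E θ σ.words))) =
        uncovered I (idx H) (nextE I H E (sampledSet I H E θ σ.words)) := by
      ext j
      simp only [rest, uncovered, mem_filter, mem_univ, true_and, mem_setsOf]
      constructor
      · rintro h _ ⟨i, hi, rfl⟩
        exact h i hi
      · exact fun h i hi => h i ⟨i, hi, rfl⟩
    rw [mem_biUnion]
    refine ⟨univ.filter fun i : Fin n =>
        (i : ℕ) ∈ chosen I (idx H) (nextE I H E (sampledSet I H E θ σ.words)),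
      mem_filter.mpr ⟨mem_univ _, ?_⟩, mem_filter.mpr ⟨mem_univ _, ?_⟩⟩
    · rw [hrest]
      exact hσ.2
    · rw [hrest]
      -- An uncovered element whose word is below `θ` would have been sampled, and hence be covered
      -- now.
      intro j hj hjθ
      have := mem_filter.mp (hnew hj)
      refine this.2 (setsOf_mem_inbox₀ I H ?_)
      rw [sampledSet, mem_filter]
      exact ⟨this.1, hjθ⟩
  calc _ ≤ ((bad.biUnion fun Y => univ.filter fun σ : Row n m s =>
        ∀ j ∈ rest Y, ¬ (σ.words (H.elt j)).getD (pos I H j) 0 < θ).card : ℝ) := by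
        exact_mod_cast Finset.card_le_card hsub
    _ ≤ ∑ Y ∈ bad, ((univ.filter fun σ : Row n m s =>
        ∀ j ∈ rest Y, ¬ (σ.words (H.elt j)).getD (pos I H j) 0 < θ).card : ℝ) := by
        exact_mod_cast Finset.card_biUnion_le
    _ ≤ ∑ _Y ∈ bad, Fintype.card (Row n m s) * Real.exp (-(2 * n)) := Finset.sum_le_sum hone
    _ = bad.card * (Fintype.card (Row n m s) * Real.exp (-(2 * n))) := by
        rw [Finset.sum_const, nsmul_eq_mul]
    _ ≤ 2 ^ n * (Fintype.card (Row n m s) * Real.exp (-(2 * n))) := by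
        refine mul_le_mul_of_nonneg_right ?_ (by positivity)
        have : bad.card ≤ 2 ^ n := (Finset.card_le_univ _).trans (by simp)
        exact_mod_cast this
    _ ≤ Real.exp n * (Fintype.card (Row n m s) * Real.exp (-(2 * n))) := by
        refine mul_le_mul_of_nonneg_right ?_ (by positivity)
        have h2 : (2 : ℝ) ≤ Real.exp 1 := by
          have := Real.add_one_le_exp (1 : ℝ)
          linarith
        calc (2 : ℝ) ^ n ≤ Real.exp 1 ^ n := pow_le_pow_left₀ (by norm_num) h2 n
          _ = Real.exp n := by rw [← Real.exp_nat_mul, mul_one]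
    _ = _ := by
        rw [show -(n : ℝ) = n + -(2 * n) by ring, Real.exp_add]
        ring

end MapReduce

namespace MapReduce

open Ty Code

/-! ## All phases -/

variable {n m s : ℕ} (I : SetCover n m) (H : Placement n m s)

/-- The thresholds of the phases. -/
def thetaSeq (n m s : ℕ) : ℕ → ℕ
  | 0 => 4 * s * wordCap n m s / m
  | p + 1 => nextTheta n m s (thetaSeq n m s p)

/-- The elements recorded before phase `p`, if a phase has `l` rounds. -/
noncomputable def recordedAt (l : ℕ) (ρs : ℕ → Fin (numMachines m s) → List ℕ) :
    ℕ → List (List ℕ)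
  | 0 => []
  | p + 1 => nextE I H (recordedAt l ρs p)
      (sampledSet I H (recordedAt l ρs p) (thetaSeq n m s p) (ρs (p * l)))

/-- The elements sampled in phase `p`. -/
noncomputable def sampledAt (l : ℕ) (ρs : ℕ → Fin (numMachines m s) → List ℕ) (p : ℕ) :
    Finset (Fin m) :=
  sampledSet I H (recordedAt I H l ρs p) (thetaSeq n m s p) (ρs (p * l))

/-- The elements that are uncovered before phase `p`. -/
noncomputable def uncoveredAt (l : ℕ) (ρs : ℕ → Fin (numMachines m s) → List ℕ) (p : ℕ) :
    Finset (Fin m) :=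
  uncovered I (idx H) (recordedAt I H l ρs p)

variable {I H} {l : ℕ} {ρs : ℕ → Fin (numMachines m s) → List ℕ}

/-- The record before a phase depends only on the sampling rounds of earlier phases. The words of
the current phase are therefore fresh, and the bounds for one row apply with the record fixed. -/
lemma recordedAt_congr {ρs' : ℕ → Fin (numMachines m s) → List ℕ} {p : ℕ}
    (h : ∀ p' < p, ρs (p' * l) = ρs' (p' * l)) :
    recordedAt I H l ρs p = recordedAt I H l ρs' p := by
  induction p with
  | zero => rfl
  | succ p ih => rw [recordedAt, recordedAt, ih fun p' hp' => h p' (by omega), h p (by omega)]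

lemma recorded_recordedAt (p : ℕ) : Recorded I (idx H) (recordedAt I H l ρs p) := by
  induction p with
  | zero => exact Recorded.nil
  | succ p ih => exact ih.record_inv (mem_byMachine _) fun T hT => mem_inbox₀_fst I H hT

lemma thetaSeq_le (p : ℕ) : thetaSeq n m s p ≤ 4 * s * wordCap n m s := by
  induction p with
  | zero => exact Nat.div_le_self _ _
  | succ p ih => exact nextTheta_lt ih

lemma le_thetaSeq {p₀ p : ℕ} (h : wordCap n m s ≤ thetaSeq n m s p₀) (hp : p₀ ≤ p) :
    wordCap n m s ≤ thetaSeq n m s p := by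
  induction p, hp using Nat.le_induction with
  | base => exact h
  | succ p _ ih =>
    rw [thetaSeq, nextTheta]
    exact (if_pos ih).symm ▸ ih

lemma sampledAt_subset (p : ℕ) : sampledAt I H l ρs p ⊆ uncoveredAt I H l ρs p := by
  classical
  rw [sampledAt, sampledSet, uncoveredAt]
  convert filter_subset _ _

lemma uncoveredAt_succ (p : ℕ) : uncoveredAt I H l ρs (p + 1) ⊆
    uncoveredAt I H l ρs p \ sampledAt I H l ρs p := by
  intro j hj
  have := (recorded_recordedAt p).uncovered_record (mem_byMachine _)
    (fun T hT => mem_inbox₀_fst I H hT) hj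
  rw [mem_filter] at this
  exact mem_sdiff.mpr ⟨this.1, fun h => this.2 (setsOf_mem_inbox₀ I H h)⟩

lemma getD_lt {ρ : Fin (numMachines m s) → List ℕ} (hρ : IsWords n m s ρ)
    (k : Fin (numMachines m s)) (t : ℕ) : (ρ k).getD t 0 < wordCap n m s := by
  rw [List.getD_eq_getElem?_getD]
  by_cases ht : t < (ρ k).length
  · rw [List.getElem?_eq_getElem ht]
    exact (hρ k).2 _ (List.getElem_mem ht)
  · rw [List.getElem?_eq_none (not_lt.mp ht)]
    exact NeZero.pos _

/-- All random words lie below the threshold, so every uncovered element is sampled with certainty.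
-/
lemma uncoveredAt_succ_eq_empty (hρ : ∀ r, IsWords n m s (ρs r)) {p : ℕ}
    (h : wordCap n m s ≤ thetaSeq n m s p) : uncoveredAt I H l ρs (p + 1) = ∅ := by
  classical
  have e : uncoveredAt I H l ρs p ⊆ sampledAt I H l ρs p := by
    intro j hj
    rw [sampledAt, mem_sampledSet]
    refine ⟨?_, (getD_lt (hρ _) _ _).trans_le h⟩
    simpa [uncoveredAt, uncovered] using hj
  rw [← Finset.subset_empty, ← Finset.sdiff_eq_empty_iff_subset.mpr e]
  exact uncoveredAt_succ p

/-- The first `p₀` phases go well. -/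
def Good (I : SetCover n m) (H : Placement n m s) (l p₀ : ℕ)
    (ρs : ℕ → Fin (numMachines m s) → List ℕ) : Prop :=
  ∀ p < p₀, (sampledAt I H l ρs p).card ≤ 9 * s ∧
    (uncoveredAt I H l ρs (p + 1)).card * thetaSeq n m s p ≤ 2 * n * wordCap n m s

lemma card_uncoveredAt_zero :
    (uncoveredAt I H l ρs 0).card * thetaSeq n m s 0 ≤ 4 * s * wordCap n m s := by
  refine (Nat.mul_le_mul_right _ ((Finset.card_le_univ _).trans (by simp))).trans
    (Nat.mul_div_le _ _)

/-- Passing to the next threshold multiplies the bound `2 * n * B` by `2 * s / n`, giving the bound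
`4 * s * B` that the sampling estimate needs. -/
lemma card_uncoveredAt_succ {p : ℕ} (hθ : thetaSeq n m s p < wordCap n m s)
    (h : (uncoveredAt I H l ρs (p + 1)).card * thetaSeq n m s p ≤ 2 * n * wordCap n m s) :
    (uncoveredAt I H l ρs (p + 1)).card * thetaSeq n m s (p + 1) ≤ 4 * s * wordCap n m s := by
  have e : thetaSeq n m s (p + 1) = 2 * s * thetaSeq n m s p / n := by
    rw [thetaSeq, nextTheta]
    exact if_neg (not_le.mpr hθ)
  rw [e]
  refine (Nat.mul_div_le_mul_div_assoc _ _ _).trans (Nat.div_le_of_le_mul ?_)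
  nlinarith

variable {p₀ : ℕ}

lemma Good.card_uncoveredAt (hρ : ∀ r, IsWords n m s (ρs r))
    (h : Good I H l p₀ ρs) (h1 : ∀ p < p₀, thetaSeq n m s p < wordCap n m s)
    (h2 : wordCap n m s ≤ thetaSeq n m s p₀) (p : ℕ) :
    (uncoveredAt I H l ρs p).card * thetaSeq n m s p ≤ 4 * s * wordCap n m s := by
  cases p with
  | zero => exact card_uncoveredAt_zero
  | succ p =>
    by_cases hp : p < p₀
    · exact card_uncoveredAt_succ (h1 p hp) (h p hp).2
    · rw [uncoveredAt_succ_eq_empty hρ (le_thetaSeq h2 (not_lt.mp hp))]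
      simp

/-- From phase `p₀` on the threshold is at least the word capacity `B`, so `|U| * θ ≤ 4 * s * B`
forces `|U| ≤ 4 * s`. Sampling everything is then affordable without any randomness. -/
lemma Good.card_sampledAt (hρ : ∀ r, IsWords n m s (ρs r))
    (h : Good I H l p₀ ρs) (h1 : ∀ p < p₀, thetaSeq n m s p < wordCap n m s)
    (h2 : wordCap n m s ≤ thetaSeq n m s p₀) (p : ℕ) :
    (sampledAt I H l ρs p).card ≤ 9 * s := by
  by_cases hp : p < p₀
  · exact (h p hp).1
  · have h3 := h.card_uncoveredAt hρ h1 h2 p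
    have h4 := Nat.mul_le_mul_left (uncoveredAt I H l ρs p).card (le_thetaSeq h2 (not_lt.mp hp))
    have h5 := Nat.le_of_mul_le_mul_right (h4.trans h3) (NeZero.pos _)
    have h6 := Finset.card_le_card (sampledAt_subset (I := I) (H := H) (l := l) (ρs := ρs) p)
    omega

variable {Cs : ℕ → Config randomizedLocalRatio (numMachines m s)} {L : ℕ}

/-- After phase `p₀` nothing is uncovered, and phases continue idly. A round may fall inside a
phase, but the choices before and after that phase are then both covers, so the run may stop
anywhere. -/
lemma Good.run (hCs : ∀ r, Cs (r + 1) = randomizedLocalRatio.next (Cs r) (ρs r))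
    (hρ : ∀ r, IsWords n m s (ρs r)) (hm : 1 ≤ m) (hns : n ≤ s)
    (hC0 : Cs 0 = ⟨fun k => initC.eval (localInput I H k), fun _ => []⟩)
    (hL : ∀ i < L, s ^ i < numMachines m s) (hL' : numMachines m s ≤ s ^ L)
    (h : Good I H (3 * L + 3) p₀ ρs) (h1 : ∀ p < p₀, thetaSeq n m s p < wordCap n m s)
    (h2 : wordCap n m s ≤ thetaSeq n m s p₀) (r : ℕ) :
    Fits I (Cs r) (ρs r) ∧ ((p₀ + 1) * (3 * L + 3) ≤ r → ∃ E, Recorded I (idx H) E ∧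
      uncovered I (idx H) E = ∅ ∧ Shows I H (Cs r) E) := by
  have hQ := h.card_sampledAt hρ h1 h2
  have hphase : ∀ p, AtSample I H (Cs (p * (3 * L + 3))) (thetaSeq n m s p)
      (recordedAt I H (3 * L + 3) ρs p) := by
    intro p
    induction p with
    | zero =>
      -- At the start all machines are informed: all weights are positive, so no set is chosen yet.
      refine ⟨1, fun _ => [], fun k => ?_, ?_, fun k => ⟨List.nodup_nil, ?_⟩, fun k => ?_⟩
      · rw [zero_mul, hC0]
        rw [recordedAt, ite_self]
        rfl
      · have := two_mul_lt_wordCap_sq n m s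
        omega
      · rw [recordedAt, chosen_nil (mem_byMachine _)]
        simp
      · rw [zero_mul, hC0]
    | succ p ih =>
      have := (ih.phase hCs hρ hm hns (recorded_recordedAt p) (thetaSeq_le p) (hQ p) hL hL').2
      rwa [← Nat.succ_mul] at this
  have hp := (hphase (r / (3 * L + 3))).phase hCs hρ hm hns (recorded_recordedAt _)
    (thetaSeq_le _) (hQ _) hL hL'
  have hr := hp.1 (r % (3 * L + 3)) (Nat.mod_lt _ (by omega))
  rw [Nat.div_add_mod'] at hr
  refine ⟨hr.1, fun hle => ?_⟩
  have hle' : p₀ + 1 ≤ r / (3 * L + 3) := (Nat.le_div_iff_mul_le (by omega)).mpr hle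
  have hU : ∀ p, p₀ + 1 ≤ p → uncoveredAt I H (3 * L + 3) ρs p = ∅ := by
    intro p hp
    obtain ⟨p', rfl⟩ := Nat.exists_eq_add_of_le' (show 1 ≤ p by omega)
    exact uncoveredAt_succ_eq_empty hρ (le_thetaSeq h2 (by omega))
  rcases hr.2 with h3 | h3
  · exact ⟨_, recorded_recordedAt _, hU _ hle', h3⟩
  · exact ⟨_, recorded_recordedAt (r / (3 * L + 3) + 1), hU _ (by omega), h3⟩

/-! ## The success probability -/

variable {R : ℕ}

lemma Tape.words_of_lt (ω : Tape n m s R) {r : ℕ} (h : r < R) :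
    ω.words r = Row.words (ω ⟨r, h⟩) := by
  funext k
  rw [Tape.words, dif_pos h]
  rfl

lemma Tape.isWords (ω : Tape n m s R) (r : ℕ) : IsWords n m s (ω.words r) := by
  intro k
  rw [Tape.words]
  split_ifs with h
  · refine ⟨by simp, fun x hx => ?_⟩
    rw [List.mem_ofFn] at hx
    obtain ⟨t, rfl⟩ := hx
    exact Fin.is_lt _
  · simp

lemma Tape.words_update (ω : Tape n m s R) {r r' : ℕ} (h : r < R) (hr : r' ≠ r) (σ : Row n m s) :
    Tape.words (Function.update ω ⟨r, h⟩ σ) r' = ω.words r' := by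
  funext k
  rw [Tape.words, Tape.words]
  split_ifs with h'
  · rw [Function.update_of_ne]
    simpa [Fin.ext_iff] using hr
  · rfl

lemma recordedAt_update (ω : Tape n m s R) (hl : 0 < l) {p : ℕ} (hp : p * l < R)
    (σ : Row n m s) :
    recordedAt I H l (Tape.words (Function.update ω ⟨p * l, hp⟩ σ)) p =
      recordedAt I H l ω.words p := by
  refine recordedAt_congr fun p' hp' => ω.words_update hp ?_ σ
  exact (Nat.mul_lt_mul_of_pos_right hp' hl).ne

lemma words_update_self (ω : Tape n m s R) {r : ℕ} (hr : r < R) (σ : Row n m s) :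
    Tape.words (Function.update ω ⟨r, hr⟩ σ) r = σ.words := by
  rw [Tape.words_of_lt _ hr, Function.update_self]

open Classical in
lemma card_not_good_le (hns : n ≤ s) (hl : 0 < l)
    (h1 : ∀ p < p₀, thetaSeq n m s p < wordCap n m s) (hR : p₀ * l ≤ R) :
    ((univ.filter fun ω : Tape n m s R => ¬ Good I H l p₀ ω.words).card : ℝ) ≤
      2 * p₀ * Real.exp (-n) * Fintype.card (Tape n m s R) := by
  -- The bound on the uncovered set is built into the event. For a fixed past it either fails, and
  -- the event is empty, or it is available for the tail estimate.
  let bad₁ (p : ℕ) := univ.filter fun ω : Tape n m s R =>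
    (uncoveredAt I H l ω.words p).card * thetaSeq n m s p ≤ 4 * s * wordCap n m s ∧
      9 * s < (sampledAt I H l ω.words p).card
  let bad₂ (p : ℕ) := univ.filter fun ω : Tape n m s R => 2 * n * wordCap n m s <
    (uncoveredAt I H l ω.words (p + 1)).card * thetaSeq n m s p
  have hpR : ∀ p < p₀, p * l < R := fun p hp =>
    (Nat.mul_lt_mul_of_pos_right hp hl).trans_le hR
  have hb₁ : ∀ p < p₀, ((bad₁ p).card : ℝ) ≤ Real.exp (-n) * Fintype.card (Tape n m s R) := by
    intro p hp
    refine card_le_of_row ⟨p * l, hpR p hp⟩ _ fun (ω : Tape n m s R) => ?_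
    simp only [uncoveredAt, sampledAt, recordedAt_update ω hl (hpR p hp), words_update_self]
    by_cases hU : (uncovered I (idx H) (recordedAt I H l ω.words p)).card * thetaSeq n m s p ≤
      4 * s * wordCap n m s
    · simp only [hU, true_and]
      exact card_large_sample_le I H (h1 p hp).le hns hU
    · simp only [hU, false_and, Finset.filter_false, Finset.card_empty, Nat.cast_zero]
      positivity
  have hb₂ : ∀ p < p₀, ((bad₂ p).card : ℝ) ≤ Real.exp (-n) * Fintype.card (Tape n m s R) := by
    intro p hp
    refine card_le_of_row ⟨p * l, hpR p hp⟩ _ fun (ω : Tape n m s R) => ?_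
    simp only [uncoveredAt, recordedAt, recordedAt_update ω hl (hpR p hp), words_update_self]
    exact card_large_rest_le I H (h1 p hp).le (recorded_recordedAt p)
  have hsub : (univ.filter fun ω : Tape n m s R => ¬ Good I H l p₀ ω.words) ⊆
      (Finset.range p₀).biUnion fun p => bad₁ p ∪ bad₂ p := by
    intro ω hω
    by_contra hnot
    simp only [mem_biUnion, mem_range, mem_union, mem_filter, mem_univ, true_and, bad₁, bad₂,
      not_exists, not_and, not_or, not_lt] at hnot hω
    -- Avoiding `bad₂` in the previous phase supplies the condition built into `bad₁`; for the first
    -- phase it holds by the choice of the initial threshold.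
    refine hω fun p hp => ⟨(hnot p hp).1 ?_, (hnot p hp).2⟩
    cases p with
    | zero => exact card_uncoveredAt_zero
    | succ p => exact card_uncoveredAt_succ (h1 p (by omega)) (hnot p (by omega)).2
  calc _ ≤ (((Finset.range p₀).biUnion fun p => bad₁ p ∪ bad₂ p).card : ℝ) := by
        exact_mod_cast Finset.card_le_card hsub
    _ ≤ ∑ p ∈ Finset.range p₀, ((bad₁ p ∪ bad₂ p).card : ℝ) := by
        exact_mod_cast Finset.card_biUnion_le
    _ ≤ ∑ _p ∈ Finset.range p₀, 2 * (Real.exp (-n) * Fintype.card (Tape n m s R)) := by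
        refine Finset.sum_le_sum fun p hp => ?_
        have h3 : ((bad₁ p ∪ bad₂ p).card : ℝ) ≤ (bad₁ p).card + (bad₂ p).card := by
          exact_mod_cast Finset.card_union_le _ _
        linarith [hb₁ p (mem_range.mp hp), hb₂ p (mem_range.mp hp)]
    _ = _ := by
        rw [Finset.sum_const, Finset.card_range, nsmul_eq_mul]
        ring

lemma Good.success (ω : Tape n m s R) (hm : 1 ≤ m) (hns : n ≤ s)
    (hL : ∀ i < L, s ^ i < numMachines m s) (hL' : numMachines m s ≤ s ^ L)
    (h : Good I H (3 * L + 3) p₀ ω.words) (h1 : ∀ p < p₀, thetaSeq n m s p < wordCap n m s)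
    (h2 : wordCap n m s ≤ thetaSeq n m s p₀) (hR : (p₀ + 1) * (3 * L + 3) ≤ R) {σ τ : ℝ}
    (hinit : ∀ x, inputTy.size (wordCap n m s) x ≤ sizeBound I s →
      (randomizedLocalRatio.init.space (wordCap n m s) x : ℝ) ≤ σ ∧
        (randomizedLocalRatio.init.time x : ℝ) ≤ τ)
    (hstep : ∀ x, inTy.size (wordCap n m s) x ≤ sizeBound I s →
      Admissible (wordCap n m s) (sizeBound I s) x →
      (randomizedLocalRatio.step.space (wordCap n m s) x : ℝ) ≤ σ ∧
        (randomizedLocalRatio.step.time x : ℝ) ≤ τ)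
    (hout : ∀ x, stTy.size (wordCap n m s) x ≤ sizeBound I s →
      (randomizedLocalRatio.output.space (wordCap n m s) x : ℝ) ≤ σ ∧
        (randomizedLocalRatio.output.time x : ℝ) ≤ τ) :
    randomizedLocalRatio.Respects I H ω σ τ ∧
      I.IsApprox I.maxFreq (randomizedLocalRatio.result I H ω) := by
  have hrun := h.run (Cs := randomizedLocalRatio.run I H ω) (fun r => rfl) ω.isWords hm hns rfl
    hL hL' h1 h2
  refine ⟨⟨fun k => hinit _ ?_, fun r _ k => ?_, hout _ ?_⟩, ?_⟩
  · refine (size_localInput_le hm k).trans ?_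
    have hn := one_le_of_feasible I hm
    have hf := Nat.mul_le_mul_left s (one_le_maxFreq I hm)
    unfold sizeBound
    nlinarith
  · obtain ⟨h3, h4⟩ := (hrun r).1 k
    exact hstep _ h3 h4
  · refine le_trans ?_ ((hrun R).1 0).1
    rw [Algorithm.stepInput, Ty.size_prod]
    exact Nat.le_add_right _ _
  · obtain ⟨E, hE, hU, hX⟩ := (hrun R).2 hR
    refine hE.isApprox (mem_byMachine _) hU fun i => ?_
    rw [← hX.2, Algorithm.result, mem_filter]
    simp only [mem_univ, true_and, eval_comp, eval_prim, Prim.eval]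

lemma successProb_ge (I : SetCover n m) (H : Placement n m s) (hm : 1 ≤ m) (hns : n ≤ s)
    (hL : ∀ i < L, s ^ i < numMachines m s) (hL' : numMachines m s ≤ s ^ L)
    (h1 : ∀ p < p₀, thetaSeq n m s p < wordCap n m s)
    (h2 : wordCap n m s ≤ thetaSeq n m s p₀) (hR : (p₀ + 1) * (3 * L + 3) ≤ R) {σ τ : ℝ}
    (hinit : ∀ x, inputTy.size (wordCap n m s) x ≤ sizeBound I s →
      (randomizedLocalRatio.init.space (wordCap n m s) x : ℝ) ≤ σ ∧
        (randomizedLocalRatio.init.time x : ℝ) ≤ τ)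
    (hstep : ∀ x, inTy.size (wordCap n m s) x ≤ sizeBound I s →
      Admissible (wordCap n m s) (sizeBound I s) x →
      (randomizedLocalRatio.step.space (wordCap n m s) x : ℝ) ≤ σ ∧
        (randomizedLocalRatio.step.time x : ℝ) ≤ τ)
    (hout : ∀ x, stTy.size (wordCap n m s) x ≤ sizeBound I s →
      (randomizedLocalRatio.output.space (wordCap n m s) x : ℝ) ≤ σ ∧
        (randomizedLocalRatio.output.time x : ℝ) ≤ τ) :
    1 - 2 * p₀ * Real.exp (-n) ≤ randomizedLocalRatio.successProb I H R σ τ I.maxFreq := by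
  classical
  have hT : (0 : ℝ) < Fintype.card (Tape n m s R) := by exact_mod_cast Fintype.card_pos
  have hbad := card_not_good_le (I := I) (H := H) (l := 3 * L + 3) (R := R) hns (by omega) h1
    (by nlinarith)
  rw [Algorithm.successProb, Nat.card_eq_fintype_card, Nat.card_eq_fintype_card,
    Fintype.card_subtype, le_div_iff₀ hT]
  have hgood : ((univ.filter fun ω : Tape n m s R => Good I H (3 * L + 3) p₀ ω.words).card : ℝ) ≤
      (univ.filter fun ω : Tape n m s R => randomizedLocalRatio.Respects I H ω σ τ ∧
        I.IsApprox I.maxFreq (randomizedLocalRatio.result I H ω)).card := by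
    exact_mod_cast Finset.card_le_card (Finset.monotone_filter_right _ fun ω _ hω =>
      Good.success ω hm hns hL hL' hω h1 h2 hR hinit hstep hout)
  have hsum : ((univ.filter fun ω : Tape n m s R => Good I H (3 * L + 3) p₀ ω.words).card : ℝ) +
      (univ.filter fun ω : Tape n m s R => ¬ Good I H (3 * L + 3) p₀ ω.words).card =
      Fintype.card (Tape n m s R) := by
    rw [← Finset.card_univ, ← Finset.card_filter_add_card_filter_not
      (s := univ) (fun ω : Tape n m s R => Good I H (3 * L + 3) p₀ ω.words)]
    push_cast
    rfl
  linarith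

end MapReduce

namespace MapReduce

open Ty Code

/-! ## Numerical bounds -/

section Numerics

variable {n m : ℕ} {c μ : ℝ}

lemma le_memUnit (n : ℕ) (μ : ℝ) : (n : ℝ) ^ (1 + μ) ≤ memUnit n μ := Nat.le_ceil _

lemma le_memUnit_of_pos (hn : 1 ≤ n) (hμ : 0 < μ) : n ≤ memUnit n μ := by
  have h1 : (1 : ℝ) ≤ n := by exact_mod_cast hn
  have h2 : (n : ℝ) ≤ (n : ℝ) ^ (1 + μ) := by
    simpa using Real.rpow_le_rpow_of_exponent_le h1 (show (1 : ℝ) ≤ 1 + μ by linarith)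
  exact_mod_cast h2.trans (le_memUnit n μ)

lemma memUnit_le (hn : 1 ≤ n) (hμ : 0 < μ) : (memUnit n μ : ℝ) ≤ 2 * (n : ℝ) ^ (1 + μ) := by
  have h1 : (1 : ℝ) ≤ n := by exact_mod_cast hn
  have h2 : (1 : ℝ) ≤ (n : ℝ) ^ (1 + μ) := Real.one_le_rpow h1 (by linarith)
  have := (Nat.ceil_lt_add_one (zero_le_one.trans h2)).le
  unfold memUnit
  linarith

/-- `(1 + μ) * (⌊c / μ⌋ + 1) ≥ 1 + c`, so this power of the memory unit exceeds even `m`. -/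
lemma exists_relay (hn : 1 ≤ n) (hμ : 0 < μ) (hc : μ < c) (hm : 1 ≤ m)
    (hmn : (m : ℝ) ≤ (n : ℝ) ^ (1 + c)) :
    numMachines m (memUnit n μ) ≤ memUnit n μ ^ (⌊c / μ⌋₊ + 1) := by
  have h1 : (1 : ℝ) ≤ n := by exact_mod_cast hn
  have hx : 1 ≤ c / μ := (one_le_div hμ).mpr hc.le
  have hfl := Nat.lt_floor_add_one (c / μ)
  refine (numMachines_le hm).trans ?_
  have h2 : (m : ℝ) ≤ (memUnit n μ : ℝ) ^ (⌊c / μ⌋₊ + 1) := by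
    calc (m : ℝ) ≤ (n : ℝ) ^ (1 + c) := hmn
      _ ≤ (n : ℝ) ^ ((1 + μ) * ((⌊c / μ⌋₊ + 1 : ℕ) : ℝ)) := by
          refine Real.rpow_le_rpow_of_exponent_le h1 ?_
          push_cast
          have h3 : μ * (c / μ) = c := by field_simp
          nlinarith
      _ = ((n : ℝ) ^ (1 + μ)) ^ (⌊c / μ⌋₊ + 1) := by
          rw [Real.rpow_mul (by linarith), Real.rpow_natCast]
      _ ≤ _ := pow_le_pow_left₀ (by positivity) (le_memUnit n μ) _
  exact_mod_cast h2

/-- Each `I.T j` is nonempty with at most two members, hence of the form `{a, b}` for a pair of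
vertices, and there are no parallel edges. -/
lemma card_le_sq_of_isVertexCoverInstance {I : SetCover n m} (h : I.IsVertexCoverInstance) :
    m ≤ n * n := by
  have h1 : (univ : Finset (Fin m)).image I.T ⊆
      (univ : Finset (Fin n × Fin n)).image fun x => {x.1, x.2} := by
    intro Y hY
    obtain ⟨j, _, rfl⟩ := mem_image.mp hY
    obtain ⟨i, hi⟩ := I.feasible j
    have : Nonempty (Fin n) := ⟨i⟩
    have hi' : i ∈ I.T j := by simp [SetCover.T, hi]
    have h2 : (I.T j).card ≤ 2 :=
      h.1 ▸ Finset.le_sup (f := fun j => (I.T j).card) (mem_univ j)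
    have h3 : ((I.T j).erase i).card ≤ 1 := by
      rw [Finset.card_erase_of_mem hi']
      omega
    rcases Finset.card_le_one_iff_subset_singleton.mp h3 with ⟨i', hi''⟩
    rw [mem_image]
    rcases Finset.subset_singleton_iff.mp hi'' with h4 | h4
    · exact ⟨(i, i), mem_univ _, by
        rw [← Finset.insert_erase hi', h4]
        simp⟩
    · exact ⟨(i, i'), mem_univ _, by
        rw [← Finset.insert_erase hi', h4]⟩
  have h2 := (Finset.card_le_card h1).trans Finset.card_image_le
  rw [Finset.card_image_of_injective _ h.2] at h2
  simpa using h2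

lemma numMachines_le_of_le_sq {s : ℕ} (hs : 1 ≤ s) (hm : m ≤ s * s) (hm1 : 1 ≤ m) :
    numMachines m s ≤ s := by
  unfold numMachines
  have : (m - 1) / s < s := by
    rw [Nat.div_lt_iff_lt_mul (by omega)]
    omega
  omega

/-- Rounding down costs at most a factor of two here. The factor `2` in `nextTheta` and the spare
factor in the initial threshold absorb these losses. -/
lemma half_le_floor_div {a b : ℕ} (hb : 0 < b) (h : b ≤ a) :
    (a : ℝ) / (2 * b) ≤ (a / b : ℕ) := by
  have hb' : (0 : ℝ) < b := by exact_mod_cast hb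
  have h1 : 1 ≤ a / b := (Nat.one_le_div_iff hb).mpr h
  have h2 : a < 2 * b * (a / b) := by
    have := Nat.div_add_mod a b
    have h3 := Nat.mod_lt a hb
    nlinarith
  rw [div_le_iff₀ (by positivity)]
  have h3 : (a : ℝ) ≤ 2 * b * (a / b : ℕ) := by exact_mod_cast h2.le
  linarith

/-- As long as the word capacity `B` is not reached, each phase gains a factor of at least `n ^ μ`
over the initial `B * n ^ (μ - c)`. -/
lemma exists_le_thetaSeq (hn : 1 ≤ n) (hμ : 0 < μ) (hm : 1 ≤ m)
    (hmn : (m : ℝ) ≤ (n : ℝ) ^ (1 + c)) :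
    ∃ p ≤ ⌊c / μ⌋₊, wordCap n m (memUnit n μ) ≤ thetaSeq n m (memUnit n μ) p := by
  have h1 : (1 : ℝ) ≤ n := by exact_mod_cast hn
  have h0 : (0 : ℝ) < n := by linarith
  by_contra! hcon
  have hs := le_memUnit n μ
  have hns := le_memUnit_of_pos hn hμ
  set s := memUnit n μ
  have hs1 : 1 ≤ s := hn.trans hns
  have hBpos : (0 : ℝ) < wordCap n m s := by exact_mod_cast NeZero.pos (wordCap n m s)
  have hmpos : (0 : ℝ) < m := by exact_mod_cast hm
  have hxn : (n : ℝ) ^ (1 + μ) = n * (n : ℝ) ^ μ := by rw [Real.rpow_add h0, Real.rpow_one]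
  have hx1 : (1 : ℝ) ≤ (n : ℝ) ^ μ := Real.one_le_rpow h1 hμ.le
  have key : ∀ p ≤ ⌊c / μ⌋₊, 1 ≤ thetaSeq n m s p ∧
      (wordCap n m s : ℝ) * ((n : ℝ) ^ (μ - c) * ((n : ℝ) ^ μ) ^ p) ≤ thetaSeq n m s p := by
    intro p
    induction p with
    | zero =>
      intro _
      have hmB : m ≤ 4 * s * wordCap n m s := by
        unfold wordCap
        nlinarith
      refine ⟨(Nat.one_le_div_iff hm).mpr hmB, ?_⟩
      refine le_trans ?_ (half_le_floor_div hm hmB)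
      rw [pow_zero, mul_one, le_div_iff₀ (by positivity)]
      have h2 : (n : ℝ) ^ (μ - c) * m ≤ s := by
        calc (n : ℝ) ^ (μ - c) * m ≤ (n : ℝ) ^ (μ - c) * (n : ℝ) ^ (1 + c) :=
              mul_le_mul_of_nonneg_left hmn (by positivity)
          _ = (n : ℝ) ^ (1 + μ) := by rw [← Real.rpow_add h0]; congr 1; ring
          _ ≤ s := hs
      have h3 := mul_le_mul_of_nonneg_left h2 hBpos.le
      have h4 : (0 : ℝ) ≤ wordCap n m s * s := by positivity
      push_cast
      nlinarith
    | succ p ih =>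
      intro hp
      obtain ⟨ih1, ih2⟩ := ih (by omega)
      have e : thetaSeq n m s (p + 1) = 2 * s * thetaSeq n m s p / n := by
        rw [thetaSeq, nextTheta]
        exact if_neg (not_le.mpr (hcon p (by omega)))
      have hle : n ≤ 2 * s * thetaSeq n m s p := by nlinarith
      refine ⟨e ▸ (Nat.one_le_div_iff hn).mpr hle, ?_⟩
      rw [e]
      refine le_trans ?_ (half_le_floor_div hn hle)
      rw [le_div_iff₀ (by positivity)]
      push_cast
      calc (wordCap n m s : ℝ) * ((n : ℝ) ^ (μ - c) * ((n : ℝ) ^ μ) ^ (p + 1)) * (2 * n)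
          = 2 * (n * (n : ℝ) ^ μ) *
            ((wordCap n m s : ℝ) * ((n : ℝ) ^ (μ - c) * ((n : ℝ) ^ μ) ^ p)) := by ring
        _ ≤ 2 * (n * (n : ℝ) ^ μ) * thetaSeq n m s p :=
            mul_le_mul_of_nonneg_left ih2 (by positivity)
        _ ≤ 2 * s * thetaSeq n m s p := by
            refine mul_le_mul_of_nonneg_right ?_ (Nat.cast_nonneg _)
            rw [← hxn]
            linarith
  have hfin := (key _ le_rfl).2
  have hlt := hcon _ le_rfl
  -- The exponent `μ - c + μ * ⌊c / μ⌋` is nonnegative, since `⌊c / μ⌋ + 1 ≥ c / μ`.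
  have h5 : (1 : ℝ) ≤ (n : ℝ) ^ (μ - c) * ((n : ℝ) ^ μ) ^ ⌊c / μ⌋₊ := by
    rw [← Real.rpow_natCast, ← Real.rpow_mul h0.le, ← Real.rpow_add h0]
    refine Real.one_le_rpow h1 ?_
    have h6 := (Nat.lt_floor_add_one (c / μ)).le
    have h7 : μ * (c / μ) = c := by field_simp
    nlinarith
  have h8 : (wordCap n m s : ℝ) ≤ thetaSeq n m s ⌊c / μ⌋₊ :=
    (le_mul_of_one_le_right hBpos.le h5).trans hfin
  exact absurd (by exact_mod_cast h8) (not_le.mpr hlt)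

end Numerics

/-- The exponent and factor for the costs of a code with linear bounds. -/
def costExponent (C : ℕ) : ℕ := 120 * C + (60 * C + 3) * C + 18

lemma maxFreq_le {n m : ℕ} (I : SetCover n m) : I.maxFreq ≤ n :=
  Finset.sup_le fun _ _ => (Finset.card_le_univ _).trans (by simp)

/-- The space constant `120` is `60` from `sizeBound` times `2` for rounding up the memory unit. For
the time, `I.maxFreq * s` is below the square of the word capacity, and a constant factor is
absorbed by a further power of it. -/
lemma Cost.bounds {n m : ℕ} {μ : ℝ} {I : SetCover n m} (hn : 1 ≤ n) (hμ : 0 < μ) {C : ℕ}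
    {a b : Ty} {p : Code a b} {x : a.den}
    (h : Cost (wordCap n m (memUnit n μ)) (sizeBound I (memUnit n μ)) C p x) :
    (p.space (wordCap n m (memUnit n μ)) x : ℝ) ≤
        costExponent C * (I.maxFreq * (n : ℝ) ^ (1 + μ)) ∧
      (p.time x : ℝ) ≤ (wordCap n m (memUnit n μ) : ℝ) ^ costExponent C := by
  have hs := memUnit_le hn hμ
  have hf := maxFreq_le I
  constructor
  · calc (p.space (wordCap n m (memUnit n μ)) x : ℝ)
        ≤ ((C * (60 * (I.maxFreq * memUnit n μ)) : ℕ) : ℝ) := by exact_mod_cast h.space_le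
      _ = C * 60 * (I.maxFreq * memUnit n μ) := by push_cast; ring
      _ ≤ C * 60 * (I.maxFreq * (2 * (n : ℝ) ^ (1 + μ))) := by gcongr
      _ = (120 * C : ℕ) * (I.maxFreq * (n : ℝ) ^ (1 + μ)) := by push_cast; ring
      _ ≤ _ := by
          refine mul_le_mul_of_nonneg_right ?_ (by positivity)
          exact_mod_cast show 120 * C ≤ costExponent C by unfold costExponent; omega
  · generalize memUnit n μ = s at h
    have hB : 1 ≤ wordCap n m s := by unfold wordCap; omega
    have hB2 : 2 ≤ wordCap n m s := by unfold wordCap; omega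
    have h1 : I.maxFreq * s ≤ wordCap n m s ^ 2 := by
      rw [sq]
      exact Nat.mul_le_mul (by unfold wordCap; omega) (by unfold wordCap; omega)
    have h2 : C * sizeBound I s + 1 ≤ wordCap n m s ^ (60 * C + 3) := by
      calc C * sizeBound I s + 1 ≤ 60 * C * wordCap n m s ^ 2 + wordCap n m s ^ 2 := by
            have := Nat.mul_le_mul_left (60 * C) h1
            have := Nat.one_le_pow 2 _ hB
            unfold sizeBound
            nlinarith
        _ = (60 * C + 1) * wordCap n m s ^ 2 := by ring
        _ ≤ wordCap n m s ^ (60 * C + 1) * wordCap n m s ^ 2 :=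
            Nat.mul_le_mul_right _ (Nat.lt_two_pow_self.le.trans (Nat.pow_le_pow_left hB2 _))
        _ = _ := by rw [← pow_add]
    have h3 : p.time x ≤ wordCap n m s ^ costExponent C := by
      refine (h.time_le.trans (Nat.pow_le_pow_left h2 C)).trans ?_
      rw [← pow_mul]
      exact Nat.pow_le_pow_right hB (by unfold costExponent; omega)
    exact_mod_cast h3

/-- The rounds, the memory and the success probability of randomized local ratio. -/
theorem randomizedLocalRatio_successProb :
    ∃ K : ℕ, ∀ (c μ : ℝ), 0 < μ → μ < c →
      ∀ (n m : ℕ) (I : SetCover n m), 1 ≤ m → (m : ℝ) ≤ (n : ℝ) ^ (1 + c) →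
      ∀ H : Placement n m (memUnit n μ),
        (I.IsVertexCoverInstance →
          1 - K * (c / μ) * Real.exp (-(n : ℝ)) ≤
            randomizedLocalRatio.successProb I H ⌊K * (c / μ)⌋₊
              (K * (I.maxFreq * (n : ℝ) ^ (1 + μ)))
              ((wordCap n m (memUnit n μ) : ℝ) ^ K) I.maxFreq) ∧
        1 - K * (c / μ) * Real.exp (-(n : ℝ)) ≤
          randomizedLocalRatio.successProb I H ⌊K * (c / μ) ^ 2⌋₊
            (K * (I.maxFreq * (n : ℝ) ^ (1 + μ)))
            ((wordCap n m (memUnit n μ) : ℝ) ^ K) I.maxFreq := by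
  classical
  obtain ⟨C₁, hC₁⟩ := Code.stepC_cost
  obtain ⟨C₂, hC₂⟩ := Code.Lin.cost (p := randomizedLocalRatio.init)
  obtain ⟨C₃, hC₃⟩ := Code.Lin.cost (p := randomizedLocalRatio.output)
  set C := C₁ + C₂ + C₃
  refine ⟨costExponent C, fun c μ hμ hc n m I hm hmn H => ?_⟩
  have hn := one_le_of_feasible I hm
  have hns := le_memUnit_of_pos hn hμ
  have hx : 1 ≤ c / μ := (one_le_div hμ).mpr hc.le
  have hK : (18 : ℝ) ≤ costExponent C := by
    exact_mod_cast show 18 ≤ costExponent C by unfold costExponent; omega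
  have hfl : (⌊c / μ⌋₊ : ℝ) ≤ c / μ := Nat.floor_le (by linarith)
  have hB : 2 ≤ wordCap n m (memUnit n μ) := by unfold wordCap; omega
  have hex := exists_le_thetaSeq hn hμ hm hmn
  have hex' : ∃ p, wordCap n m (memUnit n μ) ≤ thetaSeq n m (memUnit n μ) p :=
    hex.imp fun p hp => hp.2
  have hp₀ : Nat.find hex' ≤ ⌊c / μ⌋₊ := by
    obtain ⟨p, hp, hθ⟩ := hex
    exact (Nat.find_min' hex' hθ).trans hp
  have hlow : ∀ p < Nat.find hex', thetaSeq n m (memUnit n μ) p < wordCap n m (memUnit n μ) :=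
    fun p hp => not_le.mp (Nat.find_min hex' hp)
  have hrel : ∃ L, numMachines m (memUnit n μ) ≤ memUnit n μ ^ L :=
    ⟨_, exists_relay hn hμ hc hm hmn⟩
  have hmain : ∀ R, (Nat.find hex' + 1) * (3 * Nat.find hrel + 3) ≤ R →
      1 - costExponent C * (c / μ) * Real.exp (-(n : ℝ)) ≤
        randomizedLocalRatio.successProb I H R
          (costExponent C * (I.maxFreq * (n : ℝ) ^ (1 + μ)))
          ((wordCap n m (memUnit n μ) : ℝ) ^ costExponent C) I.maxFreq := by
    intro R hR
    refine le_trans ?_ (successProb_ge I H hm hns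
      (fun i hi => not_le.mp (Nat.find_min hrel hi)) (Nat.find_spec hrel) hlow
      (Nat.find_spec hex') hR
      (fun x hx => Cost.bounds hn hμ ((hC₂ _ hB _ x hx).mono le_rfl (by omega)))
      (fun x hx hx' => Cost.bounds hn hμ ((hC₁ _ hB _ x hx hx').mono le_rfl (by omega)))
      (fun x hx => Cost.bounds hn hμ ((hC₃ _ hB _ x hx).mono le_rfl (by omega))))
    have h1 : (Nat.find hex' : ℝ) ≤ c / μ := le_trans (by exact_mod_cast hp₀) hfl
    refine sub_le_sub_left (mul_le_mul_of_nonneg_right ?_ (Real.exp_pos _).le) _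
    nlinarith
  have hp₁ : ((Nat.find hex' : ℝ) + 1) ≤ 2 * (c / μ) := by
    have h1 : (Nat.find hex' : ℝ) ≤ c / μ := le_trans (by exact_mod_cast hp₀) hfl
    linarith
  refine ⟨fun hvc => hmain _ (Nat.le_floor ?_), hmain _ (Nat.le_floor ?_)⟩
  -- For a graph `m ≤ n ^ 2 ≤ s ^ 2`, so there are at most `s` machines and one relay cycle reaches
  -- all of them. Every phase then has at most six rounds.
  · have hL : Nat.find hrel ≤ 1 := Nat.find_min' hrel (by
      rw [pow_one]
      exact numMachines_le_of_le_sq (hn.trans hns)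
        ((card_le_sq_of_isVertexCoverInstance hvc).trans (Nat.mul_le_mul hns hns)) hm)
    have hL' : (Nat.find hrel : ℝ) ≤ 1 := by exact_mod_cast hL
    push_cast
    calc ((Nat.find hex' : ℝ) + 1) * (3 * Nat.find hrel + 3) ≤ 2 * (c / μ) * (3 * 1 + 3) := by
          gcongr
      _ ≤ costExponent C * (c / μ) := by nlinarith
  · have hL : Nat.find hrel ≤ ⌊c / μ⌋₊ + 1 :=
      Nat.find_min' hrel (exists_relay hn hμ hc hm hmn)
    have hL' : (Nat.find hrel : ℝ) ≤ 2 * (c / μ) := by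
      have : (Nat.find hrel : ℝ) ≤ ⌊c / μ⌋₊ + 1 := by exact_mod_cast hL
      linarith
    push_cast
    calc ((Nat.find hex' : ℝ) + 1) * (3 * Nat.find hrel + 3)
        ≤ 2 * (c / μ) * (3 * (2 * (c / μ)) + 3 * (c / μ)) := by
          gcongr
          linarith
      _ = 18 * (c / μ) ^ 2 := by ring
      _ ≤ costExponent C * (c / μ) ^ 2 := mul_le_mul_of_nonneg_right hK (by positivity)

end MapReduce

theorem mainTheorem2 :
    ∃ (P : MapReduce.Algorithm) (K : ℕ), ∀ (c μ : ℝ), 0 < μ → μ < c →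
      ∀ (n m : ℕ) (I : SetCover n m), 1 ≤ m → (m : ℝ) ≤ (n : ℝ) ^ (1 + c) →
      ∀ H : MapReduce.Placement n m (MapReduce.memUnit n μ),
        (I.IsVertexCoverInstance →
          1 - K * (c / μ) * Real.exp (-(n : ℝ)) ≤
            P.successProb I H ⌊K * (c / μ)⌋₊
              (K * (I.maxFreq * (n : ℝ) ^ (1 + μ)))
              ((MapReduce.wordCap n m (MapReduce.memUnit n μ) : ℝ) ^ K) I.maxFreq) ∧
        1 - K * (c / μ) * Real.exp (-(n : ℝ)) ≤
          P.successProb I H ⌊K * (c / μ) ^ 2⌋₊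
            (K * (I.maxFreq * (n : ℝ) ^ (1 + μ)))
            ((MapReduce.wordCap n m (MapReduce.memUnit n μ) : ℝ) ^ K) I.maxFreq := by
  exact ⟨MapReduce.randomizedLocalRatio, MapReduce.randomizedLocalRatio_successProb⟩
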